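/- Let $m\ge 1$, let $(\Omega,\mathcal F,\mathbb P)$ be a probability space with a non-decreasing sequence of $\sigma$-algebras $\{\mathcal F_k\}_{k\ge 0}$, and write $\mathbb E_k\{\cdot\}=\mathbb E[\cdot\mid\mathcal F_k]$. Consider the model $$y_{k+1}=S_k(\phi_k^T\theta+e_{k+1}),\qquad S_k(x)=\begin{cases}L_k,&x<l_k,\\ x,&l_k\le x\le u_k,\\ U_k,&x>u_k,\end{cases}\qquad k=0,1,\dots,$$ with $\theta,\phi_k\in\mathbb R^m$ (the thresholds $l_k,L_k=-\infty$ and $u_k,U_k=+\infty$ are allowed). Assume: 1. $\{\phi_k\}$ is adapted to $\{\mathcal F_k\}$ and almost surely bounded in $k$; $\theta$ is an interior point of a known convex compact set $D\subseteq\mathbb R^m$. Let $\{M_k\}$ be an adapted, almost surely bounded real sequence with $\sup_{x\in D}|\phi_k^Tx|\le M_k$ a.s. for all $k$. 2. $\{l_k\},\{u_k\},\{L_k\},\{U_k\}$ are adapted and there are non-negative square-integrable random variables $c,l,u$ such that, a.s. for all $k\ge0$, $l_k-c\le L_k\le l_k\le u_k\le U_k\le u_k+c$, $\sup_k\max(l_k,0)\le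 l$ and $\sup_k\max(-u_k,0)\le u$. 3. $\{e_k,\mathcal F_k\}$ is a square-integrable martingale difference sequence and there is $\eta>0$ with $\inf_k\mathbb E_k\{|e_{k+1}|^2\}>0$ and $\sup_k\mathbb E_k\{|e_{k+1}|^{2+\eta}\}<\infty$ a.s. The function $G_k(x)=\mathbb E_k\{S_k(x+e_{k+1})\}$ (computed from the conditional law of $e_{k+1}$ given $\mathcal F_k$) is almost surely differentiable in $x$, and there are random variables $M>\sup_kM_k$ and $\rho\ge 0$ such that a.s. $0<\inf_{|x|\le M,k\ge0}G_k'(x)\le\sup_{|x|\le M,k\ge0}G_k'(x)<\infty$ and $|G_k'(x)-G_k'(y)|\le\rho|x-y|$ for all $k$ and all $|x|,|y|\le M$. Put $\underline g_k=\inf_{|x|\le M_k}G_k'(x)$, $\overline g_k=\sup_{|x|\le M_k}G_k'(x)$ and $\Pi_Q(x)=\arg\min_{y\in D}(x-y)^TQ(x-y)$. Let $\bar\theta_0,\hat\theta_0\in D$ and positive definite $\bar P_0,P_0\in\mathbb R^{m\times m}$ be arbitrary, let $\{\mu_k\}$ be any adapted process with $0<\inf_k\mu_k\le\sup_k\mu_k<\infty$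 a.s., and define for $k\ge0$ the two-step quasi-Newton (TSQN) estimates $$\begin{aligned}\bar\theta_{k+1}&=\Pi_{\bar P_{k+1}^{-1}}\{\bar\theta_k+\bar a_k\bar\beta_k\bar P_k\phi_k[y_{k+1}-G_k(\phi_k^T\bar\theta_k)]\},& \bar P_{k+1}&=\bar P_k-\bar a_k\bar\beta_k^2\bar P_k\phi_k\phi_k^T\bar P_k,\\ \bar\beta_k&=\min\Big\{\underline g_k,\frac1{2\overline g_k\phi_k^T\bar P_k\phi_k+1}\Big\},&\bar a_k&=\frac1{1+\bar\beta_k^2\phi_k^T\bar P_k\phi_k},\\ \hat\theta_{k+1}&=\Pi_{P_{k+1}^{-1}}\{\hat\theta_k+a_k\beta_kP_k\phi_k[y_{k+1}-G_k(\phi_k^T\hat\theta_k)]\},&P_{k+1}&=P_k-a_k\beta_k^2P_k\phi_k\phi_k^TP_k,\\ a_k&=\frac1{\mu_k+\beta_k^2\phi_k^TP_k\phi_k},\end{aligned}$$ where $\beta_k=\dfrac{G_k(\phi_k^T\bar\theta_k)-G_k(\phi_k^T\hat\theta_k)}{\phi_k^T\bar\theta_k-\phi_k^T\hat\theta_k}$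 if $\phi_k^T\hat\theta_k\ne\phi_k^T\bar\theta_k$, and $\beta_k=G_k'(\phi_k^T\hat\theta_k)$ otherwise. Let $R_k=(\mathbb E_k\{y_{k+1}\}-G_k(\phi_k^T\hat\theta_k))^2$ be the regret of the adaptive predictor, and let $\lambda_{\max}(k)$ be the largest eigenvalue of $\sum_{i=0}^k\phi_i\phi_i^T+\lambda_0I$, where $\lambda_0>\|P_0^{-1}\|$. Then, with no excitation condition, if $\lambda_0\ge1$, $$\sum_{i=1}^kR_i=O(\log\lambda_{\max}(k))\quad(k\to\infty)\quad\text{almost surely.}$$ If $\lambda_0<1$, the same bound, in the sense $\sum_{i=1}^kR_i=O(|\log\lambda_{\max}(k)|)$, holds for almost every sample path along which $\lambda_{\max}(k)$ does not converge to $1$. -/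

import Mathlib

open MeasureTheory ProbabilityTheory Filter Topology
open scoped Matrix

noncomputable section

namespace TSQN

/-! ### Conditional laws and conditional expectations -/

/-- The regular conditional distribution of the real random variable `X` given the sub-σ-algebra
`𝓖`, as a measure on `ℝ` for each sample point. -/
def condLaw {Ω : Type*} (𝓖 : MeasurableSpace Ω) {mΩ : MeasurableSpace Ω} (P : Measure Ω)
    [IsFiniteMeasure P] (X : Ω → ℝ) (ω : Ω) : Measure ℝ :=
  @condDistrib Ω Ω ℝ _ _ _ mΩ 𝓖 X id P _ ω

/-- The conditional expectation of `X` given `𝓖`: the mean of the conditional law. For integrable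
`X` it is the usual one (`condMean_ae_eq_condExp`); it also makes sense when `X` is only
integrable conditionally on `𝓖`. -/
def condMean {Ω : Type*} (𝓖 : MeasurableSpace Ω) {mΩ : MeasurableSpace Ω} (P : Measure Ω)
    [IsFiniteMeasure P] (X : Ω → ℝ) (ω : Ω) : ℝ :=
  ∫ t, t ∂(condLaw 𝓖 P X ω)

theorem condMean_ae_eq_condExp {Ω : Type*} {𝓖 : MeasurableSpace Ω} {mΩ : MeasurableSpace Ω}
    (h𝓖 : 𝓖 ≤ mΩ) {P : Measure Ω} [IsFiniteMeasure P] {X : Ω → ℝ} (hX : Integrable X P) :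
    condMean 𝓖 P X =ᵐ[P] P[X|𝓖] := by
  have h := @condExp_ae_eq_integral_condDistrib' Ω Ω mΩ P _ id 𝓖 ℝ _ _ _ _ _ _ X
    (measurable_id'' h𝓖) hX
  rw [MeasurableSpace.comap_id] at h
  exact h.symm

/-! ### The saturation function -/

/-- The saturation function with observable range `[l, u]` and outer values `L`, `U`.
The thresholds may be infinite; `L` is used only when some real `x` lies below `l`, and `U` only
when some real `x` lies above `u`. -/
def saturation (l u L U : EReal) (x : ℝ) : ℝ :=
  if (x : EReal) < l then L.toReal else if (x : EReal) ≤ u then x else U.toReal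

/-! ### The model -/

/-- The data of the model (no properties): a filtration `ℱ`, the true parameter `θ`, the known set
`D`, the regressors `φ k`, the noise `e (k + 1)`, the thresholds `l k`, `u k`, `L k`, `U k`, and
the bounds `M k` on `|φₖᵀ x|`, `x ∈ D`, that the algorithm uses. -/
structure Model (Ω : Type*) [mΩ : MeasurableSpace Ω] (m : ℕ) where
  ℱ : Filtration ℕ mΩ
  θ : Fin m → ℝ
  D : Set (Fin m → ℝ)
  φ : ℕ → Ω → Fin m → ℝ
  e : ℕ → Ω → ℝ
  l : ℕ → Ω → EReal
  u : ℕ → Ω → EReal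
  L : ℕ → Ω → EReal
  U : ℕ → Ω → EReal
  M : ℕ → Ω → ℝ

namespace Model

variable {Ω : Type*} [mΩ : MeasurableSpace Ω] {m : ℕ}

/-- The saturation function `Sₖ` at the sample point `ω`. -/
def S (𝓜 : Model Ω m) (k : ℕ) (ω : Ω) (x : ℝ) : ℝ :=
  saturation (𝓜.l k ω) (𝓜.u k ω) (𝓜.L k ω) (𝓜.U k ω) x

/-- The observation `y_{k+1} = Sₖ(φₖᵀ θ + e_{k+1})`. -/
def yNext (𝓜 : Model Ω m) (k : ℕ) (ω : Ω) : ℝ :=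
  𝓜.S k ω (𝓜.φ k ω ⬝ᵥ 𝓜.θ + 𝓜.e (k + 1) ω)

/-- The conditional law of the noise `e_{k+1}` given `ℱₖ`. -/
def noiseLaw (𝓜 : Model Ω m) (P : Measure Ω) [IsFiniteMeasure P] (k : ℕ) (ω : Ω) : Measure ℝ :=
  condLaw (𝓜.ℱ k) P (𝓜.e (k + 1)) ω

/-- The function `Gₖ(x) = 𝔼[Sₖ(x + e_{k+1}) | ℱₖ]`, in the version that is computed from the
conditional law of `e_{k+1}` given `ℱₖ` (the thresholds in `Sₖ` are `ℱₖ`-measurable); see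
`G_ae_eq_condExp`. -/
def G (𝓜 : Model Ω m) (P : Measure Ω) [IsFiniteMeasure P] (k : ℕ) (ω : Ω) (x : ℝ) : ℝ :=
  ∫ t, 𝓜.S k ω (x + t) ∂(𝓜.noiseLaw P k ω)

/-- `g̲ₖ = inf_{|x| ≤ Mₖ} Gₖ'(x)`. -/
def gLow (𝓜 : Model Ω m) (P : Measure Ω) [IsFiniteMeasure P] (k : ℕ) (ω : Ω) : ℝ :=
  sInf (deriv (𝓜.G P k ω) '' {x | |x| ≤ 𝓜.M k ω})

/-- `g̅ₖ = sup_{|x| ≤ Mₖ} Gₖ'(x)`. -/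
def gUp (𝓜 : Model Ω m) (P : Measure Ω) [IsFiniteMeasure P] (k : ℕ) (ω : Ω) : ℝ :=
  sSup (deriv (𝓜.G P k ω) '' {x | |x| ≤ 𝓜.M k ω})

end Model

/-! ### The assumptions -/

/-- Assumption on the regressors and the parameter, together with the choice of the almost surely
bounded adapted sequence `Mₖ` with `sup_{x ∈ D} |φₖᵀ x| ≤ Mₖ`.
(Boundedness in `ℝᵐ` does not depend on the norm.) -/
structure RegressorAssumption {Ω : Type*} [mΩ : MeasurableSpace Ω] {m : ℕ}
    (P : Measure Ω) (𝓜 : Model Ω m) : Prop where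
  adapted : Adapted 𝓜.ℱ 𝓜.φ
  bounded : ∀ᵐ ω ∂P, ∃ C : ℝ, ∀ k, ‖𝓜.φ k ω‖ ≤ C
  convex : Convex ℝ 𝓜.D
  compact : IsCompact 𝓜.D
  interior : 𝓜.θ ∈ interior 𝓜.D
  M_adapted : Adapted 𝓜.ℱ 𝓜.M
  M_bounded : ∀ᵐ ω ∂P, BddAbove (Set.range fun k => 𝓜.M k ω)
  le_M : ∀ k, ∀ᵐ ω ∂P, ∀ x ∈ 𝓜.D, |𝓜.φ k ω ⬝ᵥ x| ≤ 𝓜.M k ω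

/-- Assumption on the thresholds. -/
structure ThresholdAssumption {Ω : Type*} [mΩ : MeasurableSpace Ω] {m : ℕ}
    (P : Measure Ω) (𝓜 : Model Ω m) : Prop where
  l_adapted : Adapted 𝓜.ℱ 𝓜.l
  u_adapted : Adapted 𝓜.ℱ 𝓜.u
  L_adapted : Adapted 𝓜.ℱ 𝓜.L
  U_adapted : Adapted 𝓜.ℱ 𝓜.U
  bounds : ∃ c l u : Ω → ℝ,
    (MemLp c 2 P ∧ MemLp l 2 P ∧ MemLp u 2 P) ∧
    (∀ ω, 0 ≤ c ω ∧ 0 ≤ l ω ∧ 0 ≤ u ω) ∧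
    (∀ k, ∀ᵐ ω ∂P, 𝓜.l k ω - (c ω : EReal) ≤ 𝓜.L k ω ∧ 𝓜.L k ω ≤ 𝓜.l k ω ∧
      𝓜.l k ω ≤ 𝓜.u k ω ∧ 𝓜.u k ω ≤ 𝓜.U k ω ∧ 𝓜.U k ω ≤ 𝓜.u k ω + (c ω : EReal)) ∧
    (∀ᵐ ω ∂P, (⨆ k, max (𝓜.l k ω) 0) ≤ (l ω : EReal)) ∧
    (∀ᵐ ω ∂P, (⨆ k, max (-𝓜.u k ω) 0) ≤ (u ω : EReal))

/-- Assumption on the noise and on the functions `Gₖ`. The conditional moments are integrals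
against the conditional law of the noise, with values in `[0, ∞]`. -/
structure NoiseAssumption {Ω : Type*} [mΩ : MeasurableSpace Ω] {m : ℕ}
    (P : Measure Ω) [IsFiniteMeasure P] (𝓜 : Model Ω m) : Prop where
  adapted : ∀ k, Measurable[𝓜.ℱ (k + 1)] (𝓜.e (k + 1))
  memLp : ∀ k, MemLp (𝓜.e (k + 1)) 2 P
  martingaleDiff : ∀ k, P[𝓜.e (k + 1)|𝓜.ℱ k] =ᵐ[P] 0
  moments : ∃ η : ℝ, 0 < η ∧
    (∀ᵐ ω ∂P, 0 < ⨅ k, ∫⁻ t, ENNReal.ofReal (|t| ^ 2) ∂(𝓜.noiseLaw P k ω)) ∧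
    (∀ᵐ ω ∂P, (⨆ k, ∫⁻ t, ENNReal.ofReal (|t| ^ (2 + η)) ∂(𝓜.noiseLaw P k ω)) < ⊤)
  differentiable : ∀ k, ∀ᵐ ω ∂P, Differentiable ℝ (𝓜.G P k ω)
  derivBounds : ∃ M ρ : Ω → ℝ, Measurable M ∧ Measurable ρ ∧ (∀ ω, 0 ≤ ρ ω) ∧
    (∀ᵐ ω ∂P, (⨆ k, 𝓜.M k ω) < M ω) ∧
    (∀ᵐ ω ∂P, ∃ a b : ℝ, 0 < a ∧
      ∀ k, ∀ x : ℝ, |x| ≤ M ω → a ≤ deriv (𝓜.G P k ω) x ∧ deriv (𝓜.G P k ω) x ≤ b) ∧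
    (∀ᵐ ω ∂P, ∀ k, ∀ x y : ℝ, |x| ≤ M ω → |y| ≤ M ω →
      |deriv (𝓜.G P k ω) x - deriv (𝓜.G P k ω) y| ≤ ρ ω * |x - y|)

theorem abs_saturation_le {l u L U : EReal} {c a b : ℝ} (hc : 0 ≤ c) (ha : 0 ≤ a) (hb : 0 ≤ b)
    (h₁ : l - (c : EReal) ≤ L) (h₂ : L ≤ l) (h₄ : u ≤ U)
    (h₅ : U ≤ u + (c : EReal)) (hl : l ≤ (a : EReal)) (hu : -u ≤ (b : EReal)) (x : ℝ) :
    |saturation l u L U x| ≤ |x| + c + a + b := by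
  have hx := neg_abs_le x
  have hx' := le_abs_self x
  unfold saturation
  split_ifs with h h'
  · induction l with
    | bot => exact absurd h not_lt_bot
    | top => exact absurd hl (not_le.2 (EReal.coe_lt_top a))
    | coe l =>
      induction L with
      | bot => exact absurd h₁ (not_le.2 (EReal.bot_lt_coe (l - c)))
      | top => exact absurd h₂ (not_le.2 (EReal.coe_lt_top l))
      | coe L =>
        norm_cast at h h₁ h₂ hl
        rw [EReal.toReal_coe, abs_le]
        constructor <;> linarith
  · linarith
  · rw [not_le] at h'
    induction u with
    | bot => exact absurd hu (by simp)
    | top => exact absurd h' not_top_lt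
    | coe u =>
      induction U with
      | bot => exact absurd h₄ (not_le.2 (EReal.bot_lt_coe u))
      | top => exact absurd h₅ (not_le.2 (EReal.coe_lt_top (u + c)))
      | coe U =>
        norm_cast at h' h₄ h₅ hu
        rw [EReal.toReal_coe, abs_le]
        constructor <;> linarith

/-- Under the assumptions on thresholds and noise, `Gₖ(x)` is a version of
`𝔼[Sₖ(x + e_{k+1}) | ℱₖ]` for every `x`. -/
theorem G_ae_eq_condExp {Ω : Type*} [mΩ : MeasurableSpace Ω] {m : ℕ}
    (P : Measure Ω) [IsProbabilityMeasure P] (𝓜 : Model Ω m)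
    (h₂ : ThresholdAssumption P 𝓜) (h₃ : NoiseAssumption P 𝓜) (k : ℕ) (x : ℝ) :
    (fun ω => 𝓜.G P k ω x) =ᵐ[P] P[fun ω => 𝓜.S k ω (x + 𝓜.e (k + 1) ω)|𝓜.ℱ k] := by
  have he : Measurable (𝓜.e (k + 1)) := (h₃.adapted k).mono (𝓜.ℱ.le _) le_rfl
  have hid : @Measurable Ω Ω mΩ (𝓜.ℱ k) id := measurable_id'' (𝓜.ℱ.le k)
  have hmeas : @Measurable (Ω × ℝ) ℝ ((𝓜.ℱ k).prod inferInstance) _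
      (fun p => 𝓜.S k p.1 (x + p.2)) := by
    have hl := (h₂.l_adapted k).comp (@measurable_fst Ω ℝ (𝓜.ℱ k) inferInstance)
    have hu := (h₂.u_adapted k).comp (@measurable_fst Ω ℝ (𝓜.ℱ k) inferInstance)
    have hL := (h₂.L_adapted k).comp (@measurable_fst Ω ℝ (𝓜.ℱ k) inferInstance)
    have hU := (h₂.U_adapted k).comp (@measurable_fst Ω ℝ (𝓜.ℱ k) inferInstance)
    have hz := (measurable_const_add x).comp (@measurable_snd Ω ℝ (𝓜.ℱ k) inferInstance)
    have hz' := measurable_coe_real_ereal.comp hz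
    exact Measurable.ite (measurableSet_lt hz' hl) hL.ereal_toReal
      (Measurable.ite (measurableSet_le hz' hu) hz hU.ereal_toReal)
  have hint : Integrable (fun ω => 𝓜.S k ω (x + 𝓜.e (k + 1) ω)) P := by
    obtain ⟨c, l, u, ⟨hc, hl, hu⟩, hpos, hb, hbl, hbu⟩ := h₂.bounds
    have hdom : Integrable (fun ω => (|x| + |𝓜.e (k + 1) ω|) + c ω + l ω + u ω) P :=
      ((((integrable_const _).add ((h₃.memLp k).integrable one_le_two).abs).add
        (hc.integrable one_le_two)).add (hl.integrable one_le_two)).add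
        (hu.integrable one_le_two)
    refine hdom.mono' (hmeas.comp (hid.prodMk he)).aestronglyMeasurable ?_
    filter_upwards [hb k, hbl, hbu] with ω h h' h''
    have hl' : 𝓜.l k ω ≤ (l ω : EReal) :=
      (le_max_left _ _).trans ((le_iSup (fun k => max (𝓜.l k ω) 0) k).trans h')
    have hu' : -𝓜.u k ω ≤ (u ω : EReal) :=
      (le_max_left _ _).trans ((le_iSup (fun k => max (-𝓜.u k ω) 0) k).trans h'')
    have := abs_saturation_le (hpos ω).1 (hpos ω).2.1 (hpos ω).2.2 h.1 h.2.1 h.2.2.2.1 h.2.2.2.2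
      hl' hu' (x + 𝓜.e (k + 1) ω)
    have hxe := abs_add_le x (𝓜.e (k + 1) ω)
    rw [Real.norm_eq_abs]
    change |saturation _ _ _ _ _| ≤ _
    linarith
  have h := @condExp_prod_ae_eq_integral_condDistrib Ω Ω ℝ ℝ _ _ _ _ mΩ P _ id (𝓜.e (k + 1))
    (𝓜.ℱ k) (fun p => 𝓜.S k p.1 (x + p.2)) _ _ hid he.aemeasurable
    hmeas.stronglyMeasurable hint
  rw [MeasurableSpace.comap_id] at h
  exact h.symm

/-! ### The two-step quasi-Newton algorithm (along one sample path) -/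

/-- `p` is a point of `D` nearest to `x` in the norm `‖v‖_Q² = vᵀ Q v`. -/
def IsProj {m : ℕ} (D : Set (Fin m → ℝ)) (Q : Matrix (Fin m) (Fin m) ℝ) (x p : Fin m → ℝ) : Prop :=
  p ∈ D ∧ ∀ z ∈ D, (x - p) ⬝ᵥ (Q *ᵥ (x - p)) ≤ (x - z) ⬝ᵥ (Q *ᵥ (x - z))

/-- The projection `Π_Q(x) = argmin_{y ∈ D} ‖x - y‖_Q`. The minimizer exists and is unique when `D`
is nonempty, compact and convex and `Q` is positive definite. -/
def proj {m : ℕ} (D : Set (Fin m → ℝ)) (Q : Matrix (Fin m) (Fin m) ℝ) (x : Fin m → ℝ) :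
    Fin m → ℝ :=
  Classical.epsilon (IsProj D Q x)

/-- The update `P - a β² P φ φᵀ P` of the gain matrix. -/
def gainUpdate {m : ℕ} (P : Matrix (Fin m) (Fin m) ℝ) (φ : Fin m → ℝ) (a β : ℝ) :
    Matrix (Fin m) (Fin m) ℝ :=
  P - (a * β ^ 2) • (P * Matrix.vecMulVec φ φ * P)

/-- The update `Π_{Pnew⁻¹}(θ + a β P φ (y - G(φᵀ θ)))` of the estimate. -/
def estimateUpdate {m : ℕ} (D : Set (Fin m → ℝ)) (G : ℝ → ℝ) (P Pnew : Matrix (Fin m) (Fin m) ℝ)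
    (φ θ : Fin m → ℝ) (a β y : ℝ) : Fin m → ℝ :=
  proj D Pnew⁻¹ (θ + (a * β * (y - G (φ ⬝ᵥ θ))) • (P *ᵥ φ))

/-- The gain `β̄ = min {g̲, 1 / (2 g̅ φᵀ P̄ φ + 1)}` of the first step. -/
def betaBar {m : ℕ} (gLow gUp : ℝ) (P : Matrix (Fin m) (Fin m) ℝ) (φ : Fin m → ℝ) : ℝ :=
  min gLow (1 / (2 * gUp * (φ ⬝ᵥ (P *ᵥ φ)) + 1))

/-- Step 1: the pair `(θ̄ₖ, P̄ₖ)`. Here `y k` stands for the observation `y_{k+1}`. -/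
def step1 {m : ℕ} (D : Set (Fin m → ℝ)) (G : ℕ → ℝ → ℝ) (gLow gUp : ℕ → ℝ) (φ : ℕ → Fin m → ℝ)
    (y : ℕ → ℝ) (θbar₀ : Fin m → ℝ) (Pbar₀ : Matrix (Fin m) (Fin m) ℝ) :
    ℕ → (Fin m → ℝ) × Matrix (Fin m) (Fin m) ℝ
  | 0 => (θbar₀, Pbar₀)
  | k + 1 =>
    let θbar := (step1 D G gLow gUp φ y θbar₀ Pbar₀ k).1
    let Pbar := (step1 D G gLow gUp φ y θbar₀ Pbar₀ k).2
    let β := betaBar (gLow k) (gUp k) Pbar (φ k)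
    let a := 1 / (1 + β ^ 2 * (φ k ⬝ᵥ (Pbar *ᵥ φ k)))
    let Pnew := gainUpdate Pbar (φ k) a β
    (estimateUpdate D (G k) Pbar Pnew (φ k) θbar a β (y k), Pnew)

/-- The gain `β` of the second step: the difference quotient of `G` between `φᵀ θ̄` and `φᵀ θ̂`,
or `G'(φᵀ θ̂)` if these two numbers agree. -/
def beta {m : ℕ} (G : ℝ → ℝ) (φ θbar θhat : Fin m → ℝ) : ℝ :=
  open Classical in
  if φ ⬝ᵥ θhat - φ ⬝ᵥ θbar ≠ 0 then
    (G (φ ⬝ᵥ θbar) - G (φ ⬝ᵥ θhat)) / (φ ⬝ᵥ θbar - φ ⬝ᵥ θhat)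
  else deriv G (φ ⬝ᵥ θhat)

/-- Step 2: the pair `(θ̂ₖ, Pₖ)`, given the preliminary estimates `θ̄ₖ` and the regularization
factors `μₖ`. Here `y k` stands for the observation `y_{k+1}`. -/
def step2 {m : ℕ} (D : Set (Fin m → ℝ)) (G : ℕ → ℝ → ℝ) (φ : ℕ → Fin m → ℝ) (y : ℕ → ℝ)
    (θbar : ℕ → Fin m → ℝ) (μ : ℕ → ℝ) (θhat₀ : Fin m → ℝ) (P₀ : Matrix (Fin m) (Fin m) ℝ) :
    ℕ → (Fin m → ℝ) × Matrix (Fin m) (Fin m) ℝ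
  | 0 => (θhat₀, P₀)
  | k + 1 =>
    let θhat := (step2 D G φ y θbar μ θhat₀ P₀ k).1
    let P := (step2 D G φ y θbar μ θhat₀ P₀ k).2
    let β := beta (G k) (φ k) (θbar k) θhat
    let a := 1 / (μ k + β ^ 2 * (φ k ⬝ᵥ (P *ᵥ φ k)))
    let Pnew := gainUpdate P (φ k) a β
    (estimateUpdate D (G k) P Pnew (φ k) θhat a β (y k), Pnew)

namespace Model

variable {Ω : Type*} [mΩ : MeasurableSpace Ω] {m : ℕ}

/-- The preliminary estimate `θ̄ₖ`. -/
def thetaBar (𝓜 : Model Ω m) (P : Measure Ω) [IsFiniteMeasure P] (θbar₀ : Fin m → ℝ)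
    (Pbar₀ : Matrix (Fin m) (Fin m) ℝ) (k : ℕ) (ω : Ω) : Fin m → ℝ :=
  (step1 𝓜.D (fun i => 𝓜.G P i ω) (fun i => 𝓜.gLow P i ω) (fun i => 𝓜.gUp P i ω)
    (fun i => 𝓜.φ i ω) (fun i => 𝓜.yNext i ω) θbar₀ Pbar₀ k).1

/-- The accelerated estimate `θ̂ₖ`. -/
def thetaHat (𝓜 : Model Ω m) (P : Measure Ω) [IsFiniteMeasure P] (μ : ℕ → Ω → ℝ)
    (θbar₀ : Fin m → ℝ) (Pbar₀ : Matrix (Fin m) (Fin m) ℝ)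
    (θhat₀ : Fin m → ℝ) (P₀ : Matrix (Fin m) (Fin m) ℝ) (k : ℕ) (ω : Ω) : Fin m → ℝ :=
  (step2 𝓜.D (fun i => 𝓜.G P i ω) (fun i => 𝓜.φ i ω) (fun i => 𝓜.yNext i ω)
    (fun i => 𝓜.thetaBar P θbar₀ Pbar₀ i ω) (fun i => μ i ω) θhat₀ P₀ k).1

/-- The regret `Rₖ = (𝔼[y_{k+1} | ℱₖ] - Gₖ(φₖᵀ θ̂ₖ))²`. -/
def regret (𝓜 : Model Ω m) (P : Measure Ω) [IsFiniteMeasure P] (μ : ℕ → Ω → ℝ)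
    (θbar₀ : Fin m → ℝ) (Pbar₀ : Matrix (Fin m) (Fin m) ℝ)
    (θhat₀ : Fin m → ℝ) (P₀ : Matrix (Fin m) (Fin m) ℝ) (k : ℕ) (ω : Ω) : ℝ :=
  (condMean (𝓜.ℱ k) P (𝓜.yNext k) ω
    - 𝓜.G P k ω (𝓜.φ k ω ⬝ᵥ 𝓜.thetaHat P μ θbar₀ Pbar₀ θhat₀ P₀ k ω)) ^ 2

/-- `λ_max(k)`: the largest eigenvalue of the symmetric matrix `∑_{i=0}^k φᵢ φᵢᵀ + λ₀ I`. -/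
def lambdaMax (𝓜 : Model Ω m) (lam₀ : ℝ) (k : ℕ) (ω : Ω) : ℝ :=
  sSup (spectrum ℝ
    (∑ i ∈ Finset.range (k + 1), Matrix.vecMulVec (𝓜.φ i ω) (𝓜.φ i ω)
      + lam₀ • (1 : Matrix (Fin m) (Fin m) ℝ)))

end Model

end TSQN

end

/-! Since `Gₖ` is computed from the conditional law of the noise, the conditional mean of `y_{k+1}`
is `Gₖ(φₖᵀθ)` (`condMean_yNext_ae_eq`). The regret is therefore `(Gₖ(φₖᵀθ) - Gₖ(φₖᵀθ̂ₖ))²`. Along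
almost every path the slopes of all `Gₖ` on the relevant intervals lie between two positive
constants, so the regret is comparable with `(φₖᵀ(θ - θ̂ₖ))²`.

Both steps of the algorithm are instances of one recursion, `IsQuasiNewton`, with Lyapunov function
`Vₖ = (θ - θ̂ₖ)ᵀ Pₖ⁻¹ (θ - θ̂ₖ)`. By Sherman–Morrison, `P_{k+1}⁻¹ = Pₖ⁻¹ + (β²/μ) φφᵀ`, and
projecting onto `D` in the metric `P_{k+1}⁻¹` brings the estimate no further from `θ ∈ D`. Write `x
= β φᵀ(θ - θ̂)`, `ψ = G(φᵀθ) - G(φᵀθ̂)`, `w` for the innovation and `h` for the normalized gain. One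
step then gives `V' ≤ V + (1/μ)(x² - 2x(ψ + w) + h(ψ + w)²)`. Three facts turn this into a bound on
`∑ x²`.

Drift: `x² - 2xψ ≤ -x²/2 + 2δ²`. In the first step `β̄` is below every slope of `G`, so `x² ≤ xψ`
and `δ = 0`. In the second step `β` is the secant slope between `φᵀθ̄` and `φᵀθ̂`, so `ψ - x`
depends only on the error `φᵀ(θ - θ̄)` of the first step, whose squares have already been summed.

Noise: `∑ (x/μ) w` is at most `ε ∑ (x/μ)² + C`, which the drift absorbs, and `∑ h w² ≤ C (1 + ∑ h)`.
Both are martingale statements (`IsBoundedNoise.ae_abs_sum_le`, `IsBoundedNoise.ae_sum_mul_sq_le`).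
The conditional moments of the innovations have only a random bound, so the innovations are cut off
at integer levels and the results are glued (`exists_isBoundedNoise`). The coefficients must be
functions of the past, up to null sets; `AEMeasWrt` records this.

Gain: `h` is at most the increment of `log det P⁻¹`, and this determinant is polynomially bounded in
`λ_max`, so `∑ h ≤ C (1 + log⁺ λ_max)`.

Finally `1 + log⁺ λ_max` is `O(|log λ_max|)` unless `λ_max → 1`, because `λ_max` is monotone. When
`λ₀ ≥ 1`, convergence to `1` would force all regressors, and with them all regrets, to vanish. -/

namespace TSQN

/-! ### Real sequences -/

/-- A form of Kronecker's lemma. -/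
theorem abs_sum_le_of_tendsto_sum_div {s x : ℕ → ℝ} (hs : Monotone s) (hs0 : 0 < s 0)
    (hx : ∃ l, Tendsto (fun n => ∑ i ∈ Finset.range n, x i / s i) atTop (𝓝 l))
    {ε : ℝ} (hε : 0 < ε) :
    ∃ C, 0 ≤ C ∧ ∀ n, |∑ i ∈ Finset.range (n + 1), x i| ≤ ε * s n + C := by
  obtain ⟨l, hl⟩ := hx
  set T : ℕ → ℝ := fun n => ∑ i ∈ Finset.range n, x i / s i with hT
  set A : ℕ → ℝ := fun n => ∑ i ∈ Finset.range n, x i with hA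
  have hspos : ∀ n, 0 < s n := fun n => hs0.trans_le (hs (Nat.zero_le n))
  obtain ⟨N, hN⟩ := Metric.tendsto_atTop.1 hl (ε / 2) (half_pos hε)
  have hr : ∀ n, N ≤ n → |T n - l| ≤ ε / 2 := fun n hn => by
    have := hN n hn
    rw [Real.dist_eq] at this
    exact this.le
  -- Summation by parts: the increments of `B` are increments of `s` times tails `T - l`. Past `N`
  -- the tails are at most `ε / 2`; the other `ε / 2` pays for the boundary term `s n * (T (n + 1) -
  -- l)`.
  set B : ℕ → ℝ := fun n => A (n + 1) - s n * (T (n + 1) - l) with hB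
  have hstep : ∀ n, B (n + 1) - B n = -((s (n + 1) - s n) * (T (n + 1) - l)) := by
    intro n
    have h1 : A (n + 1 + 1) = A (n + 1) + x (n + 1) := Finset.sum_range_succ _ _
    have h2 : T (n + 1 + 1) = T (n + 1) + x (n + 1) / s (n + 1) := Finset.sum_range_succ _ _
    have h3 : s (n + 1) * (x (n + 1) / s (n + 1)) = x (n + 1) :=
      mul_div_cancel₀ _ (hspos _).ne'
    simp only [hB, h1, h2]
    linear_combination -h3
  have hBn : ∀ n, N ≤ n → |B n| ≤ |B N| + ε / 2 * (s n - s N) := by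
    intro n hn
    induction n, hn using Nat.le_induction with
    | base => simp
    | succ n hn ih =>
      have h1 : |B (n + 1) - B n| ≤ (s (n + 1) - s n) * (ε / 2) := by
        rw [hstep, abs_neg, abs_mul, abs_of_nonneg (sub_nonneg.2 (hs n.le_succ))]
        exact mul_le_mul_of_nonneg_left (hr _ (by omega)) (sub_nonneg.2 (hs n.le_succ))
      have h2 := abs_sub_abs_le_abs_sub (B (n + 1)) (B n)
      linarith
  refine ⟨|B N| + ∑ i ∈ Finset.range N, |A (i + 1)|,
    add_nonneg (abs_nonneg _) (Finset.sum_nonneg fun _ _ => abs_nonneg _), fun n => ?_⟩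
  change |A (n + 1)| ≤ _
  rcases lt_or_ge n N with h | h
  · have h1 : |A (n + 1)| ≤ ∑ i ∈ Finset.range N, |A (i + 1)| :=
      Finset.single_le_sum (f := fun i => |A (i + 1)|) (fun _ _ => abs_nonneg _)
        (Finset.mem_range.2 h)
    have := mul_pos hε (hspos n)
    have := abs_nonneg (B N)
    linarith
  · have h1 : A (n + 1) = B n + s n * (T (n + 1) - l) := by simp [hB]
    have h2 : |s n * (T (n + 1) - l)| ≤ s n * (ε / 2) := by
      rw [abs_mul, abs_of_pos (hspos n)]
      exact mul_le_mul_of_nonneg_left (hr _ (by omega)) (hspos n).le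
    have h3 := hBn n h
    have h4 : 0 ≤ ∑ i ∈ Finset.range N, |A (i + 1)| := Finset.sum_nonneg fun _ _ => abs_nonneg _
    have h5 := abs_add_le (B n) (s n * (T (n + 1) - l))
    have h6 := mul_pos hε (hspos N)
    rw [h1]
    linarith

/-- A lower rectangle against `∫ x ^ (-p)` over `[a, b]`. With `t = a / b` it reduces to `(1 - t)(p
- 1) ≤ t ^ (1 - p) - 1`, which follows from `exp y ≥ 1 + y` and `log t ≤ t - 1`. -/
theorem sub_mul_rpow_neg_le {a b p : ℝ} (ha : 0 < a) (hab : a ≤ b) (hp : 1 < p) :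
    (b - a) * b ^ (-p) ≤ (a ^ (1 - p) - b ^ (1 - p)) / (p - 1) := by
  have hb : 0 < b := ha.trans_le hab
  have ht : 0 < a / b := div_pos ha hb
  have h1 : (1 - a / b) * (p - 1) ≤ (a / b) ^ (1 - p) - 1 := by
    have h2 := Real.add_one_le_exp (Real.log (a / b) * (1 - p))
    rw [← Real.rpow_def_of_pos ht] at h2
    have h3 := Real.log_le_sub_one_of_pos ht
    nlinarith
  have h4 : a ^ (1 - p) = (a / b) ^ (1 - p) * b ^ (1 - p) := by
    rw [Real.div_rpow ha.le hb.le, div_mul_cancel₀ _ (Real.rpow_pos_of_pos hb _).ne']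
  have h5 : b ^ (1 - p) = b * b ^ (-p) := by
    rw [sub_eq_add_neg, Real.rpow_add hb, Real.rpow_one]
  have h6 : 0 < b ^ (-p) := Real.rpow_pos_of_pos hb _
  rw [le_div_iff₀ (by linarith), h4, h5]
  have h7 : b - a = (1 - a / b) * b := by field_simp
  have h8 := mul_le_mul_of_nonneg_right h1 (mul_pos hb h6).le
  rw [h7]
  linarith

/-- The normalizing sequence `1 + ∑_{i ≤ k} dᵢ`. -/
def normSum (d : ℕ → ℝ) (k : ℕ) : ℝ := 1 + ∑ i ∈ Finset.range (k + 1), d i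

theorem normSum_succ (d : ℕ → ℝ) (k : ℕ) : normSum d (k + 1) = normSum d k + d (k + 1) := by
  rw [normSum, Finset.sum_range_succ, normSum, add_assoc]

theorem normSum_mono {d : ℕ → ℝ} (hd : ∀ k, 0 ≤ d k) : Monotone (normSum d) :=
  monotone_nat_of_le_succ fun k => by rw [normSum_succ]; linarith [hd (k + 1)]

theorem one_le_normSum {d : ℕ → ℝ} (hd : ∀ k, 0 ≤ d k) (k : ℕ) : 1 ≤ normSum d k :=
  le_add_of_nonneg_right (Finset.sum_nonneg fun i _ => hd i)

/-- The Abel–Dini theorem: `d k` is the increment of `normSum d`, so the preceding comparison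
telescopes. The bound is independent of `d`, hence survives integration over the sample space. -/
theorem sum_mul_normSum_rpow_le {d : ℕ → ℝ} (hd : ∀ k, 0 ≤ d k) {p : ℝ} (hp : 1 < p) (n : ℕ) :
    ∑ k ∈ Finset.range n, d k * normSum d k ^ (-p) ≤ 1 / (p - 1) := by
  have key : ∀ n, ∑ k ∈ Finset.range (n + 1), d k * normSum d k ^ (-p)
      ≤ (1 - normSum d n ^ (1 - p)) / (p - 1) := by
    intro n
    induction n with
    | zero =>
      have h := sub_mul_rpow_neg_le one_pos (one_le_normSum hd 0) hp
      rw [Real.one_rpow] at h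
      have h0 : normSum d 0 - 1 = d 0 := by simp [normSum]
      rw [h0] at h
      simpa using h
    | succ n ih =>
      have h := sub_mul_rpow_neg_le (one_pos.trans_le (one_le_normSum hd n))
        (normSum_mono hd n.le_succ) hp
      have h0 : normSum d n.succ - normSum d n = d (n + 1) := by
        rw [Nat.succ_eq_add_one, normSum_succ]; ring
      rw [h0] at h
      rw [Finset.sum_range_succ]
      refine (add_le_add ih h).trans (le_of_eq ?_)
      rw [← add_div]
      congr 1
      ring
  cases n with
  | zero =>
    simp only [Finset.range_zero, Finset.sum_empty]
    exact div_nonneg zero_le_one (by linarith)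
  | succ n =>
    refine (key n).trans (div_le_div_of_nonneg_right ?_ (by linarith))
    linarith [Real.rpow_nonneg (zero_le_one.trans (one_le_normSum hd n)) (1 - p)]

/-! ### Martingale difference sequences -/

section Martingale

open scoped ENNReal

variable {Ω : Type*} [mΩ : MeasurableSpace Ω] {P : Measure Ω} {ℱ : Filtration ℕ mΩ}

/-- A martingale difference sequence `w` whose conditional absolute moments of order `2 * p` are
bounded by `K`. -/
structure IsBoundedNoise (ℱ : Filtration ℕ mΩ) (P : Measure Ω) (w : ℕ → Ω → ℝ) (p K : ℝ) :
    Prop where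
  measurable : ∀ k, Measurable[ℱ (k + 1)] (w k)
  condExp_eq : ∀ k, P[w k|ℱ k] =ᵐ[P] 0
  moment_le : ∀ k, ∀ f : Ω → ℝ≥0∞, Measurable[ℱ k] f →
    ∫⁻ ω, f ω * ENNReal.ofReal ((w k ω ^ 2) ^ p) ∂P ≤ ENNReal.ofReal K * ∫⁻ ω, f ω ∂P

theorem le_one_add_rpow {x p : ℝ} (hx : 0 ≤ x) (hp : 1 ≤ p) : x ≤ 1 + x ^ p := by
  rcases le_total x 1 with h | h
  · linarith [Real.rpow_nonneg hx p]
  · have := Real.rpow_le_rpow_of_exponent_le h hp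
    rw [Real.rpow_one] at this
    linarith

namespace IsBoundedNoise

variable {w : ℕ → Ω → ℝ} {p K : ℝ}

theorem measurable' (hw : IsBoundedNoise ℱ P w p K) (k : ℕ) : Measurable (w k) :=
  (hw.measurable k).mono (ℱ.le _) le_rfl

theorem lintegral_mul_sq_le (hw : IsBoundedNoise ℱ P w p K) (hp : 1 ≤ p) (k : ℕ) {f : Ω → ℝ≥0∞}
    (hf : Measurable[ℱ k] f) :
    ∫⁻ ω, f ω * ENNReal.ofReal (w k ω ^ 2) ∂P ≤ (1 + ENNReal.ofReal K) * ∫⁻ ω, f ω ∂P := by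
  have hf' : Measurable f := hf.mono (ℱ.le k) le_rfl
  calc ∫⁻ ω, f ω * ENNReal.ofReal (w k ω ^ 2) ∂P
      ≤ ∫⁻ ω, (f ω + f ω * ENNReal.ofReal ((w k ω ^ 2) ^ p)) ∂P := by
        refine lintegral_mono fun ω => ?_
        have h1 := ENNReal.ofReal_le_ofReal (le_one_add_rpow (sq_nonneg (w k ω)) hp)
        rw [ENNReal.ofReal_add zero_le_one (Real.rpow_nonneg (sq_nonneg _) _),
          ENNReal.ofReal_one] at h1
        calc _ ≤ f ω * (1 + ENNReal.ofReal ((w k ω ^ 2) ^ p)) := by gcongr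
          _ = _ := by rw [mul_add, mul_one]
    _ = ∫⁻ ω, f ω ∂P + ∫⁻ ω, f ω * ENNReal.ofReal ((w k ω ^ 2) ^ p) ∂P :=
        lintegral_add_left hf' _
    _ ≤ _ := by
        rw [add_mul, one_mul]
        gcongr
        exact hw.moment_le k f hf

theorem memLp [IsProbabilityMeasure P] (hw : IsBoundedNoise ℱ P w p K) (hp : 1 ≤ p) (k : ℕ) :
    MemLp (w k) 2 P := by
  rw [memLp_two_iff_integrable_sq (hw.measurable' k).aestronglyMeasurable]
  refine ⟨((hw.measurable' k).pow_const 2).aestronglyMeasurable, ?_⟩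
  rw [hasFiniteIntegral_iff_ofReal (ae_of_all _ fun ω => sq_nonneg _)]
  have := hw.lintegral_mul_sq_le hp k (f := fun _ => 1) measurable_const
  simp only [one_mul, lintegral_one, measure_univ, mul_one] at this
  exact this.trans_lt (ENNReal.add_lt_top.2 ⟨ENNReal.one_lt_top, ENNReal.ofReal_lt_top⟩)

end IsBoundedNoise

theorem measurable_normSum {d : ℕ → Ω → ℝ} (hd : ∀ k, Measurable[ℱ k] (d k)) (k : ℕ) :
    Measurable[ℱ k] fun ω => normSum (fun i => d i ω) k := by
  refine Measurable.const_add ?_ 1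
  exact Finset.measurable_sum _ fun i hi =>
    (hd i).mono (ℱ.mono (by have := Finset.mem_range.1 hi; omega)) le_rfl

variable [IsProbabilityMeasure P]

/-- Orthogonality of the increments makes the second moments of the partial sums add up, so they
stay below `K`. As `|T| ≤ 1 + T²`, the martingale is bounded in `L¹` and converges almost surely. -/
theorem ae_exists_tendsto_sum {z : ℕ → Ω → ℝ} (hz : ∀ k, Measurable[ℱ (k + 1)] (z k))
    (hL : ∀ k, MemLp (z k) 2 P) (h0 : ∀ k, P[z k|ℱ k] =ᵐ[P] 0) {K : ℝ} (hK0 : 0 ≤ K)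
    (hK : ∀ n, ∑ k ∈ Finset.range n, ∫⁻ ω, ENNReal.ofReal (z k ω ^ 2) ∂P ≤ ENNReal.ofReal K) :
    ∀ᵐ ω ∂P, ∃ l, Tendsto (fun n => ∑ k ∈ Finset.range n, z k ω) atTop (𝓝 l) := by
  set T : ℕ → Ω → ℝ := fun n ω => ∑ k ∈ Finset.range n, z k ω with hT
  have hTs : ∀ n, T (n + 1) = T n + z n := fun n => by
    ext ω
    simp [hT, Finset.sum_range_succ]
  have hTm : ∀ n, Measurable[ℱ n] (T n) := fun n =>
    Finset.measurable_sum _ fun k hk =>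
      (hz k).mono (ℱ.mono (by have := Finset.mem_range.1 hk; omega)) le_rfl
  have hTL : ∀ n, MemLp (T n) 2 P := fun n => memLp_finsetSum _ fun k _ => hL k
  have hTi : ∀ n, Integrable (T n) P := fun n => (hTL n).integrable one_le_two
  have hmart : Martingale T ℱ P := by
    refine martingale_of_condExp_sub_eq_zero_nat (fun n => (hTm n).stronglyMeasurable) hTi
      fun n => ?_
    rw [hTs, add_sub_cancel_left]
    exact h0 n
  have hsq : ∀ n, ∫ ω, T n ω ^ 2 ∂P = ∑ k ∈ Finset.range n, ∫ ω, z k ω ^ 2 ∂P := by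
    intro n
    induction n with
    | zero => simp [hT]
    | succ n ih =>
      have hprod : Integrable (T n * z n) P := (hTL n).integrable_mul (hL n)
      have hcross : ∫ ω, (T n * z n) ω ∂P = 0 := by
        rw [← integral_condExp (ℱ.le n)]
        have h1 := condExp_mul_of_stronglyMeasurable_left (hTm n).stronglyMeasurable hprod
          ((hL n).integrable one_le_two)
        rw [integral_congr_ae (g := fun _ => (0 : ℝ)), integral_zero]
        filter_upwards [h1, h0 n] with ω h1 h2
        rw [h1, Pi.mul_apply, h2, Pi.zero_apply, mul_zero]
      have hexp : ∀ ω, T (n + 1) ω ^ 2 = T n ω ^ 2 + (2 * (T n * z n) ω + z n ω ^ 2) := fun ω => by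
        rw [hTs]
        simp only [Pi.add_apply, Pi.mul_apply]
        ring
      simp_rw [hexp]
      rw [integral_add (hTL n).integrable_sq
        (show Integrable (fun ω => 2 * (T n * z n) ω + z n ω ^ 2) P from
          (hprod.const_mul 2).add (hL n).integrable_sq),
        integral_add (hprod.const_mul 2) (hL n).integrable_sq, integral_const_mul, hcross, ih,
        Finset.sum_range_succ]
      ring
  have hbd : ∀ n, ∫ ω, T n ω ^ 2 ∂P ≤ K := by
    intro n
    rw [hsq, ← ENNReal.ofReal_le_ofReal_iff hK0, ENNReal.ofReal_sum_of_nonneg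
      fun k _ => integral_nonneg fun ω => sq_nonneg _]
    refine (Finset.sum_le_sum fun k _ => ?_).trans (hK n)
    rw [ofReal_integral_eq_lintegral_ofReal (hL k).integrable_sq
      (ae_of_all _ fun ω => sq_nonneg _)]
  refine hmart.submartingale.exists_ae_tendsto_of_bdd (R := (1 + K).toNNReal) fun n => ?_
  rw [eLpNorm_one_eq_lintegral_enorm]
  have h1 : ∫⁻ ω, ‖T n ω‖ₑ ∂P ≤ ∫⁻ ω, ENNReal.ofReal (1 + T n ω ^ 2) ∂P := by
    refine lintegral_mono fun ω => ?_
    rw [← ofReal_norm, Real.norm_eq_abs]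
    refine ENNReal.ofReal_le_ofReal ?_
    nlinarith [sq_nonneg (|T n ω| - 1), sq_abs (T n ω), abs_nonneg (T n ω)]
  refine h1.trans ?_
  have hint : Integrable (fun ω => 1 + T n ω ^ 2) P :=
    (integrable_const 1).add (hTL n).integrable_sq
  rw [← ofReal_integral_eq_lintegral_ofReal hint
    (ae_of_all _ fun ω => by positivity), integral_add (integrable_const 1) (hTL n).integrable_sq]
  refine ENNReal.ofReal_le_ofReal ?_
  simpa using hbd n

theorem sum_lintegral_le {d : ℕ → Ω → ℝ} (hd : ∀ k, Measurable[ℱ k] (d k))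
    (hd0 : ∀ k ω, 0 ≤ d k ω) {p : ℝ} (hp : 1 < p) (n : ℕ) :
    ∑ k ∈ Finset.range n, ∫⁻ ω, ENNReal.ofReal (d k ω * normSum (fun i => d i ω) k ^ (-p)) ∂P
      ≤ ENNReal.ofReal (1 / (p - 1)) := by
  rw [← lintegral_finsetSum]
  · calc _ ≤ ∫⁻ _, ENNReal.ofReal (1 / (p - 1)) ∂P := by
          refine lintegral_mono fun ω => ?_
          rw [← ENNReal.ofReal_sum_of_nonneg]
          · exact ENNReal.ofReal_le_ofReal (sum_mul_normSum_rpow_le (fun k => hd0 k ω) hp n)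
          · exact fun k _ => mul_nonneg (hd0 k ω) (Real.rpow_nonneg
              (zero_le_one.trans (one_le_normSum (fun i => hd0 i ω) k)) _)
      _ = _ := by simp
  · exact fun k _ => (((hd k).mono (ℱ.le k) le_rfl).mul
      (((measurable_normSum hd k).mono (ℱ.le k) le_rfl).pow_const _)).ennreal_ofReal

/-- Martingale transforms are of smaller order than the sum of the squares of the coefficients. -/
theorem IsBoundedNoise.ae_abs_sum_le {w : ℕ → Ω → ℝ} {p K : ℝ} (hw : IsBoundedNoise ℱ P w p K)
    (hp : 1 ≤ p) {c : ℕ → Ω → ℝ} (hc : ∀ k, Measurable[ℱ k] (c k)) :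
    ∀ᵐ ω ∂P, ∀ ε > 0, ∃ C, ∀ n,
      |∑ k ∈ Finset.range n, c k ω * w k ω| ≤ ε * ∑ k ∈ Finset.range n, c k ω ^ 2 + C := by
  set s : ℕ → Ω → ℝ := fun k ω => normSum (fun i => c i ω ^ 2) k with hs
  have hsq : ∀ k, Measurable[ℱ k] fun ω => c k ω ^ 2 := fun k => (hc k).pow_const 2
  have hsm : ∀ k, Measurable[ℱ k] (s k) := measurable_normSum hsq
  have hs1 : ∀ k ω, 1 ≤ s k ω := fun k ω => one_le_normSum (fun i => sq_nonneg _) k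
  -- After division by `s` the squared coefficients are summable by Abel–Dini with exponent `2`, so
  -- `∑ x w` converges almost surely; Kronecker's lemma then restores the weights `s`.
  set x : ℕ → Ω → ℝ := fun k ω => c k ω / s k ω with hx
  have hxm : ∀ k, Measurable[ℱ k] (x k) := fun k => (hc k).div (hsm k)
  have hxb : ∀ k ω, ‖x k ω‖ ≤ 1 := by
    intro k ω
    rw [Real.norm_eq_abs, abs_div, abs_of_pos (one_pos.trans_le (hs1 k ω)),
      div_le_one (one_pos.trans_le (hs1 k ω))]
    have h1 : 1 + c k ω ^ 2 ≤ s k ω := by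
      have h2 := Finset.single_le_sum (f := fun i => c i ω ^ 2) (fun i _ => sq_nonneg _)
        (Finset.self_mem_range_succ k)
      simp only [hs, normSum]
      linarith
    nlinarith [sq_nonneg (|c k ω| - 1), sq_abs (c k ω), abs_nonneg (c k ω)]
  have hx2 : ∀ k ω, x k ω ^ 2 = c k ω ^ 2 * s k ω ^ (-2 : ℝ) := by
    intro k ω
    rw [Real.rpow_neg (zero_le_one.trans (hs1 k ω)), Real.rpow_two]
    simp only [hx]
    field_simp
  have hzL : ∀ k, MemLp (fun ω => x k ω * w k ω) 2 P := by
    intro k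
    refine (hw.memLp hp k).of_le (((hxm k).mono (ℱ.le k) le_rfl).mul
      (hw.measurable' k)).aestronglyMeasurable (ae_of_all _ fun ω => ?_)
    rw [norm_mul]
    exact mul_le_of_le_one_left (norm_nonneg _) (hxb k ω)
  have hconv := ae_exists_tendsto_sum (P := P) (ℱ := ℱ) (z := fun k ω => x k ω * w k ω)
    -- The factor `1 / (2 - 1)` is the Abel–Dini bound at exponent `2`; `max K 0` serves because the
    -- sign of `K` is not prescribed here.
    (K := (1 + max K 0) * (1 / (2 - 1)))
    (fun k => ((hxm k).mono (ℱ.mono k.le_succ) le_rfl).mul (hw.measurable k)) hzL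
    (fun k => by
      have h1 := condExp_mul_of_stronglyMeasurable_left (hxm k).stronglyMeasurable
        ((hzL k).integrable one_le_two) ((hw.memLp hp k).integrable one_le_two)
      filter_upwards [h1, hw.condExp_eq k] with ω h1 h2
      change (P[x k * w k|ℱ k]) ω = 0
      rw [h1, Pi.mul_apply, h2, Pi.zero_apply, mul_zero])
    (by positivity)
    (fun n => by
      calc _ = ∑ k ∈ Finset.range n,
            ∫⁻ ω, ENNReal.ofReal (x k ω ^ 2) * ENNReal.ofReal (w k ω ^ 2) ∂P := by
            refine Finset.sum_congr rfl fun k _ => lintegral_congr fun ω => ?_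
            rw [mul_pow, ENNReal.ofReal_mul (sq_nonneg _)]
        _ ≤ ∑ k ∈ Finset.range n,
            (1 + ENNReal.ofReal K) * ∫⁻ ω, ENNReal.ofReal (x k ω ^ 2) ∂P :=
            Finset.sum_le_sum fun k _ =>
              hw.lintegral_mul_sq_le hp k ((hxm k).pow_const 2).ennreal_ofReal
        _ = (1 + ENNReal.ofReal K) * ∑ k ∈ Finset.range n,
            ∫⁻ ω, ENNReal.ofReal (c k ω ^ 2 * s k ω ^ (-2 : ℝ)) ∂P := by
            rw [Finset.mul_sum]
            simp_rw [hx2]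
        _ ≤ (1 + ENNReal.ofReal K) * ENNReal.ofReal (1 / (2 - 1)) := by
            gcongr
            exact sum_lintegral_le hsq (fun k ω => sq_nonneg _) one_lt_two n
        _ ≤ _ := by
            rw [ENNReal.ofReal_mul (by positivity), ENNReal.ofReal_add zero_le_one
              (le_max_right _ _), ENNReal.ofReal_one]
            gcongr
            exact le_max_left _ _)
  filter_upwards [hconv] with ω hω ε hε
  obtain ⟨C, hC0, hC⟩ := abs_sum_le_of_tendsto_sum_div (s := fun k => s k ω)
    (x := fun k => c k ω * w k ω) (normSum_mono fun i => sq_nonneg _)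
    (one_pos.trans_le (hs1 0 ω)) (by
      obtain ⟨l, hl⟩ := hω
      refine ⟨l, hl.congr fun n => Finset.sum_congr rfl fun k _ => ?_⟩
      simp only [hx]
      ring) hε
  -- The extra `ε` is the contribution of the leading `1` in `normSum`.
  refine ⟨ε + C, fun n => ?_⟩
  cases n with
  | zero => simpa using (add_pos_of_pos_of_nonneg hε hC0).le
  | succ n =>
    refine (hC n).trans (le_of_eq ?_)
    simp only [hs, normSum]
    ring

/-- Conditional variance is at most the conditional second moment; both sides are integrated. -/
theorem lintegral_sq_sub_condExp_le {v : Ω → ℝ} (hv : MemLp v 2 P) (k : ℕ) :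
    ∫⁻ ω, ENNReal.ofReal ((v ω - (P[v|ℱ k]) ω) ^ 2) ∂P ≤ ∫⁻ ω, ENNReal.ofReal (v ω ^ 2) ∂P := by
  have hc : MemLp (fun ω => v ω - (P[v|ℱ k]) ω) 2 P := hv.sub (hv.condExp one_le_two)
  rw [← ofReal_integral_eq_lintegral_ofReal hc.integrable_sq (ae_of_all _ fun ω => sq_nonneg _),
    ← ofReal_integral_eq_lintegral_ofReal hv.integrable_sq (ae_of_all _ fun ω => sq_nonneg _)]
  refine ENNReal.ofReal_le_ofReal ?_
  have h1 := integral_mono_ae (integrable_condVar (m := ℱ k) (X := v) (μ := P))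
    integrable_condExp (condVar_ae_le_condExp_sq (ℱ.le k) hv)
  rw [integral_condExp (ℱ.le k)] at h1
  have h2 : ∫ ω, (Var[v; P | ℱ k]) ω ∂P = ∫ ω, (v ω - (P[v|ℱ k]) ω) ^ 2 ∂P :=
    integral_condExp (ℱ.le k)
  rw [h2] at h1
  exact h1

/-- Truncation at level `s` trades missing moments for powers of `s`. Here the square of the kept
part is bounded by splitting `2 = (2 - p) + p`; `sub_min_le` bounds the discarded part. -/
theorem min_sq_le {a s p : ℝ} (ha : 0 ≤ a) (hs : 0 < s) (hp : 1 ≤ p) (hp2 : p ≤ 2) :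
    min a s ^ 2 ≤ s ^ (2 - p) * a ^ p := by
  have h0 : 0 ≤ min a s := le_min ha hs.le
  rcases h0.eq_or_lt with h | h
  · rw [← h]
    have := mul_nonneg (Real.rpow_nonneg hs.le (2 - p)) (Real.rpow_nonneg ha p)
    simpa using this
  · calc min a s ^ 2 = min a s ^ (2 - p) * min a s ^ p := by
          rw [← Real.rpow_add h, sub_add_cancel, Real.rpow_two]
      _ ≤ _ := mul_le_mul (Real.rpow_le_rpow h0 (min_le_right _ _) (by linarith))
          (Real.rpow_le_rpow h0 (min_le_left _ _) (by linarith)) (Real.rpow_nonneg h0 _)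
          (Real.rpow_nonneg hs.le _)

theorem sub_min_le {a s p : ℝ} (ha : 0 ≤ a) (hs : 0 < s) (hp : 1 ≤ p) :
    a - min a s ≤ s ^ (1 - p) * a ^ p := by
  have hR := mul_nonneg (Real.rpow_nonneg hs.le (1 - p)) (Real.rpow_nonneg ha p)
  rcases le_total a s with h | h
  · rw [min_eq_left h]
    simpa using hR
  · have ha' : 0 < a := hs.trans_le h
    rw [min_eq_right h]
    have h1 : a ^ (1 - p) * a ^ p = a := by
      rw [← Real.rpow_add ha', sub_add_cancel, Real.rpow_one]
    have h2 : a ^ (1 - p) ≤ s ^ (1 - p) :=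
      Real.rpow_le_rpow_of_nonpos hs h (by linarith)
    have h3 := mul_le_mul_of_nonneg_right h2 (Real.rpow_nonneg ha p)
    linarith

/-- Weighted sums of squared noise are bounded by the sums of the weights. -/
theorem IsBoundedNoise.ae_sum_mul_sq_le {w : ℕ → Ω → ℝ} {p K : ℝ} (hw : IsBoundedNoise ℱ P w p K)
    (hp : 1 < p) (hp2 : p ≤ 2) (hK : 0 ≤ K) {d : ℕ → Ω → ℝ} (hd : ∀ k, Measurable[ℱ k] (d k))
    (hd0 : ∀ k ω, 0 ≤ d k ω) (hd1 : ∀ k ω, d k ω ≤ 1) :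
    ∀ᵐ ω ∂P, ∃ C, 0 ≤ C ∧ ∀ n, ∑ k ∈ Finset.range n, d k ω * w k ω ^ 2
      ≤ C * (1 + ∑ k ∈ Finset.range n, d k ω) := by
  set s : ℕ → Ω → ℝ := fun k ω => normSum (fun i => d i ω) k with hs
  have hsm : ∀ k, Measurable[ℱ k] (s k) := measurable_normSum hd
  have hs1 : ∀ k ω, 1 ≤ s k ω := fun k ω => one_le_normSum (fun i => hd0 i ω) k
  have hs0 : ∀ k ω, 0 < s k ω := fun k ω => one_pos.trans_le (hs1 k ω)
  -- Only moments of order `p` of `w²` are available, with `p` possibly below `2`, so `w²` is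
  -- truncated at `s`. This splits `d w²` into `s (v - E v)`, `s E v` and `s r`, where `E` is the
  -- conditional expectation and `r` the normalized truncation error. The first part is handled by
  -- `L²` convergence and Kronecker, the second by the conditional second moment, the third by
  -- summability of `r`.
  set v : ℕ → Ω → ℝ := fun k ω => d k ω / s k ω * min (w k ω ^ 2) (s k ω) with hv
  have hvm : ∀ k, Measurable[ℱ (k + 1)] (v k) := fun k =>
    (((hd k).mono (ℱ.mono k.le_succ) le_rfl).div ((hsm k).mono (ℱ.mono k.le_succ) le_rfl)).mul
      (((hw.measurable k).pow_const 2).min ((hsm k).mono (ℱ.mono k.le_succ) le_rfl))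
  have hvm' : ∀ k, Measurable (v k) := fun k => (hvm k).mono (ℱ.le _) le_rfl
  have hv0 : ∀ k ω, 0 ≤ v k ω := fun k ω =>
    mul_nonneg (div_nonneg (hd0 k ω) (hs0 k ω).le) (le_min (sq_nonneg _) (hs0 k ω).le)
  have hv1 : ∀ k ω, v k ω ≤ 1 := fun k ω => by
    calc v k ω ≤ d k ω / s k ω * s k ω :=
          mul_le_mul_of_nonneg_left (min_le_right _ _) (div_nonneg (hd0 k ω) (hs0 k ω).le)
      _ = d k ω := div_mul_cancel₀ _ (hs0 k ω).ne'
      _ ≤ 1 := hd1 k ω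
  have hvL : ∀ k, MemLp (v k) 2 P := fun k =>
    MemLp.of_bound (hvm' k).aestronglyMeasurable 1 (ae_of_all _ fun ω => by
      rw [Real.norm_eq_abs, abs_of_nonneg (hv0 k ω)]; exact hv1 k ω)
  have hpw : ∀ k ω, v k ω ^ 2 ≤ d k ω * s k ω ^ (-p) * (w k ω ^ 2) ^ p := by
    intro k ω
    have h1 := min_sq_le (sq_nonneg (w k ω)) (hs0 k ω) hp.le hp2
    have h2 : s k ω ^ (2 - p) = s k ω ^ 2 * s k ω ^ (-p) := by
      rw [sub_eq_add_neg, Real.rpow_add (hs0 k ω), Real.rpow_two]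
    have h3 : 0 ≤ d k ω / s k ω ^ 2 := div_nonneg (hd0 k ω) (sq_nonneg _)
    have h4 : 0 ≤ min (w k ω ^ 2) (s k ω) ^ 2 := sq_nonneg _
    -- One of the two factors `d` is dropped, using `d ≤ 1`, so that Abel–Dini applies to the other.
    calc v k ω ^ 2 = d k ω * (d k ω / s k ω ^ 2 * min (w k ω ^ 2) (s k ω) ^ 2) := by
          simp only [hv]; ring
      _ ≤ 1 * (d k ω / s k ω ^ 2 * min (w k ω ^ 2) (s k ω) ^ 2) :=
          mul_le_mul_of_nonneg_right (hd1 k ω) (mul_nonneg h3 h4)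
      _ ≤ 1 * (d k ω / s k ω ^ 2 * (s k ω ^ 2 * s k ω ^ (-p) * (w k ω ^ 2) ^ p)) := by
          rw [← h2]; gcongr
      _ = _ := by have := (hs0 k ω).ne'; field_simp
  have hfm : ∀ k, Measurable[ℱ k] fun ω => ENNReal.ofReal (d k ω * s k ω ^ (-p)) := fun k =>
    ((hd k).mul ((hsm k).pow_const _)).ennreal_ofReal
  have hf0 : ∀ k ω, 0 ≤ d k ω * s k ω ^ (-p) := fun k ω =>
    mul_nonneg (hd0 k ω) (Real.rpow_nonneg (hs0 k ω).le _)
  have hbound : ∀ n, ∑ k ∈ Finset.range n,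
      ∫⁻ ω, ENNReal.ofReal (d k ω * s k ω ^ (-p)) * ENNReal.ofReal ((w k ω ^ 2) ^ p) ∂P
      ≤ ENNReal.ofReal (K * (1 / (p - 1))) := fun n => by
    calc _ ≤ ∑ k ∈ Finset.range n,
          ENNReal.ofReal K * ∫⁻ ω, ENNReal.ofReal (d k ω * s k ω ^ (-p)) ∂P :=
          Finset.sum_le_sum fun k _ => hw.moment_le k _ (hfm k)
      _ = ENNReal.ofReal K * ∑ k ∈ Finset.range n,
          ∫⁻ ω, ENNReal.ofReal (d k ω * s k ω ^ (-p)) ∂P := by rw [Finset.mul_sum]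
      _ ≤ ENNReal.ofReal K * ENNReal.ofReal (1 / (p - 1)) := by
          gcongr
          exact sum_lintegral_le hd hd0 hp n
      _ = _ := (ENNReal.ofReal_mul hK).symm
  have hconv := ae_exists_tendsto_sum (P := P) (ℱ := ℱ) (z := fun k ω => v k ω - (P[v k|ℱ k]) ω)
    (K := K * (1 / (p - 1)))
    (fun k => (hvm k).sub
      (stronglyMeasurable_condExp.measurable.mono (ℱ.mono k.le_succ) le_rfl))
    (fun k => (hvL k).sub ((hvL k).condExp one_le_two))
    (fun k => by
      have h1 := condExp_sub ((hvL k).integrable one_le_two)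
        (integrable_condExp (m := ℱ k) (f := v k) (μ := P)) (ℱ k)
      have h2 : P[P[v k|ℱ k]|ℱ k] = P[v k|ℱ k] :=
        condExp_of_stronglyMeasurable (ℱ.le k) stronglyMeasurable_condExp integrable_condExp
      filter_upwards [h1] with ω h1
      change (P[v k - P[v k|ℱ k]|ℱ k]) ω = 0
      rw [h1, h2]
      simp)
    (mul_nonneg hK (div_nonneg zero_le_one (by linarith)))
    (fun n => by
      refine (Finset.sum_le_sum fun k _ => ?_).trans (hbound n)
      refine (lintegral_sq_sub_condExp_le (hvL k) k).trans (lintegral_mono fun ω => ?_)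
      rw [← ENNReal.ofReal_mul (hf0 k ω)]
      exact ENNReal.ofReal_le_ofReal (hpw k ω))
  have hcond : ∀ᵐ ω ∂P, ∀ k, s k ω * (P[v k|ℱ k]) ω ≤ (1 + K) * d k ω := by
    rw [ae_all_iff]
    intro k
    have hw2 : Integrable (fun ω => w k ω ^ 2) P := (hw.memLp hp.le k).integrable_sq
    have hx1 : ∀ ω, ‖d k ω / s k ω‖ ≤ 1 := fun ω => by
      rw [Real.norm_eq_abs, abs_of_nonneg (div_nonneg (hd0 k ω) (hs0 k ω).le),
        div_le_one (hs0 k ω)]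
      exact (hd1 k ω).trans (hs1 k ω)
    -- The bound on the conditional second moment is tested on sets of `ℱ k`, with their indicators
    -- as weights in `lintegral_mul_sq_le`.
    have hE : P[fun ω => w k ω ^ 2|ℱ k] ≤ᵐ[P] fun _ => 1 + K := by
      refine ae_le_of_ae_le_trim (hm := ℱ.le k) ?_
      refine ae_le_of_forall_setIntegral_le
        (integrable_condExp.trim (ℱ.le k) stronglyMeasurable_condExp) (integrable_const _)
        fun t ht _ => ?_
      rw [← setIntegral_trim (ℱ.le k) stronglyMeasurable_condExp ht,
        ← setIntegral_trim (ℱ.le k) stronglyMeasurable_const ht,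
        setIntegral_condExp (ℱ.le k) hw2 ht, setIntegral_const, smul_eq_mul,
        ← integral_indicator (ℱ.le k t ht)]
      have h1 := hw.lintegral_mul_sq_le hp.le k (f := t.indicator fun _ => 1)
        ((@measurable_const ℝ≥0∞ Ω _ (ℱ k) 1).indicator ht)
      have h2 : ∫⁻ ω, t.indicator (fun _ => (1 : ℝ≥0∞)) ω ∂P = P t :=
        lintegral_indicator_one (ℱ.le k t ht)
      rw [h2] at h1
      have h3 : ∫⁻ ω, ENNReal.ofReal (t.indicator (fun ω => w k ω ^ 2) ω) ∂P
          ≤ (1 + ENNReal.ofReal K) * P t := by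
        refine le_trans (le_of_eq (lintegral_congr fun ω => ?_)) h1
        by_cases hω : ω ∈ t <;> simp [hω]
      rw [← ofReal_integral_eq_lintegral_ofReal (hw2.indicator (ℱ.le k t ht))
        (ae_of_all _ fun ω => Set.indicator_nonneg (fun _ _ => sq_nonneg _) ω)] at h3
      rw [← ENNReal.ofReal_le_ofReal_iff (by positivity)]
      refine h3.trans (le_of_eq ?_)
      rw [ENNReal.ofReal_mul measureReal_nonneg, ENNReal.ofReal_add zero_le_one hK,
        ENNReal.ofReal_one, ofReal_measureReal, mul_comm]
    have h1 := condExp_stronglyMeasurable_mul_of_bound (ℱ.le k)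
      ((hd k).div (hsm k)).stronglyMeasurable hw2 1 (ae_of_all _ hx1)
    have h2 := condExp_mono (m := ℱ k) ((hvL k).integrable one_le_two)
      (hw2.bdd_mul (c := 1)
        (((hd k).mono (ℱ.le k) le_rfl).div ((hsm k).mono (ℱ.le k) le_rfl)).aestronglyMeasurable
        (ae_of_all _ hx1))
      (ae_of_all P fun ω => mul_le_mul_of_nonneg_left (min_le_left (w k ω ^ 2) (s k ω))
        (div_nonneg (hd0 k ω) (hs0 k ω).le))
    filter_upwards [hE, h1, h2] with ω hE h1 h2
    have h3 : (P[v k|ℱ k]) ω ≤ d k ω / s k ω * (1 + K) := by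
      refine h2.trans ?_
      refine (le_of_eq h1).trans ?_
      exact mul_le_mul_of_nonneg_left hE (div_nonneg (hd0 k ω) (hs0 k ω).le)
    calc s k ω * (P[v k|ℱ k]) ω ≤ s k ω * (d k ω / s k ω * (1 + K)) :=
          mul_le_mul_of_nonneg_left h3 (hs0 k ω).le
      _ = _ := by have := (hs0 k ω).ne'; field_simp
  set r : ℕ → Ω → ℝ := fun k ω => d k ω / s k ω * (w k ω ^ 2 - min (w k ω ^ 2) (s k ω)) with hr
  have hr0 : ∀ k ω, 0 ≤ r k ω := fun k ω =>
    mul_nonneg (div_nonneg (hd0 k ω) (hs0 k ω).le) (sub_nonneg.2 (min_le_left _ _))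
  have hrle : ∀ k ω, r k ω ≤ d k ω * s k ω ^ (-p) * (w k ω ^ 2) ^ p := by
    intro k ω
    have h1 := sub_min_le (sq_nonneg (w k ω)) (hs0 k ω) hp.le
    have h2 : s k ω ^ (1 - p) = s k ω * s k ω ^ (-p) := by
      rw [sub_eq_add_neg, Real.rpow_add (hs0 k ω), Real.rpow_one]
    calc r k ω ≤ d k ω / s k ω * (s k ω * s k ω ^ (-p) * (w k ω ^ 2) ^ p) := by
          rw [← h2]
          exact mul_le_mul_of_nonneg_left h1 (div_nonneg (hd0 k ω) (hs0 k ω).le)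
      _ = _ := by have := (hs0 k ω).ne'; field_simp
  have hrm : ∀ k, Measurable (r k) := fun k =>
    (((hd k).mono (ℱ.le k) le_rfl).div ((hsm k).mono (ℱ.le k) le_rfl)).mul
      (((hw.measurable' k).pow_const 2).sub
        (((hw.measurable' k).pow_const 2).min ((hsm k).mono (ℱ.le k) le_rfl)))
  -- The expectation of `∑ r` is at most `K / (p - 1)`, so the sum is finite almost surely.
  have hrsum : ∀ᵐ ω ∂P, ∑' k, ENNReal.ofReal (r k ω) < ⊤ := by
    refine ae_lt_top (Measurable.tsum fun k => (hrm k).ennreal_ofReal) ?_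
    rw [lintegral_tsum fun k => (hrm k).ennreal_ofReal.aemeasurable]
    refine ne_top_of_le_ne_top (ENNReal.ofReal_ne_top (r := K * (1 / (p - 1)))) ?_
    rw [ENNReal.tsum_eq_iSup_nat]
    refine iSup_le fun n => (Finset.sum_le_sum fun k _ => ?_).trans (hbound n)
    refine lintegral_mono fun ω => ?_
    rw [← ENNReal.ofReal_mul (hf0 k ω)]
    exact ENNReal.ofReal_le_ofReal (hrle k ω)
  filter_upwards [hconv, hcond, hrsum] with ω hconv hcond hrsum
  obtain ⟨C, hC0, hC⟩ := abs_sum_le_of_tendsto_sum_div (s := fun k => s k ω)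
    (x := fun k => s k ω * (v k ω - (P[v k|ℱ k]) ω)) (normSum_mono fun i => hd0 i ω)
    (hs0 0 ω) (by
      obtain ⟨l, hl⟩ := hconv
      refine ⟨l, hl.congr fun n => Finset.sum_congr rfl fun k _ => ?_⟩
      rw [mul_div_cancel_left₀ _ (hs0 k ω).ne']) one_pos
  set A := (∑' k, ENNReal.ofReal (r k ω)).toReal with hA
  have hA0 : 0 ≤ A := ENNReal.toReal_nonneg
  have hrA : ∀ n, ∑ k ∈ Finset.range n, r k ω ≤ A := fun n => by
    have h1 := ENNReal.sum_le_tsum (f := fun k => ENNReal.ofReal (r k ω)) (Finset.range n)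
    rw [← ENNReal.ofReal_sum_of_nonneg fun k _ => hr0 k ω] at h1
    have := ENNReal.toReal_mono hrsum.ne h1
    rwa [ENNReal.toReal_ofReal (Finset.sum_nonneg fun k _ => hr0 k ω)] at this
  refine ⟨1 + C + (1 + K) + A, by positivity, fun n => ?_⟩
  cases n with
  | zero => simp; positivity
  | succ n =>
    have hsplit : ∀ k, d k ω * w k ω ^ 2 = s k ω * (v k ω - (P[v k|ℱ k]) ω)
        + s k ω * (P[v k|ℱ k]) ω + s k ω * r k ω := fun k => by
      have := (hs0 k ω).ne'
      simp only [hv, hr]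
      field_simp
      ring
    have h1 := (le_abs_self _).trans (hC n)
    have h2 : ∑ k ∈ Finset.range (n + 1), s k ω * (P[v k|ℱ k]) ω
        ≤ (1 + K) * ∑ k ∈ Finset.range (n + 1), d k ω := by
      rw [Finset.mul_sum]
      exact Finset.sum_le_sum fun k _ => hcond k
    -- Since `s` is monotone, all weights are replaced by the last one, and `∑ r` by its finite
    -- total `A`.
    have h3 : ∑ k ∈ Finset.range (n + 1), s k ω * r k ω ≤ s n ω * A := by
      calc _ ≤ ∑ k ∈ Finset.range (n + 1), s n ω * r k ω :=
            Finset.sum_le_sum fun k hk => mul_le_mul_of_nonneg_right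
              (normSum_mono (fun i => hd0 i ω) (by have := Finset.mem_range.1 hk; omega)) (hr0 k ω)
        _ = s n ω * ∑ k ∈ Finset.range (n + 1), r k ω := by rw [Finset.mul_sum]
        _ ≤ _ := mul_le_mul_of_nonneg_left (hrA _) (hs0 n ω).le
    have h4 : s n ω = 1 + ∑ k ∈ Finset.range (n + 1), d k ω := rfl
    have h5 : 0 ≤ ∑ k ∈ Finset.range (n + 1), d k ω := Finset.sum_nonneg fun k _ => hd0 k ω
    simp_rw [hsplit]
    rw [Finset.sum_add_distrib, Finset.sum_add_distrib]
    rw [h4] at h1 h3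
    nlinarith [mul_nonneg hC0 h5, mul_nonneg hK h5]

end Martingale

/-! ### Rank-one updates of positive definite matrices -/

section Matrix

open Matrix

variable {m : ℕ}

theorem dotProduct_vecMulVec_mulVec (φ v w : Fin m → ℝ) :
    v ⬝ᵥ (vecMulVec φ φ *ᵥ w) = (φ ⬝ᵥ v) * (φ ⬝ᵥ w) := by
  rw [vecMulVec_mulVec, dotProduct_smul, op_smul_eq_smul, smul_eq_mul, dotProduct_comm v φ,
    mul_comm]

theorem isHermitian_vecMulVec_self (φ : Fin m → ℝ) : (vecMulVec φ φ).IsHermitian :=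
  transpose_vecMulVec φ φ

theorem posSemidef_smul_vecMulVec_self (φ : Fin m → ℝ) {c : ℝ} (hc : 0 ≤ c) :
    (c • vecMulVec φ φ).PosSemidef :=
  (posSemidef_vecMulVec_self_star (R := ℝ) φ).smul hc

theorem dotProduct_mulVec_comm {R : Matrix (Fin m) (Fin m) ℝ} (hR : R.IsHermitian)
    (v w : Fin m → ℝ) : v ⬝ᵥ (R *ᵥ w) = w ⬝ᵥ (R *ᵥ v) := by
  have h : Rᵀ = R := hR
  rw [dotProduct_mulVec, ← mulVec_transpose, h, dotProduct_comm]

theorem quadForm_sub {R : Matrix (Fin m) (Fin m) ℝ} (hR : R.IsHermitian) (v w : Fin m → ℝ) :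
    (v - w) ⬝ᵥ (R *ᵥ (v - w)) = v ⬝ᵥ (R *ᵥ v) - 2 * (v ⬝ᵥ (R *ᵥ w)) + w ⬝ᵥ (R *ᵥ w) := by
  rw [mulVec_sub, dotProduct_sub, sub_dotProduct, sub_dotProduct, dotProduct_mulVec_comm hR w v]
  ring

theorem dotProduct_inv_mulVec_nonneg {R : Matrix (Fin m) (Fin m) ℝ} (hR : R.PosDef)
    (φ : Fin m → ℝ) : 0 ≤ φ ⬝ᵥ (R⁻¹ *ᵥ φ) :=
  hR.inv.posSemidef.dotProduct_mulVec_nonneg φ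

theorem mulVec_inv_mulVec {R : Matrix (Fin m) (Fin m) ℝ} (hR : R.PosDef) (φ : Fin m → ℝ) :
    R *ᵥ (R⁻¹ *ᵥ φ) = φ := by
  rw [mulVec_mulVec, mul_nonsing_inv R ((isUnit_iff_isUnit_det R).1 hR.isUnit), one_mulVec]

/-- The Sherman–Morrison formula for the update of the gain matrix. -/
theorem gainUpdate_inv_eq {R : Matrix (Fin m) (Fin m) ℝ} (hR : R.PosDef) (φ : Fin m → ℝ)
    (β : ℝ) {μ : ℝ} (hμ : 0 < μ) :
    gainUpdate R⁻¹ φ (1 / (μ + β ^ 2 * (φ ⬝ᵥ (R⁻¹ *ᵥ φ)))) β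
      = (R + (β ^ 2 / μ) • vecMulVec φ φ)⁻¹ := by
  set q := φ ⬝ᵥ (R⁻¹ *ᵥ φ) with hq
  have hq0 : 0 ≤ q := dotProduct_inv_mulVec_nonneg hR φ
  have hden : μ + β ^ 2 * q ≠ 0 := by positivity
  symm
  refine inv_eq_left_inv ?_
  have hunit := (isUnit_iff_isUnit_det R).1 hR.isUnit
  have h1 : R⁻¹ * R = 1 := nonsing_inv_mul R hunit
  have h2 : vecMulVec φ φ * R⁻¹ * vecMulVec φ φ = q • vecMulVec φ φ := by
    rw [Matrix.mul_assoc, mul_vecMulVec, vecMulVec_mul_vecMulVec, hq]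
    rw [vecMulVec_smul]
  rw [gainUpdate, Matrix.sub_mul, Matrix.mul_add, h1, Matrix.mul_add, Matrix.smul_mul,
    Matrix.smul_mul, Matrix.mul_smul, Matrix.mul_smul]
  have h3 : R⁻¹ * vecMulVec φ φ * R⁻¹ * R = R⁻¹ * vecMulVec φ φ := by
    rw [Matrix.mul_assoc, h1, Matrix.mul_one]
  have h4 : R⁻¹ * vecMulVec φ φ * R⁻¹ * vecMulVec φ φ = q • (R⁻¹ * vecMulVec φ φ) := by
    rw [Matrix.mul_assoc, Matrix.mul_assoc, ← Matrix.mul_assoc (vecMulVec φ φ), h2,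
      Matrix.mul_smul]
  rw [h3, h4, smul_smul, smul_smul, ← sub_sub, add_sub_assoc, ← sub_smul, add_sub_assoc, ← sub_smul,
    show β ^ 2 / μ - 1 / (μ + β ^ 2 * q) * β ^ 2
      - 1 / (μ + β ^ 2 * q) * β ^ 2 * (β ^ 2 / μ) * q = 0 by field_simp; ring,
    zero_smul, add_zero]

theorem posDef_add_smul_vecMulVec {R : Matrix (Fin m) (Fin m) ℝ} (hR : R.PosDef) (φ : Fin m → ℝ)
    {c : ℝ} (hc : 0 ≤ c) : (R + c • vecMulVec φ φ).PosDef :=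
  hR.add_posSemidef (posSemidef_smul_vecMulVec_self φ hc)

/-- The energy identity for one quasi-Newton step before projection. -/
theorem energy_step_eq {R : Matrix (Fin m) (Fin m) ℝ} (hR : R.PosDef) (φ v : Fin m → ℝ)
    (β r : ℝ) {μ : ℝ} (hμ : 0 < μ) :
    (v - (1 / (μ + β ^ 2 * (φ ⬝ᵥ (R⁻¹ *ᵥ φ))) * β * r) • (R⁻¹ *ᵥ φ)) ⬝ᵥ
      ((R + (β ^ 2 / μ) • vecMulVec φ φ) *ᵥ
        (v - (1 / (μ + β ^ 2 * (φ ⬝ᵥ (R⁻¹ *ᵥ φ))) * β * r) • (R⁻¹ *ᵥ φ)))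
    = v ⬝ᵥ (R *ᵥ v) + (1 / μ) * ((β * (φ ⬝ᵥ v)) ^ 2 - 2 * (β * (φ ⬝ᵥ v)) * r
      + β ^ 2 * (φ ⬝ᵥ (R⁻¹ *ᵥ φ)) / (μ + β ^ 2 * (φ ⬝ᵥ (R⁻¹ *ᵥ φ))) * r ^ 2) := by
  set q := φ ⬝ᵥ (R⁻¹ *ᵥ φ) with hq
  have hq0 : 0 ≤ q := dotProduct_inv_mulVec_nonneg hR φ
  have hden : μ + β ^ 2 * q ≠ 0 := by positivity
  set t := 1 / (μ + β ^ 2 * q) * β * r with ht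
  set p := R⁻¹ *ᵥ φ with hp
  have hRp : R *ᵥ p = φ := mulVec_inv_mulVec hR φ
  have h1 : v ⬝ᵥ (R *ᵥ p) = φ ⬝ᵥ v := by rw [hRp, dotProduct_comm]
  have h2 : p ⬝ᵥ (R *ᵥ v) = φ ⬝ᵥ v := by rw [dotProduct_mulVec_comm hR.isHermitian, h1]
  have h3 : p ⬝ᵥ (R *ᵥ p) = q := by rw [hRp, dotProduct_comm]
  have h4 : φ ⬝ᵥ (v - t • p) = φ ⬝ᵥ v - t * q := by
    rw [dotProduct_sub, dotProduct_smul, smul_eq_mul]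
  rw [add_mulVec, dotProduct_add, smul_mulVec, dotProduct_smul, dotProduct_vecMulVec_mulVec, h4,
    mulVec_sub, mulVec_smul, dotProduct_sub, sub_dotProduct, sub_dotProduct, smul_dotProduct,
    smul_dotProduct, dotProduct_smul, dotProduct_smul, h1, h2, h3]
  simp only [smul_eq_mul]
  rw [ht]
  field_simp
  ring

theorem det_add_smul_vecMulVec {R : Matrix (Fin m) (Fin m) ℝ} (hR : R.PosDef) (φ : Fin m → ℝ)
    (c : ℝ) :
    (R + c • vecMulVec φ φ).det = R.det * (1 + c * (φ ⬝ᵥ (R⁻¹ *ᵥ φ))) := by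
  have hunit := (isUnit_iff_isUnit_det R).1 hR.isUnit
  have h1 : R + c • vecMulVec φ φ = R * (1 + replicateCol Unit (c • (R⁻¹ *ᵥ φ))
      * replicateRow Unit φ) := by
    rw [← vecMulVec_eq, Matrix.mul_add, Matrix.mul_one, mul_vecMulVec, mulVec_smul,
      mulVec_inv_mulVec hR, smul_vecMulVec]
  rw [h1, det_mul, det_one_add_replicateCol_mul_replicateRow, dotProduct_smul, smul_eq_mul]

/-- The normalized gain is dominated by the increment of the log-determinant. -/
theorem gain_le_log_det_sub {R : Matrix (Fin m) (Fin m) ℝ} (hR : R.PosDef) (φ : Fin m → ℝ)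
    (β : ℝ) {μ : ℝ} (hμ : 0 < μ) :
    β ^ 2 * (φ ⬝ᵥ (R⁻¹ *ᵥ φ)) / (μ + β ^ 2 * (φ ⬝ᵥ (R⁻¹ *ᵥ φ)))
      ≤ Real.log (R + (β ^ 2 / μ) • vecMulVec φ φ).det - Real.log R.det := by
  set q := φ ⬝ᵥ (R⁻¹ *ᵥ φ) with hq
  have hq0 : 0 ≤ q := dotProduct_inv_mulVec_nonneg hR φ
  have hden : 0 < μ + β ^ 2 * q := by positivity
  have hpos : 0 < 1 + β ^ 2 / μ * q := by positivity
  rw [det_add_smul_vecMulVec hR, Real.log_mul hR.det_pos.ne' hpos.ne', add_sub_cancel_left]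
  -- At `x = 1 + β² q / μ`, the ratio of the two determinants, `1 - 1 / x` is exactly the normalized
  -- gain.
  refine le_trans (le_of_eq ?_) (Real.one_sub_inv_le_log_of_pos hpos)
  have : 1 + β ^ 2 / μ * q = (μ + β ^ 2 * q) / μ := by field_simp
  rw [this, inv_div]
  field_simp
  ring

/-- Every eigenvalue is positive, hence at most the trace. The crude bound suffices because only the
logarithm of the determinant enters. -/
theorem det_le_trace_pow {R : Matrix (Fin m) (Fin m) ℝ} (hR : R.PosDef) :
    R.det ≤ R.trace ^ m := by
  rw [hR.isHermitian.det_eq_prod_eigenvalues, hR.isHermitian.trace_eq_sum_eigenvalues]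
  simp only [RCLike.ofReal_real_eq_id, id_eq]
  calc ∏ i, hR.isHermitian.eigenvalues i
      ≤ ∏ _i : Fin m, ∑ j, hR.isHermitian.eigenvalues j :=
        Finset.prod_le_prod (fun i _ => (hR.eigenvalues_pos i).le) fun i _ =>
          Finset.single_le_sum (fun j _ => (hR.eigenvalues_pos j).le) (Finset.mem_univ i)
    _ = _ := by simp

/-! ### The largest eigenvalue -/

/-- The Rayleigh bound: the spectrum of `r - A` is nonnegative for `r` the supremum of the spectrum
of `A`. -/
theorem dotProduct_mulVec_le_sSup_spectrum {A : Matrix (Fin m) (Fin m) ℝ} (hA : A.IsHermitian)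
    (v : Fin m → ℝ) : v ⬝ᵥ (A *ᵥ v) ≤ sSup (spectrum ℝ A) * (v ⬝ᵥ v) := by
  set r := sSup (spectrum ℝ A) with hr
  have hps : (algebraMap ℝ (Matrix (Fin m) (Fin m) ℝ) r - A).PosSemidef := by
    rw [posSemidef_iff_isHermitian_and_spectrum_nonneg]
    refine ⟨?_, ?_⟩
    · refine IsHermitian.sub ?_ hA
      rw [Algebra.algebraMap_eq_smul_one]
      exact isHermitian_one.smul (IsSelfAdjoint.all r)
    · rw [← spectrum.singleton_sub_eq]
      rintro x ⟨y, hy, z, hz, rfl⟩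
      rw [Set.mem_singleton_iff] at hy
      subst hy
      simp only [Set.mem_ofPred_eq, sub_nonneg]
      exact le_csSup finite_real_spectrum.bddAbove hz
  have h := hps.dotProduct_mulVec_nonneg v
  rw [sub_mulVec, dotProduct_sub, Algebra.algebraMap_eq_smul_one, smul_mulVec, one_mulVec,
    dotProduct_smul, smul_eq_mul] at h
  simp only [star_trivial] at h
  linarith

theorem exists_sSup_spectrum_eigenvector (hm : 1 ≤ m) {A : Matrix (Fin m) (Fin m) ℝ}
    (hA : A.IsHermitian) :
    ∃ v : Fin m → ℝ, 0 < v ⬝ᵥ v ∧ v ⬝ᵥ (A *ᵥ v) = sSup (spectrum ℝ A) * (v ⬝ᵥ v) := by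
  have hne : (spectrum ℝ A).Nonempty := ⟨_, hA.eigenvalues_mem_spectrum_real ⟨0, hm⟩⟩
  have hmem := hne.csSup_mem finite_real_spectrum
  rw [hA.spectrum_real_eq_range_eigenvalues] at hmem ⊢
  obtain ⟨j, hj⟩ := hmem
  have hv : ((hA.eigenvectorBasis j : EuclideanSpace ℝ (Fin m)) : Fin m → ℝ) ≠ 0 := by
    intro h
    have h1 := hA.eigenvectorBasis.orthonormal.ne_zero j
    exact h1 (by ext i; exact congrFun h i)
  refine ⟨hA.eigenvectorBasis j, ?_, ?_⟩
  · have := dotProduct_star_self_pos_iff.2 hv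
    simpa using this
  · rw [hA.mulVec_eigenvectorBasis j, dotProduct_smul, hj, smul_eq_mul]

/-- The regularized information matrix. -/
def infoMatrix (lam₀ : ℝ) (φ : ℕ → Fin m → ℝ) (k : ℕ) : Matrix (Fin m) (Fin m) ℝ :=
  ∑ i ∈ Finset.range (k + 1), vecMulVec (φ i) (φ i) + lam₀ • (1 : Matrix (Fin m) (Fin m) ℝ)

theorem isHermitian_infoMatrix (lam₀ : ℝ) (φ : ℕ → Fin m → ℝ) (k : ℕ) :
    (infoMatrix lam₀ φ k).IsHermitian := by
  refine IsHermitian.add ?_ (isHermitian_one.smul (IsSelfAdjoint.all lam₀))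
  rw [IsHermitian, conjTranspose_sum]
  exact Finset.sum_congr rfl fun i _ => isHermitian_vecMulVec_self (φ i)

theorem dotProduct_infoMatrix_mulVec (lam₀ : ℝ) (φ : ℕ → Fin m → ℝ) (k : ℕ) (v : Fin m → ℝ) :
    v ⬝ᵥ (infoMatrix lam₀ φ k *ᵥ v)
      = ∑ i ∈ Finset.range (k + 1), (φ i ⬝ᵥ v) ^ 2 + lam₀ * (v ⬝ᵥ v) := by
  rw [infoMatrix, add_mulVec, dotProduct_add, smul_mulVec, one_mulVec, dotProduct_smul,
    smul_eq_mul, sum_mulVec, dotProduct_sum]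
  simp_rw [dotProduct_vecMulVec_mulVec, ← sq]

/-- A top eigenvector at time `k` is a test vector for the Rayleigh bound at time `k + 1`, where the
quadratic form has gained a square. -/
theorem sSup_spectrum_infoMatrix_mono (hm : 1 ≤ m) (lam₀ : ℝ) (φ : ℕ → Fin m → ℝ) :
    Monotone fun k => sSup (spectrum ℝ (infoMatrix lam₀ φ k)) := by
  refine monotone_nat_of_le_succ fun k => ?_
  obtain ⟨v, hv, h⟩ := exists_sSup_spectrum_eigenvector hm (isHermitian_infoMatrix lam₀ φ k)
  have h' := dotProduct_mulVec_le_sSup_spectrum (isHermitian_infoMatrix lam₀ φ (k + 1)) v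
  refine le_of_mul_le_mul_right (h.symm.le.trans (le_trans ?_ h')) hv
  rw [dotProduct_infoMatrix_mulVec, dotProduct_infoMatrix_mulVec, Finset.sum_range_succ _ (k + 1)]
  linarith [sq_nonneg (φ (k + 1) ⬝ᵥ v)]

theorem le_sSup_spectrum_infoMatrix (hm : 1 ≤ m) (lam₀ : ℝ) (φ : ℕ → Fin m → ℝ) (k : ℕ) :
    lam₀ ≤ sSup (spectrum ℝ (infoMatrix lam₀ φ k)) := by
  have h := dotProduct_mulVec_le_sSup_spectrum (isHermitian_infoMatrix lam₀ φ k)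
    (Pi.single ⟨0, hm⟩ 1)
  rw [dotProduct_infoMatrix_mulVec] at h
  have h1 : (Pi.single (⟨0, hm⟩ : Fin m) (1 : ℝ) : Fin m → ℝ) ⬝ᵥ Pi.single ⟨0, hm⟩ 1 = 1 := by simp
  rw [h1] at h
  have := Finset.sum_nonneg fun i (_ : i ∈ Finset.range (k + 1)) =>
    sq_nonneg (φ i ⬝ᵥ Pi.single (⟨0, hm⟩ : Fin m) (1 : ℝ))
  linarith

/-- Each diagonal entry is at most the largest eigenvalue, by testing with a coordinate vector;
there are `m` of them. -/
theorem sum_dotProduct_self_le (lam₀ : ℝ) (hlam₀ : 0 ≤ lam₀) (φ : ℕ → Fin m → ℝ) (k : ℕ) :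
    ∑ i ∈ Finset.range (k + 1), φ i ⬝ᵥ φ i ≤ m * sSup (spectrum ℝ (infoMatrix lam₀ φ k)) := by
  have h : ∀ j : Fin m, ∑ i ∈ Finset.range (k + 1), φ i j ^ 2
      ≤ sSup (spectrum ℝ (infoMatrix lam₀ φ k)) := by
    intro j
    have h := dotProduct_mulVec_le_sSup_spectrum (isHermitian_infoMatrix lam₀ φ k) (Pi.single j 1)
    rw [dotProduct_infoMatrix_mulVec] at h
    simp only [dotProduct_single, mul_one, Pi.single_eq_same] at h
    linarith
  calc ∑ i ∈ Finset.range (k + 1), φ i ⬝ᵥ φ i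
      = ∑ j, ∑ i ∈ Finset.range (k + 1), φ i j ^ 2 := by
        rw [Finset.sum_comm]
        simp only [dotProduct, sq]
    _ ≤ ∑ _j : Fin m, sSup (spectrum ℝ (infoMatrix lam₀ φ k)) := Finset.sum_le_sum fun j _ => h j
    _ = _ := by simp

/-- The test vector is `φ j` itself. Strictness is what moves the largest eigenvalue past `1` when
`lam₀ = 1`. -/
theorem lt_sSup_spectrum_infoMatrix (lam₀ : ℝ) (φ : ℕ → Fin m → ℝ) {j : ℕ} (hj : φ j ≠ 0) :
    lam₀ < sSup (spectrum ℝ (infoMatrix lam₀ φ j)) := by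
  have h := dotProduct_mulVec_le_sSup_spectrum (isHermitian_infoMatrix lam₀ φ j) (φ j)
  rw [dotProduct_infoMatrix_mulVec] at h
  have h1 : 0 < φ j ⬝ᵥ φ j := by
    have := dotProduct_star_self_pos_iff.2 hj
    simpa using this
  have h2 := Finset.single_le_sum (f := fun i => (φ i ⬝ᵥ φ j) ^ 2) (fun i _ => sq_nonneg _)
    (Finset.self_mem_range_succ j)
  have h3 : 0 < (φ j ⬝ᵥ φ j) ^ 2 := by positivity
  refine lt_of_mul_lt_mul_right ?_ h1.le
  linarith

/-! ### Projections -/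

theorem isProj_variational {D : Set (Fin m → ℝ)} (hD : Convex ℝ D) {Q : Matrix (Fin m) (Fin m) ℝ}
    (hQ : Q.IsHermitian) {x p z : Fin m → ℝ} (hp : IsProj D Q x p) (hz : z ∈ D) :
    (x - p) ⬝ᵥ (Q *ᵥ (z - p)) ≤ 0 := by
  by_contra! hc
  set b := (x - p) ⬝ᵥ (Q *ᵥ (z - p)) with hb
  set c := (z - p) ⬝ᵥ (Q *ᵥ (z - p)) with hcc
  have key : ∀ t : ℝ, 0 ≤ t → t ≤ 1 → 2 * t * b ≤ t ^ 2 * c := by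
    intro t ht0 ht1
    have hmem : p + t • (z - p) ∈ D := hD.add_smul_sub_mem hp.1 hz ⟨ht0, ht1⟩
    have h := hp.2 _ hmem
    have h1 : x - (p + t • (z - p)) = (x - p) - t • (z - p) := by abel
    rw [h1, quadForm_sub hQ (x - p), mulVec_smul, smul_dotProduct, dotProduct_smul,
      dotProduct_smul, ← hb, ← hcc] at h
    simp only [smul_eq_mul] at h
    linarith
  have h1 := key 1 zero_le_one le_rfl
  have hcpos : 0 < c := by linarith
  -- The quadratic `t² c - 2 t b` is smallest at `t = b / c`, and the case `t = 1` shows that this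
  -- point lies in `[0, 1]`.
  have h2 := key (b / c) (div_nonneg hc.le hcpos.le) (by rw [div_le_one hcpos]; linarith)
  have h3 : (b / c) ^ 2 * c = b / c * b := by field_simp
  rw [h3] at h2
  have h4 : 0 < b / c * b := mul_pos (div_pos hc hcpos) hc
  linarith

/-- In the expansion of the square of `z - x = (z - p) - (x - p)`, the variational inequality gives
the cross term the favourable sign. -/
theorem isProj_contract {D : Set (Fin m → ℝ)} (hD : Convex ℝ D) {Q : Matrix (Fin m) (Fin m) ℝ}
    (hQ : Q.PosDef) {x p z : Fin m → ℝ} (hp : IsProj D Q x p) (hz : z ∈ D) :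
    (z - p) ⬝ᵥ (Q *ᵥ (z - p)) ≤ (z - x) ⬝ᵥ (Q *ᵥ (z - x)) := by
  have h1 := isProj_variational hD hQ.isHermitian hp hz
  have h2 : z - x = (z - p) - (x - p) := by abel
  have h3 := hQ.posSemidef.dotProduct_mulVec_nonneg (x - p)
  simp only [star_trivial] at h3
  rw [h2, quadForm_sub hQ.isHermitian (z - p),
    dotProduct_mulVec_comm hQ.isHermitian (z - p) (x - p)]
  linarith

theorem isProj_unique {D : Set (Fin m → ℝ)} (hD : Convex ℝ D) {Q : Matrix (Fin m) (Fin m) ℝ}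
    (hQ : Q.PosDef) {x p p' : Fin m → ℝ} (hp : IsProj D Q x p) (hp' : IsProj D Q x p') :
    p = p' := by
  have h1 := isProj_variational hD hQ.isHermitian hp hp'.1
  have h2 := isProj_variational hD hQ.isHermitian hp' hp.1
  by_contra hne
  have h3 := hQ.dotProduct_mulVec_pos (sub_ne_zero.2 hne)
  have h4 : p - p' = (x - p') - (x - p) := by abel
  have h5 : p' - p = -(p - p') := by abel
  rw [h5, mulVec_neg, dotProduct_neg] at h1
  simp only [star_trivial] at h3
  nth_rewrite 1 [h4] at h3
  rw [sub_dotProduct] at h3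
  linarith

theorem isProj_proj {D : Set (Fin m → ℝ)} (hD : IsCompact D) (hne : D.Nonempty)
    (Q : Matrix (Fin m) (Fin m) ℝ) (x : Fin m → ℝ) : IsProj D Q x (proj D Q x) := by
  refine Classical.epsilon_spec (p := IsProj D Q x) ?_
  have hcont : Continuous fun p : Fin m → ℝ => (x - p) ⬝ᵥ (Q *ᵥ (x - p)) := by fun_prop
  obtain ⟨p, hp, h⟩ := hD.exists_isMinOn hne hcont.continuousOn
  exact ⟨p, hp, fun z hz => h hz⟩

/-- The preimage of a closed set `F` is the shadow, along the compact `D`, of the closed set of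
pairs of a datum and a minimizer in `F`. Uniqueness of the minimizer identifies it with the chosen
point `proj`. -/
theorem continuousOn_proj {D : Set (Fin m → ℝ)} (hD : IsCompact D) (hne : D.Nonempty)
    (hconv : Convex ℝ D) {K : Set (Matrix (Fin m) (Fin m) ℝ × (Fin m → ℝ))}
    (hK : ∀ q ∈ K, q.1.PosDef) : ContinuousOn (fun q => proj D q.1 q.2) K := by
  rw [continuousOn_iff_continuous_domRestrict, continuous_iff_isClosed]
  intro F hF
  have : CompactSpace D := isCompact_iff_compactSpace.1 hD
  have hset : K.domRestrict (fun q => proj D q.1 q.2) ⁻¹' F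
      = Prod.fst '' {a : K × D | (a.2 : Fin m → ℝ) ∈ F ∧ ∀ z ∈ D,
        ((a.1 : Matrix (Fin m) (Fin m) ℝ × (Fin m → ℝ)).2 - (a.2 : Fin m → ℝ))
            ⬝ᵥ (a.1.1.1 *ᵥ (a.1.1.2 - (a.2 : Fin m → ℝ)))
          ≤ (a.1.1.2 - z) ⬝ᵥ (a.1.1.1 *ᵥ (a.1.1.2 - z))} := by
    ext q
    constructor
    · intro hq
      have hp := isProj_proj hD hne q.1.1 q.1.2
      exact ⟨(q, ⟨_, hp.1⟩), ⟨hq, hp.2⟩, rfl⟩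
    · rintro ⟨⟨q', p⟩, ⟨hpF, hp⟩, rfl⟩
      have h := isProj_unique hconv (hK _ q'.2) (isProj_proj hD hne q'.1.1 q'.1.2) ⟨p.2, hp⟩
      change proj D q'.1.1 q'.1.2 ∈ F
      rw [h]
      exact hpF
  rw [hset]
  refine isClosedMap_fst_of_compactSpace _ ?_
  have h1 : IsClosed {a : K × D | (a.2 : Fin m → ℝ) ∈ F} :=
    hF.preimage (continuous_subtype_val.comp continuous_snd)
  have h2 : IsClosed (⋂ z ∈ D, {a : K × D |
      ((a.1 : Matrix (Fin m) (Fin m) ℝ × (Fin m → ℝ)).2 - (a.2 : Fin m → ℝ))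
        ⬝ᵥ (a.1.1.1 *ᵥ (a.1.1.2 - (a.2 : Fin m → ℝ)))
      ≤ (a.1.1.2 - z) ⬝ᵥ (a.1.1.1 *ᵥ (a.1.1.2 - z))}) := by
    refine isClosed_iInter fun z => isClosed_iInter fun _ => isClosed_le ?_ ?_ <;> fun_prop
  convert h1.inter h2 using 1
  ext a
  simp

end Matrix

/-! ### Analysis along one sample path -/

section Path

open Matrix

variable {m : ℕ}

/-- The energy inequality is summed; the negative drift `-x² / 2` pays for the linear noise term,
and `V ≥ 0` bounds what is left. -/
theorem sum_sq_div_le_of_descent {V x ψ δ w h μ : ℕ → ℝ} {a B : ℝ} (ha : 0 < a)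
    (hμ : ∀ k, a ≤ μ k) (hV : ∀ k, 0 ≤ V k)
    (hstep : ∀ k, V (k + 1) ≤ V k
      + (1 / μ k) * (x k ^ 2 - 2 * x k * (ψ k + w k) + h k * (ψ k + w k) ^ 2))
    (hψ : ∀ k, x k ^ 2 - 2 * x k * ψ k ≤ -(1 / 2) * x k ^ 2 + 2 * δ k ^ 2)
    (hB : ∀ k, |ψ k| ≤ B) (hh : ∀ k, 0 ≤ h k)
    (hlin : ∀ ε > 0, ∃ C, ∀ n, |∑ k ∈ Finset.range n, x k / μ k * w k|
      ≤ ε * ∑ k ∈ Finset.range n, (x k / μ k) ^ 2 + C)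
    (hsq : ∃ C, 0 ≤ C ∧ ∀ n, ∑ k ∈ Finset.range n, h k * w k ^ 2
      ≤ C * (1 + ∑ k ∈ Finset.range n, h k)) :
    ∃ C, 0 ≤ C ∧ ∀ n, ∑ k ∈ Finset.range n, x k ^ 2 / μ k
      ≤ C * (1 + ∑ k ∈ Finset.range n, δ k ^ 2 + ∑ k ∈ Finset.range n, h k) := by
  -- As `a ∑ (x / μ)² ≤ ∑ x² / μ`, twice the noise sum costs at most a quarter of `∑ x² / μ` plus a
  -- constant. A quarter of it remains of the drift, whence the factor `4` in the constants.
  obtain ⟨C₁, hC₁⟩ := hlin (a / 8) (by positivity)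
  obtain ⟨C₂, hC₂0, hC₂⟩ := hsq
  have hμ0 : ∀ k, 0 < μ k := fun k => ha.trans_le (hμ k)
  have hdiv : ∀ k, ∀ t : ℝ, 0 ≤ t → 1 / μ k * t ≤ 1 / a * t := fun k t ht =>
    mul_le_mul_of_nonneg_right (one_div_le_one_div_of_le ha (hμ k)) ht
  have hone : ∀ k, V (k + 1) ≤ V k + (-(1 / 2) * (x k ^ 2 / μ k) + 2 / a * δ k ^ 2
      - 2 * (x k / μ k * w k) + 2 * B ^ 2 / a * h k + 2 / a * (h k * w k ^ 2)) := by
    intro k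
    refine (hstep k).trans (add_le_add_right ?_ _)
    have hB2 : ψ k ^ 2 ≤ B ^ 2 := by
      rw [← sq_abs]
      exact pow_le_pow_left₀ (abs_nonneg _) (hB k) 2
    have h1 : h k * (ψ k + w k) ^ 2 ≤ 2 * (h k * B ^ 2) + 2 * (h k * w k ^ 2) := by
      have h2 : (ψ k + w k) ^ 2 ≤ 2 * B ^ 2 + 2 * w k ^ 2 := by nlinarith [sq_nonneg (ψ k - w k)]
      nlinarith [mul_le_mul_of_nonneg_left h2 (hh k)]
    have h3 : x k ^ 2 - 2 * x k * (ψ k + w k) + h k * (ψ k + w k) ^ 2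
        ≤ -(1 / 2) * x k ^ 2 - 2 * (x k * w k)
          + (2 * δ k ^ 2 + 2 * (h k * B ^ 2) + 2 * (h k * w k ^ 2)) := by
      have := hψ k
      linarith
    have h4 := mul_le_mul_of_nonneg_left h3 (one_div_pos.2 (hμ0 k)).le
    have h5 := hdiv k (2 * δ k ^ 2 + 2 * (h k * B ^ 2) + 2 * (h k * w k ^ 2))
      (by have := hh k; positivity)
    have h6 : 1 / μ k * (-(1 / 2) * x k ^ 2 - 2 * (x k * w k)
          + (2 * δ k ^ 2 + 2 * (h k * B ^ 2) + 2 * (h k * w k ^ 2)))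
        = -(1 / 2) * (x k ^ 2 / μ k) - 2 * (x k / μ k * w k)
          + 1 / μ k * (2 * δ k ^ 2 + 2 * (h k * B ^ 2) + 2 * (h k * w k ^ 2)) := by ring
    have h7 : 1 / a * (2 * δ k ^ 2 + 2 * (h k * B ^ 2) + 2 * (h k * w k ^ 2))
        = 2 / a * δ k ^ 2 + 2 * B ^ 2 / a * h k + 2 / a * (h k * w k ^ 2) := by ring
    linarith
  have htel : ∀ n, V n ≤ V 0 + (-(1 / 2) * ∑ k ∈ Finset.range n, x k ^ 2 / μ k
      + 2 / a * ∑ k ∈ Finset.range n, δ k ^ 2 - 2 * ∑ k ∈ Finset.range n, x k / μ k * w k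
      + 2 * B ^ 2 / a * ∑ k ∈ Finset.range n, h k
      + 2 / a * ∑ k ∈ Finset.range n, h k * w k ^ 2) := by
    intro n
    induction n with
    | zero => simp
    | succ n ih =>
      simp only [Finset.sum_range_succ]
      have := hone n
      linarith
  have hx2 : ∀ n, a * ∑ k ∈ Finset.range n, (x k / μ k) ^ 2
      ≤ ∑ k ∈ Finset.range n, x k ^ 2 / μ k := by
    intro n
    rw [Finset.mul_sum]
    refine Finset.sum_le_sum fun k _ => ?_
    have h1 : a * (x k / μ k) ^ 2 = x k ^ 2 / μ k * (a / μ k) := by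
      have := (hμ0 k).ne'
      field_simp
    rw [h1]
    exact mul_le_of_le_one_right (div_nonneg (sq_nonneg _) (hμ0 k).le)
      ((div_le_one (hμ0 k)).2 (hμ k))
  refine ⟨4 * V 0 + 8 * |C₁| + 8 / a + 8 * B ^ 2 / a + 8 / a * C₂,
    by have := hV 0; positivity, fun n => ?_⟩
  have h1 := htel n
  have h2 := hV n
  have h3 := (neg_abs_le _).trans' (neg_le_neg (hC₁ n))
  have h4 := hx2 n
  have h5 := mul_le_mul_of_nonneg_left (hC₂ n) (div_pos two_pos ha).le
  have h6 := le_abs_self C₁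
  set X := ∑ k ∈ Finset.range n, x k ^ 2 / μ k
  set Δ := ∑ k ∈ Finset.range n, δ k ^ 2 with hΔ
  set H := ∑ k ∈ Finset.range n, h k with hH
  have hΔ0 : 0 ≤ Δ := Finset.sum_nonneg fun k _ => sq_nonneg _
  have hH0 : 0 ≤ H := Finset.sum_nonneg fun k _ => hh k
  have hX : X ≤ 4 * V 0 + 8 * |C₁| + 8 / a * Δ + 8 * B ^ 2 / a * H + 8 / a * C₂ * (1 + H) := by
    have e1 : 8 / a * Δ = 4 * (2 / a * Δ) := by ring
    have e2 : 8 * B ^ 2 / a * H = 4 * (2 * B ^ 2 / a * H) := by ring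
    have e3 : 8 / a * C₂ * (1 + H) = 4 * (2 / a * (C₂ * (1 + H))) := by ring
    rw [e1, e2, e3]
    linarith
  have n1 : 0 ≤ 4 * V 0 + 8 * |C₁| := by have := hV 0; positivity
  have n2 : 0 ≤ 8 / a := by positivity
  have n3 : 0 ≤ 8 * B ^ 2 / a := by positivity
  have n4 : 0 ≤ 8 / a * C₂ := by positivity
  nlinarith [mul_nonneg n1 hΔ0, mul_nonneg n1 hH0, mul_nonneg n2 hH0, mul_nonneg n3 hΔ0,
    mul_nonneg n4 hΔ0]

/-- The normalized gain `β² φᵀPφ / (μ + β² φᵀPφ)`. -/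
noncomputable def normGain (P : Matrix (Fin m) (Fin m) ℝ) (φ : Fin m → ℝ) (μ β : ℝ) : ℝ :=
  β ^ 2 * (φ ⬝ᵥ (P *ᵥ φ)) / (μ + β ^ 2 * (φ ⬝ᵥ (P *ᵥ φ)))

theorem PosDef.quadForm_nonneg {P : Matrix (Fin m) (Fin m) ℝ} (hP : P.PosDef) (φ : Fin m → ℝ) :
    0 ≤ φ ⬝ᵥ (P *ᵥ φ) :=
  hP.posSemidef.dotProduct_mulVec_nonneg φ

theorem normGain_nonneg {P : Matrix (Fin m) (Fin m) ℝ} (hP : P.PosDef) (φ : Fin m → ℝ) {μ : ℝ}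
    (hμ : 0 < μ) (β : ℝ) : 0 ≤ normGain P φ μ β := by
  have := PosDef.quadForm_nonneg hP φ
  unfold normGain
  positivity

theorem normGain_le_one {P : Matrix (Fin m) (Fin m) ℝ} (hP : P.PosDef) (φ : Fin m → ℝ) {μ : ℝ}
    (hμ : 0 < μ) (β : ℝ) : normGain P φ μ β ≤ 1 := by
  have := PosDef.quadForm_nonneg hP φ
  unfold normGain
  rw [div_le_one (by positivity)]
  linarith

theorem inv_inv_of_posDef {P : Matrix (Fin m) (Fin m) ℝ} (hP : P.PosDef) : P⁻¹⁻¹ = P :=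
  nonsing_inv_nonsing_inv P ((isUnit_iff_isUnit_det P).1 hP.isUnit)

theorem gainUpdate_eq_inv {P : Matrix (Fin m) (Fin m) ℝ} (hP : P.PosDef) (φ : Fin m → ℝ)
    (β : ℝ) {μ : ℝ} (hμ : 0 < μ) :
    gainUpdate P φ (1 / (μ + β ^ 2 * (φ ⬝ᵥ (P *ᵥ φ)))) β
      = (P⁻¹ + (β ^ 2 / μ) • vecMulVec φ φ)⁻¹ := by
  have h := gainUpdate_inv_eq hP.inv φ β hμ
  rwa [inv_inv_of_posDef hP] at h

theorem posDef_gainUpdate {P : Matrix (Fin m) (Fin m) ℝ} (hP : P.PosDef) (φ : Fin m → ℝ)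
    (β : ℝ) {μ : ℝ} (hμ : 0 < μ) :
    (gainUpdate P φ (1 / (μ + β ^ 2 * (φ ⬝ᵥ (P *ᵥ φ)))) β).PosDef := by
  rw [gainUpdate_eq_inv hP φ β hμ]
  exact (posDef_add_smul_vecMulVec hP.inv φ (by positivity)).inv

theorem inv_gainUpdate {P : Matrix (Fin m) (Fin m) ℝ} (hP : P.PosDef) (φ : Fin m → ℝ)
    (β : ℝ) {μ : ℝ} (hμ : 0 < μ) :
    (gainUpdate P φ (1 / (μ + β ^ 2 * (φ ⬝ᵥ (P *ᵥ φ)))) β)⁻¹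
      = P⁻¹ + (β ^ 2 / μ) • vecMulVec φ φ := by
  rw [gainUpdate_eq_inv hP φ β hμ]
  exact inv_inv_of_posDef (posDef_add_smul_vecMulVec hP.inv φ (by positivity))

theorem quadForm_gainUpdate_le {P : Matrix (Fin m) (Fin m) ℝ} (hP : P.IsHermitian)
    (φ v : Fin m → ℝ) {a : ℝ} (ha : 0 ≤ a) (β : ℝ) :
    v ⬝ᵥ (gainUpdate P φ a β *ᵥ v) ≤ v ⬝ᵥ (P *ᵥ v) := by
  have h1 : v ⬝ᵥ ((P * vecMulVec φ φ * P) *ᵥ v) = (φ ⬝ᵥ (P *ᵥ v)) ^ 2 := by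
    rw [← mulVec_mulVec, ← mulVec_mulVec, dotProduct_mulVec_comm hP, ← dotProduct_comm,
      dotProduct_comm, ← dotProduct_vecMulVec_mulVec φ _ _ |>.trans (sq _).symm, dotProduct_comm]
  rw [gainUpdate, sub_mulVec, dotProduct_sub, smul_mulVec, dotProduct_smul, h1, smul_eq_mul]
  have : 0 ≤ a * β ^ 2 * (φ ⬝ᵥ (P *ᵥ v)) ^ 2 := by positivity
  linarith

/-- The projection uses the same metric `P'⁻¹` as the new energy, so it can only decrease the value
that `energy_step_eq` gives before projection. -/
theorem energy_estimateUpdate_le {D : Set (Fin m → ℝ)} (hD : IsCompact D) (hconv : Convex ℝ D)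
    {P : Matrix (Fin m) (Fin m) ℝ} (hP : P.PosDef) {θ : Fin m → ℝ} (hθ : θ ∈ D)
    (φ θhat : Fin m → ℝ) (G : ℝ → ℝ) (y β : ℝ) {μ : ℝ} (hμ : 0 < μ)
    {a : ℝ} (ha : a = 1 / (μ + β ^ 2 * (φ ⬝ᵥ (P *ᵥ φ))))
    {P' : Matrix (Fin m) (Fin m) ℝ} (hP' : P' = gainUpdate P φ a β)
    {θ' : Fin m → ℝ} (hθ' : θ' = estimateUpdate D G P P' φ θhat a β y) :
    (θ - θ') ⬝ᵥ (P'⁻¹ *ᵥ (θ - θ')) ≤ (θ - θhat) ⬝ᵥ (P⁻¹ *ᵥ (θ - θhat))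
      + (1 / μ) * ((β * (φ ⬝ᵥ (θ - θhat))) ^ 2
        - 2 * (β * (φ ⬝ᵥ (θ - θhat))) * (y - G (φ ⬝ᵥ θhat))
        + normGain P φ μ β * (y - G (φ ⬝ᵥ θhat)) ^ 2) := by
  subst ha
  have hpd : P'⁻¹.PosDef := by
    rw [hP']
    exact (posDef_gainUpdate hP φ β hμ).inv
  have hproj := isProj_proj hD ⟨θ, hθ⟩ P'⁻¹
    (θhat + (1 / (μ + β ^ 2 * (φ ⬝ᵥ (P *ᵥ φ))) * β * (y - G (φ ⬝ᵥ θhat))) • (P *ᵥ φ))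
  have h1 := isProj_contract hconv hpd hproj hθ
  have h2 := energy_step_eq hP.inv φ (θ - θhat) β (y - G (φ ⬝ᵥ θhat)) hμ
  rw [inv_inv_of_posDef hP] at h2
  rw [hθ', estimateUpdate]
  refine h1.trans ?_
  rw [← sub_sub]
  rw [normGain, ← h2, ← inv_gainUpdate hP φ β hμ, ← hP']

/-! ### Growth of the log-determinant -/

theorem log_one_add_le {x : ℝ} (hx : 0 ≤ x) : Real.log (1 + x) ≤ 1 + max 0 (Real.log x) := by
  rcases le_total x 1 with h | h
  · have h1 := Real.log_le_sub_one_of_pos (show 0 < 1 + x by linarith)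
    have := le_max_left 0 (Real.log x)
    linarith
  · have h1 : Real.log (1 + x) ≤ Real.log (2 * x) := Real.log_le_log (by linarith) (by linarith)
    rw [Real.log_mul two_ne_zero (by linarith)] at h1
    have h2 := Real.log_le_sub_one_of_pos (show (0 : ℝ) < 2 by norm_num)
    have := le_max_right 0 (Real.log x)
    linarith

theorem trace_eq_of_rec {R : ℕ → Matrix (Fin m) (Fin m) ℝ} {c : ℕ → ℝ} {φ : ℕ → Fin m → ℝ}
    (hR : ∀ k, R (k + 1) = R k + c k • vecMulVec (φ k) (φ k)) (n : ℕ) :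
    (R n).trace = (R 0).trace + ∑ k ∈ Finset.range n, c k * (φ k ⬝ᵥ φ k) := by
  induction n with
  | zero => simp
  | succ n ih =>
    rw [hR, trace_add, ih, trace_smul, trace_vecMulVec, Finset.sum_range_succ, smul_eq_mul,
      add_assoc]

/-- The trace grows at most linearly in the largest eigenvalue, and the determinant is at most its
`m`-th power. The positive part of the logarithm covers eigenvalues below `1`. -/
theorem log_det_le {R : ℕ → Matrix (Fin m) (Fin m) ℝ} {c : ℕ → ℝ} {φ : ℕ → Fin m → ℝ}
    (hpd : ∀ k, (R k).PosDef) (hR : ∀ k, R (k + 1) = R k + c k • vecMulVec (φ k) (φ k))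
    {b : ℝ} (hc : ∀ k, c k ≤ b) (hb : 0 ≤ b) {lam₀ : ℝ} (hlam₀ : 0 ≤ lam₀) (hm : 1 ≤ m) :
    ∃ C, 0 ≤ C ∧ ∀ k, Real.log (R (k + 1)).det - Real.log (R 0).det
      ≤ C * (1 + max 0 (Real.log (sSup (spectrum ℝ (infoMatrix lam₀ φ k))))) := by
  -- Chosen so that the trace of `R (k + 1)`, at most `trace (R 0) + b m λ`, is below `T (1 + λ)`;
  -- the summand `1` keeps `log T` nonnegative.
  set T : ℝ := 1 + (R 0).trace + b * m with hT
  have htr0 : 0 ≤ (R 0).trace := (hpd 0).posSemidef.trace_nonneg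
  have hT1 : 1 ≤ T := by rw [hT]; nlinarith [mul_nonneg hb (Nat.cast_nonneg' m (α := ℝ))]
  refine ⟨m * Real.log T + m + |Real.log (R 0).det|, ?_, fun k => ?_⟩
  · have := Real.log_nonneg hT1
    positivity
  set lam := sSup (spectrum ℝ (infoMatrix lam₀ φ k)) with hlam
  have hlam0 : 0 ≤ lam := hlam₀.trans (le_sSup_spectrum_infoMatrix hm lam₀ φ k)
  have htr : (R (k + 1)).trace ≤ T * (1 + lam) := by
    rw [trace_eq_of_rec hR]
    have h1 : ∑ i ∈ Finset.range (k + 1), c i * (φ i ⬝ᵥ φ i) ≤ b * (m * lam) := by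
      calc _ ≤ ∑ i ∈ Finset.range (k + 1), b * (φ i ⬝ᵥ φ i) :=
            Finset.sum_le_sum fun i _ => mul_le_mul_of_nonneg_right (hc i)
              (by simpa using dotProduct_star_self_nonneg (φ i))
        _ = b * ∑ i ∈ Finset.range (k + 1), φ i ⬝ᵥ φ i := by rw [Finset.mul_sum]
        _ ≤ _ := mul_le_mul_of_nonneg_left (sum_dotProduct_self_le lam₀ hlam₀ φ k) hb
    have h2 : 0 ≤ b * m := by positivity
    rw [hT]
    nlinarith [mul_nonneg htr0 hlam0]
  have h1 : Real.log (R (k + 1)).det ≤ m * Real.log (T * (1 + lam)) := by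
    rw [← Real.log_pow]
    refine Real.log_le_log (hpd _).det_pos ((det_le_trace_pow (hpd _)).trans ?_)
    exact pow_le_pow_left₀ (hpd _).posSemidef.trace_nonneg htr m
  rw [Real.log_mul (by linarith) (by linarith)] at h1
  have h2 := mul_le_mul_of_nonneg_left (log_one_add_le hlam0) (Nat.cast_nonneg' m (α := ℝ))
  have h3 := neg_abs_le (Real.log (R 0).det)
  have h4 : 0 ≤ max 0 (Real.log lam) := le_max_left _ _
  have h5 : 0 ≤ (m : ℝ) * Real.log T := mul_nonneg (Nat.cast_nonneg' m) (Real.log_nonneg hT1)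
  nlinarith [mul_nonneg h5 h4, mul_nonneg (abs_nonneg (Real.log (R 0).det)) h4]

/-- A quasi-Newton recursion along one sample path. -/
structure IsQuasiNewton (D : Set (Fin m → ℝ)) (G : ℕ → ℝ → ℝ) (φ : ℕ → Fin m → ℝ) (y μ β : ℕ → ℝ)
    (θhat : ℕ → Fin m → ℝ) (P : ℕ → Matrix (Fin m) (Fin m) ℝ) : Prop where
  posDef_zero : (P 0).PosDef
  mem_zero : θhat 0 ∈ D
  gain_succ : ∀ k, P (k + 1)
    = gainUpdate (P k) (φ k) (1 / (μ k + β k ^ 2 * (φ k ⬝ᵥ (P k *ᵥ φ k)))) (β k)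
  estimate_succ : ∀ k, θhat (k + 1) = estimateUpdate D (G k) (P k) (P (k + 1)) (φ k) (θhat k)
    (1 / (μ k + β k ^ 2 * (φ k ⬝ᵥ (P k *ᵥ φ k)))) (β k) (y k)

/-! ### Invariants and summed energy of a quasi-Newton recursion -/

namespace IsQuasiNewton

variable {D : Set (Fin m → ℝ)} {G : ℕ → ℝ → ℝ} {φ : ℕ → Fin m → ℝ} {y μ β : ℕ → ℝ}
  {θhat : ℕ → Fin m → ℝ} {P : ℕ → Matrix (Fin m) (Fin m) ℝ}

theorem posDef (h : IsQuasiNewton D G φ y μ β θhat P) (hμ : ∀ k, 0 < μ k) (k : ℕ) :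
    (P k).PosDef := by
  induction k with
  | zero => exact h.posDef_zero
  | succ k ih => rw [h.gain_succ]; exact posDef_gainUpdate ih _ _ (hμ k)

theorem inv_succ (h : IsQuasiNewton D G φ y μ β θhat P) (hμ : ∀ k, 0 < μ k) (k : ℕ) :
    (P (k + 1))⁻¹ = (P k)⁻¹ + (β k ^ 2 / μ k) • vecMulVec (φ k) (φ k) := by
  rw [h.gain_succ]
  exact inv_gainUpdate (h.posDef hμ k) _ _ (hμ k)

theorem mem (h : IsQuasiNewton D G φ y μ β θhat P) (hD : IsCompact D) (hne : D.Nonempty) (k : ℕ) :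
    θhat k ∈ D := by
  cases k with
  | zero => exact h.mem_zero
  | succ k => rw [h.estimate_succ]; exact (isProj_proj hD hne _ _).1

/-- The gain matrices decrease in the Loewner order. With bounded regressors this keeps `φᵀP̄φ`
bounded, and so `β̄` away from zero. -/
theorem quadForm_le (h : IsQuasiNewton D G φ y μ β θhat P) (hμ : ∀ k, 0 < μ k) (v : Fin m → ℝ)
    (k : ℕ) : v ⬝ᵥ (P k *ᵥ v) ≤ sSup (spectrum ℝ (P 0)) * (v ⬝ᵥ v) := by
  induction k with
  | zero => exact dotProduct_mulVec_le_sSup_spectrum h.posDef_zero.isHermitian v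
  | succ k ih =>
    rw [h.gain_succ]
    refine (quadForm_gainUpdate_le (h.posDef hμ k).isHermitian _ _ ?_ _).trans ih
    have h1 := PosDef.quadForm_nonneg (h.posDef hμ k) (φ k)
    have h2 := hμ k
    positivity

theorem sum_normGain_le (h : IsQuasiNewton D G φ y μ β θhat P) {a b : ℝ} (ha : 0 < a)
    (hμ : ∀ k, a ≤ μ k) (hβ : ∀ k, β k ^ 2 ≤ b) {lam₀ : ℝ} (hlam₀ : 0 ≤ lam₀) (hm : 1 ≤ m) :
    ∃ C, 0 ≤ C ∧ ∀ k, ∑ i ∈ Finset.range (k + 1), normGain (P i) (φ i) (μ i) (β i)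
      ≤ C * (1 + max 0 (Real.log (sSup (spectrum ℝ (infoMatrix lam₀ φ k))))) := by
  have hμ0 : ∀ k, 0 < μ k := fun k => ha.trans_le (hμ k)
  have hb : 0 ≤ b := (sq_nonneg _).trans (hβ 0)
  obtain ⟨C, hC0, hC⟩ := log_det_le (R := fun k => (P k)⁻¹) (c := fun k => β k ^ 2 / μ k)
    (fun k => (h.posDef hμ0 k).inv) (h.inv_succ hμ0) (b := b / a)
    (fun k => div_le_div₀ hb (hβ k) ha (hμ k)) (by positivity) hlam₀ hm
  refine ⟨C, hC0, fun k => le_trans ?_ (hC k)⟩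
  rw [← Finset.sum_range_sub (fun i => Real.log (P i)⁻¹.det)]
  refine Finset.sum_le_sum fun i _ => ?_
  have h1 := gain_le_log_det_sub (h.posDef hμ0 i).inv (φ i) (β i) (hμ0 i)
  rw [inv_inv_of_posDef (h.posDef hμ0 i), ← h.inv_succ hμ0] at h1
  exact h1

/-- The common core of both steps: `δ` measures how far `β φᵀ(θ - θ̂)` is from a valid descent
direction. It is zero in the first step and controlled by the first step in the second. -/
theorem sum_sq_le (h : IsQuasiNewton D G φ y μ β θhat P) (hD : IsCompact D) (hconv : Convex ℝ D)
    {θ : Fin m → ℝ} (hθ : θ ∈ D) {a b B : ℝ} (ha : 0 < a)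
    (hμ : ∀ k, a ≤ μ k) (hβ : ∀ k, β k ^ 2 ≤ b) {lam₀ : ℝ} (hlam₀ : 0 ≤ lam₀) (hm : 1 ≤ m)
    {δ : ℕ → ℝ}
    (hψ : ∀ k, (β k * (φ k ⬝ᵥ (θ - θhat k))) ^ 2
      - 2 * (β k * (φ k ⬝ᵥ (θ - θhat k))) * (G k (φ k ⬝ᵥ θ) - G k (φ k ⬝ᵥ θhat k))
      ≤ -(1 / 2) * (β k * (φ k ⬝ᵥ (θ - θhat k))) ^ 2 + 2 * δ k ^ 2)
    (hB : ∀ k, |G k (φ k ⬝ᵥ θ) - G k (φ k ⬝ᵥ θhat k)| ≤ B)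
    (hlin : ∀ ε > 0, ∃ C, ∀ n,
      |∑ k ∈ Finset.range n, β k * (φ k ⬝ᵥ (θ - θhat k)) / μ k * (y k - G k (φ k ⬝ᵥ θ))|
      ≤ ε * ∑ k ∈ Finset.range n, (β k * (φ k ⬝ᵥ (θ - θhat k)) / μ k) ^ 2 + C)
    (hsq : ∃ C, 0 ≤ C ∧ ∀ n,
      ∑ k ∈ Finset.range n, normGain (P k) (φ k) (μ k) (β k) * (y k - G k (φ k ⬝ᵥ θ)) ^ 2
      ≤ C * (1 + ∑ k ∈ Finset.range n, normGain (P k) (φ k) (μ k) (β k))) :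
    ∃ C, 0 ≤ C ∧ ∀ k, ∑ i ∈ Finset.range (k + 1), (β i * (φ i ⬝ᵥ (θ - θhat i))) ^ 2 / μ i
      ≤ C * (1 + ∑ i ∈ Finset.range (k + 1), δ i ^ 2
        + max 0 (Real.log (sSup (spectrum ℝ (infoMatrix lam₀ φ k))))) := by
  have hμ0 : ∀ k, 0 < μ k := fun k => ha.trans_le (hμ k)
  obtain ⟨C₁, hC₁0, hC₁⟩ := sum_sq_div_le_of_descent
    (V := fun k => (θ - θhat k) ⬝ᵥ ((P k)⁻¹ *ᵥ (θ - θhat k)))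
    (x := fun k => β k * (φ k ⬝ᵥ (θ - θhat k)))
    (ψ := fun k => G k (φ k ⬝ᵥ θ) - G k (φ k ⬝ᵥ θhat k)) (δ := δ)
    (w := fun k => y k - G k (φ k ⬝ᵥ θ)) (h := fun k => normGain (P k) (φ k) (μ k) (β k))
    ha hμ (fun k => PosDef.quadForm_nonneg (h.posDef hμ0 k).inv _)
    (fun k => by
      have h1 := energy_estimateUpdate_le hD hconv (h.posDef hμ0 k) hθ (φ k) (θhat k) (G k) (y k)
        (β k) (hμ0 k) rfl (h.gain_succ k) (h.estimate_succ k)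
      have h2 : G k (φ k ⬝ᵥ θ) - G k (φ k ⬝ᵥ θhat k) + (y k - G k (φ k ⬝ᵥ θ))
        = y k - G k (φ k ⬝ᵥ θhat k) := by ring
      simp only [h2]
      exact h1)
    hψ hB (fun k => normGain_nonneg (h.posDef hμ0 k) _ (hμ0 k) _) hlin hsq
  obtain ⟨C₂, hC₂0, hC₂⟩ := h.sum_normGain_le ha hμ hβ hlam₀ hm
  refine ⟨C₁ * (1 + C₂), by positivity, fun k => (hC₁ (k + 1)).trans ?_⟩
  rw [mul_assoc]
  refine mul_le_mul_of_nonneg_left ?_ hC₁0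
  have h1 := hC₂ k
  have h2 : 0 ≤ ∑ i ∈ Finset.range (k + 1), δ i ^ 2 := Finset.sum_nonneg fun i _ => sq_nonneg _
  have h3 : 0 ≤ max 0 (Real.log (sSup (spectrum ℝ (infoMatrix lam₀ φ k)))) := le_max_left _ _
  nlinarith [mul_nonneg hC₂0 h2]

end IsQuasiNewton

/-- The properties of one sample path that the analysis of the algorithm uses. -/
structure IsGoodPath (D : Set (Fin m → ℝ)) (θ : Fin m → ℝ) (G : ℕ → ℝ → ℝ) (M : ℕ → ℝ)
    (φ : ℕ → Fin m → ℝ) (a b B : ℝ) : Prop where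
  compact : IsCompact D
  convex : Convex ℝ D
  mem : θ ∈ D
  abs_dot_le : ∀ k, ∀ x ∈ D, |φ k ⬝ᵥ x| ≤ M k
  M_le : ∀ k, M k ≤ B
  sq_le : ∀ k, φ k ⬝ᵥ φ k ≤ B
  differentiable : ∀ k, Differentiable ℝ (G k)
  pos : 0 < a
  deriv_mem : ∀ k x, |x| ≤ M k → a ≤ deriv (G k) x ∧ deriv (G k) x ≤ b

/-! ### Slope bounds and the two steps of the algorithm -/

namespace IsGoodPath

variable {D : Set (Fin m → ℝ)} {θ : Fin m → ℝ} {G : ℕ → ℝ → ℝ} {M : ℕ → ℝ}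
  {φ : ℕ → Fin m → ℝ} {a b B : ℝ}

theorem M_nonneg (h : IsGoodPath D θ G M φ a b B) (k : ℕ) : 0 ≤ M k :=
  (abs_nonneg _).trans (h.abs_dot_le k θ h.mem)

theorem b_pos (h : IsGoodPath D θ G M φ a b B) : 0 < b := by
  have h1 := h.deriv_mem 0 0 (by rw [abs_zero]; exact h.M_nonneg 0)
  exact h.pos.trans_le (h1.1.trans h1.2)

theorem exists_slope (h : IsGoodPath D θ G M φ a b B) (k : ℕ) {x z : ℝ} (hx : |x| ≤ M k)
    (hz : |z| ≤ M k) : ∃ ξ, |ξ| ≤ M k ∧ G k x - G k z = deriv (G k) ξ * (x - z) := by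
  have key : ∀ x z : ℝ, |x| ≤ M k → |z| ≤ M k → z < x →
      ∃ ξ, |ξ| ≤ M k ∧ G k x - G k z = deriv (G k) ξ * (x - z) := by
    intro x z hx hz hlt
    obtain ⟨ξ, hξ, h1⟩ := exists_deriv_eq_slope (G k) hlt
      (h.differentiable k).continuous.continuousOn
      (h.differentiable k).differentiableOn
    refine ⟨ξ, ?_, ?_⟩
    · rw [abs_le] at hx hz ⊢
      exact ⟨hz.1.trans hξ.1.le, hξ.2.le.trans hx.2⟩
    · rw [h1, div_mul_cancel₀ _ (sub_pos.2 hlt).ne']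
  rcases lt_trichotomy x z with hlt | heq | hlt
  · obtain ⟨ξ, hξ, h1⟩ := key z x hz hx hlt
    exact ⟨ξ, hξ, by linarith⟩
  · exact ⟨x, hx, by rw [heq]; ring⟩
  · exact key x z hx hz hlt

theorem abs_sub_le (h : IsGoodPath D θ G M φ a b B) (k : ℕ) {x z : ℝ} (hx : |x| ≤ M k)
    (hz : |z| ≤ M k) : |G k x - G k z| ≤ b * |x - z| := by
  obtain ⟨ξ, hξ, h1⟩ := h.exists_slope k hx hz
  have h2 := h.deriv_mem k ξ hξ
  rw [h1, abs_mul, abs_of_pos (h.pos.trans_le h2.1)]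
  exact mul_le_mul_of_nonneg_right h2.2 (abs_nonneg _)

theorem abs_sub_le_const (h : IsGoodPath D θ G M φ a b B) (k : ℕ) {x z : ℝ} (hx : |x| ≤ M k)
    (hz : |z| ≤ M k) : |G k x - G k z| ≤ b * (2 * B) := by
  refine (h.abs_sub_le k hx hz).trans (mul_le_mul_of_nonneg_left ?_ h.b_pos.le)
  have h1 := h.M_le k
  rw [abs_le] at hx hz ⊢
  constructor <;> linarith [hx.1, hx.2, hz.1, hz.2]

theorem bddBelow_deriv (h : IsGoodPath D θ G M φ a b B) (k : ℕ) :
    BddBelow (deriv (G k) '' {x | |x| ≤ M k}) :=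
  ⟨a, by rintro _ ⟨x, hx, rfl⟩; exact (h.deriv_mem k x hx).1⟩

theorem bddAbove_deriv (h : IsGoodPath D θ G M φ a b B) (k : ℕ) :
    BddAbove (deriv (G k) '' {x | |x| ≤ M k}) :=
  ⟨b, by rintro _ ⟨x, hx, rfl⟩; exact (h.deriv_mem k x hx).2⟩

theorem nonempty_deriv (h : IsGoodPath D θ G M φ a b B) (k : ℕ) :
    (deriv (G k) '' {x | |x| ≤ M k}).Nonempty :=
  ⟨_, 0, by simpa using h.M_nonneg k, rfl⟩

/-- The accumulated squared prediction error of the preliminary estimates. -/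
theorem sum_sq_first_le (h : IsGoodPath D θ G M φ a b B) {y β : ℕ → ℝ} {θbar : ℕ → Fin m → ℝ}
    {Pbar : ℕ → Matrix (Fin m) (Fin m) ℝ}
    (hQ : IsQuasiNewton D G φ y (fun _ => 1) β θbar Pbar)
    (hβ : ∀ k, β k = betaBar (sInf (deriv (G k) '' {x | |x| ≤ M k}))
      (sSup (deriv (G k) '' {x | |x| ≤ M k})) (Pbar k) (φ k))
    {lam₀ : ℝ} (hlam₀ : 0 ≤ lam₀) (hm : 1 ≤ m)
    (hlin : ∀ ε > 0, ∃ C, ∀ n,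
      |∑ k ∈ Finset.range n, β k * (φ k ⬝ᵥ (θ - θbar k)) / 1 * (y k - G k (φ k ⬝ᵥ θ))|
      ≤ ε * ∑ k ∈ Finset.range n, (β k * (φ k ⬝ᵥ (θ - θbar k)) / 1) ^ 2 + C)
    (hsq : ∃ C, 0 ≤ C ∧ ∀ n,
      ∑ k ∈ Finset.range n, normGain (Pbar k) (φ k) 1 (β k) * (y k - G k (φ k ⬝ᵥ θ)) ^ 2
      ≤ C * (1 + ∑ k ∈ Finset.range n, normGain (Pbar k) (φ k) 1 (β k))) :
    ∃ C, 0 ≤ C ∧ ∀ k, ∑ i ∈ Finset.range (k + 1), (φ i ⬝ᵥ (θ - θbar i)) ^ 2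
      ≤ C * (1 + max 0 (Real.log (sSup (spectrum ℝ (infoMatrix lam₀ φ k))))) := by
  have hmem := hQ.mem h.compact ⟨θ, h.mem⟩
  set s := max (sSup (spectrum ℝ (Pbar 0))) 0 with hs
  have hB0 : 0 ≤ B := (h.M_nonneg 0).trans (h.M_le 0)
  -- A lower bound for all `β̄ₖ`: the slopes lie in `[a, b]` and `φᵀP̄φ ≤ s * B`. Dividing by its
  -- square turns the bound for `∑ (β̄ φᵀ(θ - θ̄))²` into the desired one.
  set β₀ := min a (1 / (2 * b * (s * B) + 1)) with hβ₀
  have hb := h.b_pos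
  have hβ₀pos : 0 < β₀ := lt_min h.pos (by positivity)
  have hq : ∀ k, φ k ⬝ᵥ (Pbar k *ᵥ φ k) ≤ s * B := fun k => by
    have h0 : 0 ≤ φ k ⬝ᵥ φ k := by simpa using dotProduct_star_self_nonneg (φ k)
    refine (hQ.quadForm_le (fun _ => one_pos) (φ k) k).trans ?_
    exact mul_le_mul (le_max_left _ _) (h.sq_le k) h0 (le_max_right _ _)
  have hge : ∀ k, β₀ ≤ β k := fun k => by
    rw [hβ k, betaBar]
    have h1 : a ≤ sInf (deriv (G k) '' {x | |x| ≤ M k}) :=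
      le_csInf (h.nonempty_deriv k) (by rintro _ ⟨x, hx, rfl⟩; exact (h.deriv_mem k x hx).1)
    have h2 : sSup (deriv (G k) '' {x | |x| ≤ M k}) ≤ b :=
      csSup_le (h.nonempty_deriv k) (by rintro _ ⟨x, hx, rfl⟩; exact (h.deriv_mem k x hx).2)
    have h3 : 0 ≤ sSup (deriv (G k) '' {x | |x| ≤ M k}) := by
      obtain ⟨t, ht⟩ := h.nonempty_deriv k
      have h4 := le_csSup (h.bddAbove_deriv k) ht
      obtain ⟨x, hx, rfl⟩ := ht
      exact h.pos.le.trans ((h.deriv_mem k x hx).1.trans h4)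
    have h5 := PosDef.quadForm_nonneg (hQ.posDef (fun _ => one_pos) k) (φ k)
    refine min_le_min h1 (one_div_le_one_div_of_le (by positivity) ?_)
    have h6 := mul_le_mul h2 (hq k) h5 hb.le
    linarith
  have hle : ∀ k x, |x| ≤ M k → β k ≤ deriv (G k) x := fun k x hx => by
    rw [hβ k, betaBar]
    exact (min_le_left _ _).trans (csInf_le (h.bddBelow_deriv k) ⟨x, hx, rfl⟩)
  have hβ0 : ∀ k, 0 < β k := fun k => hβ₀pos.trans_le (hge k)
  obtain ⟨C, hC0, hC⟩ := hQ.sum_sq_le h.compact h.convex h.mem one_pos (fun _ => le_rfl)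
    (b := b ^ 2) (B := b * (2 * B)) (fun k => by
      have h1 := hle k 0 (by simpa using h.M_nonneg k)
      have h2 := (h.deriv_mem k 0 (by simpa using h.M_nonneg k)).2
      exact pow_le_pow_left₀ (hβ0 k).le (h1.trans h2) 2) hlam₀ hm (δ := fun _ => 0)
    (fun k => by
      obtain ⟨ξ, hξ, h1⟩ := h.exists_slope k (h.abs_dot_le k θ h.mem) (h.abs_dot_le k _ (hmem k))
      have h2 := hle k ξ hξ
      rw [h1, dotProduct_sub]
      set v := φ k ⬝ᵥ θ - φ k ⬝ᵥ θbar k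
      -- The gain is below the secant slope `deriv (G k) ξ`, so `x² ≤ xψ` and the drift needs no
      -- error term.
      have h3 : (β k * v) ^ 2 ≤ β k * v * (deriv (G k) ξ * v) := by
        have h4 : β k * (β k * v ^ 2) ≤ β k * (deriv (G k) ξ * v ^ 2) := by
          have := (hβ0 k).le
          gcongr
        linarith
      nlinarith [sq_nonneg (β k * v)])
    (fun k => h.abs_sub_le_const k (h.abs_dot_le k θ h.mem) (h.abs_dot_le k _ (hmem k))) hlin hsq
  refine ⟨C / β₀ ^ 2, by positivity, fun k => ?_⟩
  have h1 := hC k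
  simp only [ne_eq, OfNat.ofNat_ne_zero, not_false_eq_true, zero_pow, Finset.sum_const_zero,
    add_zero, div_one] at h1
  rw [div_mul_eq_mul_div, le_div_iff₀ (by positivity), Finset.sum_mul]
  refine le_trans (Finset.sum_le_sum fun i _ => ?_) h1
  rw [mul_pow, mul_comm]
  gcongr
  exact hge i

theorem beta_spec (h : IsGoodPath D θ G M φ a b B) (k : ℕ) {θbar θhat : Fin m → ℝ}
    (hbar : θbar ∈ D) (hhat : θhat ∈ D) :
    (a ≤ beta (G k) (φ k) θbar θhat ∧ beta (G k) (φ k) θbar θhat ≤ b) ∧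
      G k (φ k ⬝ᵥ θbar) - G k (φ k ⬝ᵥ θhat)
        = beta (G k) (φ k) θbar θhat * (φ k ⬝ᵥ θbar - φ k ⬝ᵥ θhat) := by
  unfold beta
  split_ifs with hne
  · have hne' : φ k ⬝ᵥ θbar - φ k ⬝ᵥ θhat ≠ 0 := fun h0 => hne (by linarith)
    obtain ⟨ξ, hξ, h1⟩ := h.exists_slope k (h.abs_dot_le k _ hbar) (h.abs_dot_le k _ hhat)
    rw [h1, mul_div_cancel_right₀ _ hne']
    exact ⟨h.deriv_mem k ξ hξ, rfl⟩
  · have h0 : φ k ⬝ᵥ θbar = φ k ⬝ᵥ θhat := by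
      rw [not_not] at hne
      linarith
    rw [h0]
    exact ⟨h.deriv_mem k _ (h.abs_dot_le k _ hhat), by ring⟩

/-- The accumulated regret of the accelerated estimates. -/
theorem sum_sq_second_le (h : IsGoodPath D θ G M φ a b B) {y β μ : ℕ → ℝ}
    {θbar θhat : ℕ → Fin m → ℝ} {P : ℕ → Matrix (Fin m) (Fin m) ℝ}
    (hbar : ∀ k, θbar k ∈ D) (hQ : IsQuasiNewton D G φ y μ β θhat P)
    (hβ : ∀ k, β k = beta (G k) (φ k) (θbar k) (θhat k))
    {μ₀ μ₁ : ℝ} (hμ₀ : 0 < μ₀) (hμ : ∀ k, μ₀ ≤ μ k ∧ μ k ≤ μ₁)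
    {lam₀ : ℝ} (hlam₀ : 0 ≤ lam₀) (hm : 1 ≤ m)
    (hfirst : ∃ C, 0 ≤ C ∧ ∀ k, ∑ i ∈ Finset.range (k + 1), (φ i ⬝ᵥ (θ - θbar i)) ^ 2
      ≤ C * (1 + max 0 (Real.log (sSup (spectrum ℝ (infoMatrix lam₀ φ k))))))
    (hlin : ∀ ε > 0, ∃ C, ∀ n,
      |∑ k ∈ Finset.range n, β k * (φ k ⬝ᵥ (θ - θhat k)) / μ k * (y k - G k (φ k ⬝ᵥ θ))|
      ≤ ε * ∑ k ∈ Finset.range n, (β k * (φ k ⬝ᵥ (θ - θhat k)) / μ k) ^ 2 + C)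
    (hsq : ∃ C, 0 ≤ C ∧ ∀ n,
      ∑ k ∈ Finset.range n, normGain (P k) (φ k) (μ k) (β k) * (y k - G k (φ k ⬝ᵥ θ)) ^ 2
      ≤ C * (1 + ∑ k ∈ Finset.range n, normGain (P k) (φ k) (μ k) (β k))) :
    ∃ C, 0 ≤ C ∧ ∀ k, ∑ i ∈ Finset.range (k + 1), (G i (φ i ⬝ᵥ θ) - G i (φ i ⬝ᵥ θhat i)) ^ 2
      ≤ C * (1 + max 0 (Real.log (sSup (spectrum ℝ (infoMatrix lam₀ φ k))))) := by
  have hmem := hQ.mem h.compact ⟨θ, h.mem⟩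
  have hb := h.b_pos
  have ha := h.pos
  have hμ1 : 0 < μ₁ := hμ₀.trans_le ((hμ 0).1.trans (hμ 0).2)
  have hspec : ∀ k, (a ≤ β k ∧ β k ≤ b) ∧ G k (φ k ⬝ᵥ θbar k) - G k (φ k ⬝ᵥ θhat k)
      = β k * (φ k ⬝ᵥ θbar k - φ k ⬝ᵥ θhat k) := fun k => by
    rw [hβ k]
    exact h.beta_spec k (hbar k) (hmem k)
  obtain ⟨C₁, hC₁0, hC₁⟩ := hfirst
  obtain ⟨C₂, hC₂0, hC₂⟩ := hQ.sum_sq_le h.compact h.convex h.mem hμ₀ (fun k => (hμ k).1)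
    (b := b ^ 2) (B := b * (2 * B))
    (fun k => pow_le_pow_left₀ (ha.le.trans (hspec k).1.1) (hspec k).1.2 2) hlam₀ hm
    (δ := fun k => 2 * b * (φ k ⬝ᵥ (θ - θbar k)))
    (fun k => by
      have h1 := h.abs_sub_le k (h.abs_dot_le k θ h.mem) (h.abs_dot_le k _ (hbar k))
      have h2 := (hspec k).2
      have h3 := (hspec k).1
      simp only [dotProduct_sub]
      set X := φ k ⬝ᵥ θ
      set Y := φ k ⬝ᵥ θbar k
      set Z := φ k ⬝ᵥ θhat k
      set δ := G k X - G k Z - β k * (X - Z) with hδ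
      have h4 : |δ| ≤ |2 * b * (X - Y)| := by
        -- By the secant property of `β`, the contribution of `θhat` cancels and only `X - Y`, the
        -- error of the preliminary estimate, remains. Each of the two terms is at most `b |X - Y|`,
        -- whence the factor `2 * b`.
        have h5 : δ = (G k X - G k Y) - β k * (X - Y) := by rw [hδ]; linarith
        have h6 : |β k * (X - Y)| ≤ b * |X - Y| := by
          rw [abs_mul, abs_of_nonneg (ha.le.trans h3.1)]
          exact mul_le_mul_of_nonneg_right h3.2 (abs_nonneg _)
        rw [h5, abs_mul (2 * b), abs_of_pos (by positivity : 0 < 2 * b)]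
        have h7 := abs_sub (G k X - G k Y) (β k * (X - Y))
        linarith
      have h8 : δ ^ 2 ≤ (2 * b * (X - Y)) ^ 2 := sq_le_sq.2 h4
      have h9 : G k X - G k Z = β k * (X - Z) + δ := by rw [hδ]; ring
      rw [h9]
      -- With `x = β (X - Z)` and `ψ = x + δ`, the claim is `(x + 2δ)² ≥ 0`.
      nlinarith [sq_nonneg (β k * (X - Z) + 2 * δ)])
    (fun k => h.abs_sub_le_const k (h.abs_dot_le k θ h.mem) (h.abs_dot_le k _ (hmem k))) hlin hsq
  refine ⟨b ^ 2 * μ₁ / a ^ 2 * (C₂ * (1 + 4 * b ^ 2 * C₁)), by positivity, fun k => ?_⟩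
  set L := max 0 (Real.log (sSup (spectrum ℝ (infoMatrix lam₀ φ k)))) with hL
  have hL0 : 0 ≤ L := le_max_left _ _
  have h1 : ∑ i ∈ Finset.range (k + 1), (G i (φ i ⬝ᵥ θ) - G i (φ i ⬝ᵥ θhat i)) ^ 2
      ≤ b ^ 2 * μ₁ / a ^ 2
        * ∑ i ∈ Finset.range (k + 1), (β i * (φ i ⬝ᵥ (θ - θhat i))) ^ 2 / μ i := by
    rw [Finset.mul_sum]
    refine Finset.sum_le_sum fun i _ => ?_
    have h2 := h.abs_sub_le i (h.abs_dot_le i θ h.mem) (h.abs_dot_le i _ (hmem i))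
    rw [← dotProduct_sub] at h2
    set v := φ i ⬝ᵥ (θ - θhat i)
    have h3 : (G i (φ i ⬝ᵥ θ) - G i (φ i ⬝ᵥ θhat i)) ^ 2 ≤ b ^ 2 * v ^ 2 := by
      rw [← sq_abs, ← sq_abs v, ← mul_pow]
      exact pow_le_pow_left₀ (abs_nonneg _) h2 2
    have hμi : 0 < μ i := hμ₀.trans_le (hμ i).1
    have h4 : b ^ 2 * v ^ 2 ≤ b ^ 2 * v ^ 2 * ((β i / a) ^ 2 * (μ₁ / μ i)) := by
      refine le_mul_of_one_le_right (by positivity) ?_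
      have h5 : 1 ≤ β i / a := (one_le_div ha).2 (hspec i).1.1
      have h6 : 1 ≤ μ₁ / μ i := (one_le_div hμi).2 (hμ i).2
      exact one_le_mul_of_one_le_of_one_le (one_le_pow₀ h5) h6
    refine h3.trans (h4.trans (le_of_eq ?_))
    field_simp
  refine h1.trans ?_
  rw [mul_assoc (b ^ 2 * μ₁ / a ^ 2)]
  refine mul_le_mul_of_nonneg_left ((hC₂ k).trans ?_) (by positivity)
  rw [mul_assoc]
  refine mul_le_mul_of_nonneg_left ?_ hC₂0
  have h7 : ∑ i ∈ Finset.range (k + 1), (2 * b * (φ i ⬝ᵥ (θ - θbar i))) ^ 2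
      ≤ 4 * b ^ 2 * (C₁ * (1 + L)) := by
    have h8 := mul_le_mul_of_nonneg_left (hC₁ k) (by positivity : 0 ≤ 4 * b ^ 2)
    refine le_trans (le_of_eq ?_) h8
    rw [Finset.mul_sum]
    exact Finset.sum_congr rfl fun i _ => by ring
  linarith

end IsGoodPath

end Path

/-! ### Measurability up to null sets with respect to a sub-σ-algebra -/

section AEMeas

variable {Ω α β γ : Type*} {mΩ : MeasurableSpace Ω} [MeasurableSpace α] [MeasurableSpace β]
  [MeasurableSpace γ]

/-- `f` agrees almost everywhere with a `𝓖`-measurable function. -/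
def AEMeasWrt (𝓖 : MeasurableSpace Ω) (P : @Measure Ω mΩ) (f : Ω → α) : Prop :=
  ∃ g, Measurable[𝓖] g ∧ f =ᵐ[P] g

namespace AEMeasWrt

variable {P : Measure Ω} {𝓖 𝓗 : MeasurableSpace Ω}

theorem of_measurable {f : Ω → α} (hf : Measurable[𝓖] f) : AEMeasWrt 𝓖 P f :=
  ⟨f, hf, EventuallyEq.rfl⟩

theorem const (c : α) : AEMeasWrt 𝓖 P fun _ => c := of_measurable measurable_const

theorem mono {f : Ω → α} (hf : AEMeasWrt 𝓖 P f) (h : 𝓖 ≤ 𝓗) : AEMeasWrt 𝓗 P f := by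
  obtain ⟨g, hg, hfg⟩ := hf
  exact ⟨g, hg.mono h le_rfl, hfg⟩

theorem congr {f f' : Ω → α} (hf : AEMeasWrt 𝓖 P f) (h : f' =ᵐ[P] f) : AEMeasWrt 𝓖 P f' := by
  obtain ⟨g, hg, hfg⟩ := hf
  exact ⟨g, hg, h.trans hfg⟩

theorem comp {f : Ω → α} (hf : AEMeasWrt 𝓖 P f) {F : α → β} (hF : Measurable F) :
    AEMeasWrt 𝓖 P fun ω => F (f ω) := by
  obtain ⟨g, hg, hfg⟩ := hf
  exact ⟨fun ω => F (g ω), hF.comp hg, hfg.fun_comp F⟩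

theorem prodMk {f : Ω → α} {f' : Ω → β} (hf : AEMeasWrt 𝓖 P f) (hf' : AEMeasWrt 𝓖 P f') :
    AEMeasWrt 𝓖 P fun ω => (f ω, f' ω) := by
  obtain ⟨g, hg, hfg⟩ := hf
  obtain ⟨g', hg', hfg'⟩ := hf'
  refine ⟨fun ω => (g ω, g' ω), hg.prodMk hg', ?_⟩
  filter_upwards [hfg, hfg'] with ω h h'
  rw [h, h']

theorem comp₂ {f : Ω → α} {f' : Ω → β} (hf : AEMeasWrt 𝓖 P f) (hf' : AEMeasWrt 𝓖 P f')
    {F : α → β → γ} (hF : Measurable fun p : α × β => F p.1 p.2) :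
    AEMeasWrt 𝓖 P fun ω => F (f ω) (f' ω) :=
  (hf.prodMk hf').comp hF

theorem iInf {ι : Type*} [Countable ι] {f : ι → Ω → ℝ} (hf : ∀ i, AEMeasWrt 𝓖 P (f i)) :
    AEMeasWrt 𝓖 P fun ω => ⨅ i, f i ω := by
  choose g hg hfg using hf
  refine ⟨fun ω => ⨅ i, g i ω, Measurable.iInf hg, ?_⟩
  filter_upwards [ae_all_iff.2 hfg] with ω h
  simp only [h]

theorem iSup {ι : Type*} [Countable ι] {f : ι → Ω → ℝ} (hf : ∀ i, AEMeasWrt 𝓖 P (f i)) :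
    AEMeasWrt 𝓖 P fun ω => ⨆ i, f i ω := by
  choose g hg hfg using hf
  refine ⟨fun ω => ⨆ i, g i ω, Measurable.iSup hg, ?_⟩
  filter_upwards [ae_all_iff.2 hfg] with ω h
  simp only [h]

theorem of_tendsto {f : ℕ → Ω → ℝ} {F : Ω → ℝ} (hf : ∀ n, AEMeasWrt 𝓖 P (f n))
    (h : ∀ᵐ ω ∂P, Tendsto (fun n => f n ω) atTop (𝓝 (F ω))) : AEMeasWrt 𝓖 P F := by
  choose g hg hfg using hf
  -- The `limsup` of measurable versions is measurable everywhere and agrees with the limit wherever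
  -- that exists.
  refine ⟨fun ω => limsup (fun n => g n ω) atTop, Measurable.limsup hg, ?_⟩
  filter_upwards [ae_all_iff.2 hfg, h] with ω h1 h2
  simp only [h1] at h2
  exact h2.limsup_eq.symm

theorem ite {p : Ω → Prop} [DecidablePred p] {q : α → Prop} {ξ : Ω → α} {f f' : Ω → β}
    (hξ : AEMeasWrt 𝓖 P ξ) (hq : MeasurableSet {x | q x}) (hp : ∀ ω, p ω ↔ q (ξ ω))
    (hf : AEMeasWrt 𝓖 P f) (hf' : AEMeasWrt 𝓖 P f') :
    AEMeasWrt 𝓖 P fun ω => if p ω then f ω else f' ω := by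
  classical
  obtain ⟨ζ, hζ, hξζ⟩ := hξ
  obtain ⟨g, hg, hfg⟩ := hf
  obtain ⟨g', hg', hfg'⟩ := hf'
  refine ⟨fun ω => if q (ζ ω) then g ω else g' ω, Measurable.ite (hζ hq) hg hg', ?_⟩
  filter_upwards [hξζ, hfg, hfg'] with ω h1 h2 h3
  simp only [hp, h1, h2, h3]

end AEMeasWrt

end AEMeas

/-! ### Measurability of the estimates -/

section Estimates

open Matrix

variable {m : ℕ}

instance instMeasurableSpaceMatrix : MeasurableSpace (Matrix (Fin m) (Fin m) ℝ) := borel _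

instance instBorelSpaceMatrix : BorelSpace (Matrix (Fin m) (Fin m) ℝ) := ⟨rfl⟩

instance instSecondCountableTopologyMatrix :
    SecondCountableTopology (Matrix (Fin m) (Fin m) ℝ) :=
  inferInstanceAs (SecondCountableTopology (Fin m → Fin m → ℝ))

/-- The matrices above `R` in the Loewner order. -/
def loewnerAbove (R : Matrix (Fin m) (Fin m) ℝ) : Set (Matrix (Fin m) (Fin m) ℝ) :=
  {Q | Q.IsHermitian ∧ ∀ v : Fin m → ℝ, v ⬝ᵥ (R *ᵥ v) ≤ v ⬝ᵥ (Q *ᵥ v)}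

theorem isClosed_loewnerAbove (R : Matrix (Fin m) (Fin m) ℝ) : IsClosed (loewnerAbove R) := by
  have h1 : IsClosed {Q : Matrix (Fin m) (Fin m) ℝ | Qᵀ = Q} :=
    isClosed_eq (by fun_prop) (by fun_prop)
  have h2 : IsClosed (⋂ v : Fin m → ℝ, {Q : Matrix (Fin m) (Fin m) ℝ |
      v ⬝ᵥ (R *ᵥ v) ≤ v ⬝ᵥ (Q *ᵥ v)}) :=
    isClosed_iInter fun v => isClosed_le (by fun_prop) (by fun_prop)
  convert h1.inter h2 using 1
  ext Q
  simp [loewnerAbove, IsHermitian]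

theorem posDef_of_mem_loewnerAbove {R Q : Matrix (Fin m) (Fin m) ℝ} (hR : R.PosDef)
    (hQ : Q ∈ loewnerAbove R) : Q.PosDef :=
  PosDef.of_dotProduct_mulVec_pos hQ.1 fun {v} hv => (hR.dotProduct_mulVec_pos hv).trans_le (hQ.2 v)

open Classical in
-- `proj` is a choice whose regularity is known only for positive definite `Q`. On the closed set
-- above a fixed positive definite `R` it is continuous, so a constant extension is measurable.
theorem measurable_piecewise_proj {D : Set (Fin m → ℝ)} (hD : IsCompact D) (hne : D.Nonempty)
    (hconv : Convex ℝ D) {R : Matrix (Fin m) (Fin m) ℝ} (hR : R.PosDef) :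
    Measurable ((loewnerAbove R ×ˢ (Set.univ : Set (Fin m → ℝ))).piecewise
      (fun q => proj D q.1 q.2) fun _ => 0) :=
  ContinuousOn.measurable_piecewise
    (continuousOn_proj hD hne hconv fun _ hq => posDef_of_mem_loewnerAbove hR hq.1)
    continuousOn_const ((isClosed_loewnerAbove R).prod isClosed_univ).measurableSet

theorem AEMeasWrt.proj {Ω : Type*} {mΩ : MeasurableSpace Ω} {P : Measure Ω}
    {𝓖 : MeasurableSpace Ω} {D : Set (Fin m → ℝ)} (hD : IsCompact D) (hne : D.Nonempty)
    (hconv : Convex ℝ D) {R : Matrix (Fin m) (Fin m) ℝ} (hR : R.PosDef)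
    {Q : Ω → Matrix (Fin m) (Fin m) ℝ} {x : Ω → Fin m → ℝ} (hQ : AEMeasWrt 𝓖 P Q)
    (hx : AEMeasWrt 𝓖 P x) (h : ∀ᵐ ω ∂P, Q ω ∈ loewnerAbove R) :
    AEMeasWrt 𝓖 P fun ω => TSQN.proj D (Q ω) (x ω) := by
  classical
  refine ((hQ.prodMk hx).comp (measurable_piecewise_proj hD hne hconv hR)).congr ?_
  filter_upwards [h] with ω hω
  exact (Set.piecewise_eq_of_mem _ (fun q => TSQN.proj D q.1 q.2) (fun _ => 0)
    (Set.mk_mem_prod hω (Set.mem_univ (x ω)))).symm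

/-- Inverse gains only increase, so the metrics of the projections stay in the set where `proj` is
continuous. -/
theorem IsQuasiNewton.inv_mem_loewnerAbove {D : Set (Fin m → ℝ)} {G : ℕ → ℝ → ℝ}
    {φ : ℕ → Fin m → ℝ} {y μ β : ℕ → ℝ} {θhat : ℕ → Fin m → ℝ}
    {P : ℕ → Matrix (Fin m) (Fin m) ℝ} (h : IsQuasiNewton D G φ y μ β θhat P)
    (hμ : ∀ k, 0 < μ k) (k : ℕ) : (P k)⁻¹ ∈ loewnerAbove (P 0)⁻¹ := by
  refine ⟨(h.posDef hμ k).inv.isHermitian, fun v => ?_⟩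
  induction k with
  | zero => exact le_rfl
  | succ k ih =>
    rw [h.inv_succ hμ, add_mulVec, dotProduct_add, smul_mulVec, dotProduct_smul,
      dotProduct_vecMulVec_mulVec, smul_eq_mul]
    have h1 := hμ k
    have h2 : 0 ≤ β k ^ 2 / μ k * (φ k ⬝ᵥ v * φ k ⬝ᵥ v) :=
      mul_nonneg (by positivity) (mul_self_nonneg _)
    linarith

theorem measurable_quadForm : Measurable fun p : Matrix (Fin m) (Fin m) ℝ × (Fin m → ℝ) =>
    p.2 ⬝ᵥ (p.1 *ᵥ p.2) :=
  Continuous.measurable (by fun_prop)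

theorem measurable_dotProduct : Measurable fun p : (Fin m → ℝ) × (Fin m → ℝ) => p.1 ⬝ᵥ p.2 :=
  Continuous.measurable (by fun_prop)

/-- The inverse of `P` is carried through the induction because its recursion adds a rank-one term,
a continuous operation; measurability of matrix inversion is never needed. The hypothesis on `β` is
conditional since `β k` may depend on the current estimate and gain. -/
theorem aeMeasWrt_quasiNewton {Ω : Type*} [mΩ : MeasurableSpace Ω] {Pr : Measure Ω}
    {ℱ : Filtration ℕ mΩ} {D : Set (Fin m → ℝ)} (hD : IsCompact D) (hne : D.Nonempty)
    (hconv : Convex ℝ D) {G : ℕ → Ω → ℝ → ℝ} {φ : ℕ → Ω → Fin m → ℝ} {y μ β : ℕ → Ω → ℝ}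
    {θhat : ℕ → Ω → Fin m → ℝ} {P : ℕ → Ω → Matrix (Fin m) (Fin m) ℝ} {θhat₀ : Fin m → ℝ}
    {P₀ : Matrix (Fin m) (Fin m) ℝ} (hP₀ : P₀.PosDef)
    (hQ : ∀ᵐ ω ∂Pr, IsQuasiNewton D (fun k => G k ω) (fun k => φ k ω) (fun k => y k ω)
      (fun k => μ k ω) (fun k => β k ω) (fun k => θhat k ω) fun k => P k ω)
    (hμ : ∀ᵐ ω ∂Pr, ∀ k, 0 < μ k ω) (hθ0 : ∀ ω, θhat 0 ω = θhat₀) (hP0 : ∀ ω, P 0 ω = P₀)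
    (hφm : ∀ k, AEMeasWrt (ℱ k) Pr (φ k)) (hμm : ∀ k, AEMeasWrt (ℱ k) Pr (μ k))
    (hym : ∀ k, AEMeasWrt (ℱ (k + 1)) Pr (y k))
    (hGm : ∀ k, ∀ ξ : Ω → ℝ, AEMeasWrt (ℱ k) Pr ξ → AEMeasWrt (ℱ k) Pr fun ω => G k ω (ξ ω))
    (hβm : ∀ k, AEMeasWrt (ℱ k) Pr (θhat k) → AEMeasWrt (ℱ k) Pr (P k) →
      AEMeasWrt (ℱ k) Pr (β k)) (k : ℕ) :
    AEMeasWrt (ℱ k) Pr (θhat k) ∧ AEMeasWrt (ℱ k) Pr (P k) ∧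
      AEMeasWrt (ℱ k) Pr fun ω => (P k ω)⁻¹ := by
  induction k with
  | zero =>
    refine ⟨?_, ?_, ?_⟩
    · rw [show θhat 0 = fun _ => θhat₀ from funext hθ0]; exact .const _
    · rw [show P 0 = fun _ => P₀ from funext hP0]; exact .const _
    · simp only [hP0]; exact .const _
  | succ k ih =>
    obtain ⟨hθk, hPk, hRk⟩ := ih
    have hβk := hβm k hθk hPk
    have hquad : AEMeasWrt (ℱ k) Pr fun ω => φ k ω ⬝ᵥ (P k ω *ᵥ φ k ω) :=
      (hPk.prodMk (hφm k)).comp measurable_quadForm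
    have hak : AEMeasWrt (ℱ k) Pr fun ω =>
        1 / (μ k ω + β k ω ^ 2 * (φ k ω ⬝ᵥ (P k ω *ᵥ φ k ω))) :=
      ((hμm k).prodMk (hβk.prodMk hquad)).comp
        (F := fun p : ℝ × ℝ × ℝ => 1 / (p.1 + p.2.1 ^ 2 * p.2.2)) (by fun_prop)
    have hP' : AEMeasWrt (ℱ k) Pr (P (k + 1)) := by
      refine ((hPk.prodMk ((hφm k).prodMk (hak.prodMk hβk))).comp
        (F := fun p : Matrix (Fin m) (Fin m) ℝ × (Fin m → ℝ) × ℝ × ℝ =>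
          gainUpdate p.1 p.2.1 p.2.2.1 p.2.2.2) (Continuous.measurable ?_)).congr ?_
      · unfold gainUpdate; fun_prop
      · filter_upwards [hQ] with ω h
        exact h.gain_succ k
    have hR' : AEMeasWrt (ℱ k) Pr fun ω => (P (k + 1) ω)⁻¹ := by
      have hc : AEMeasWrt (ℱ k) Pr fun ω => β k ω ^ 2 / μ k ω :=
        hβk.comp₂ (hμm k) (F := fun b c => b ^ 2 / c) (by fun_prop)
      refine ((hRk.prodMk ((hφm k).prodMk hc)).comp
        (F := fun p : Matrix (Fin m) (Fin m) ℝ × (Fin m → ℝ) × ℝ =>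
          p.1 + p.2.2 • vecMulVec p.2.1 p.2.1) (Continuous.measurable ?_)).congr ?_
      · fun_prop
      · filter_upwards [hQ, hμ] with ω h h'
        exact h.inv_succ h' k
    have hmono : ℱ k ≤ ℱ (k + 1) := ℱ.mono k.le_succ
    refine ⟨?_, hP'.mono hmono, hR'.mono hmono⟩
    have hdot : AEMeasWrt (ℱ k) Pr fun ω => φ k ω ⬝ᵥ θhat k ω :=
      ((hφm k).prodMk hθk).comp measurable_dotProduct
    have hG := hGm k _ hdot
    have hs : AEMeasWrt (ℱ (k + 1)) Pr fun ω =>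
        1 / (μ k ω + β k ω ^ 2 * (φ k ω ⬝ᵥ (P k ω *ᵥ φ k ω))) * β k ω
          * (y k ω - G k ω (φ k ω ⬝ᵥ θhat k ω)) :=
      ((hak.prodMk (hβk.prodMk hG)).mono hmono |>.prodMk (hym k)).comp
        (F := fun p : (ℝ × ℝ × ℝ) × ℝ => p.1.1 * p.1.2.1 * (p.2 - p.1.2.2)) (by fun_prop)
    have hx : AEMeasWrt (ℱ (k + 1)) Pr fun ω => θhat k ω
        + (1 / (μ k ω + β k ω ^ 2 * (φ k ω ⬝ᵥ (P k ω *ᵥ φ k ω))) * β k ω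
          * (y k ω - G k ω (φ k ω ⬝ᵥ θhat k ω))) • (P k ω *ᵥ φ k ω) :=
      (((hθk.prodMk (hPk.prodMk (hφm k))).mono hmono).prodMk hs).comp
        (F := fun p : ((Fin m → ℝ) × Matrix (Fin m) (Fin m) ℝ × (Fin m → ℝ)) × ℝ =>
          p.1.1 + p.2 • (p.1.2.1 *ᵥ p.1.2.2)) (Continuous.measurable (by fun_prop))
    refine (AEMeasWrt.proj hD hne hconv hP₀.inv (hR'.mono hmono) hx ?_).congr ?_
    · filter_upwards [hQ, hμ] with ω h h'
      have := h.inv_mem_loewnerAbove h' (k + 1)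
      rwa [hP0] at this
    · filter_upwards [hQ] with ω h
      exact h.estimate_succ k

end Estimates

/-! ### Extrema of continuous functions over the rationals -/

/-- The radius `M` will depend on the sample point. Clamping the rationals to `[-1, 1]` and scaling
by `M` gives a dense family in the interval with a fixed countable index set, so the infimum becomes
measurable. -/
theorem iInf_rat_eq_sInf_image {f : ℝ → ℝ} {M : ℝ} (hM : 0 ≤ M)
    (hf : ContinuousOn f {x | |x| ≤ M}) (hb : BddBelow (f '' {x | |x| ≤ M})) :
    ⨅ q : ℚ, f (M * max (-1) (min 1 (q : ℝ))) = sInf (f '' {x | |x| ≤ M}) := by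
  have hclamp : ∀ r : ℝ, |M * max (-1) (min 1 r)| ≤ M := fun r => by
    rw [abs_mul, abs_of_nonneg hM]
    refine mul_le_of_le_one_right hM (abs_le.2 ⟨le_max_left _ _, max_le (by norm_num) ?_⟩)
    exact min_le_left _ _
  have hcont : Continuous fun r : ℝ => f (M * max (-1) (min 1 r)) :=
    hf.comp_continuous (by fun_prop) hclamp
  have hbdd : BddBelow (Set.range fun q : ℚ => f (M * max (-1) (min 1 (q : ℝ)))) := by
    obtain ⟨c, hc⟩ := hb
    exact ⟨c, by rintro _ ⟨q, rfl⟩; exact hc ⟨_, hclamp _, rfl⟩⟩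
  refine le_antisymm (le_csInf ⟨_, 0, by simpa using hM, rfl⟩ ?_)
    (le_ciInf fun q => csInf_le hb ⟨_, hclamp _, rfl⟩)
  rintro _ ⟨x, hx, rfl⟩
  have hall : ∀ r : ℝ, ⨅ q : ℚ, f (M * max (-1) (min 1 (q : ℝ))) ≤ f (M * max (-1) (min 1 r)) := by
    intro r
    have hcl : IsClosed {r : ℝ | ⨅ q : ℚ, f (M * max (-1) (min 1 (q : ℝ)))
      ≤ f (M * max (-1) (min 1 r))} := isClosed_le continuous_const hcont
    have hsub : Set.range ((↑) : ℚ → ℝ) ⊆ {r : ℝ | ⨅ q : ℚ, f (M * max (-1) (min 1 (q : ℝ)))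
        ≤ f (M * max (-1) (min 1 r))} := by
      rintro _ ⟨q, rfl⟩
      exact ciInf_le hbdd q
    exact hcl.closure_subset_iff.2 hsub (Rat.denseRange_cast r)
  have hx' : |x| ≤ M := hx
  rcases hM.eq_or_lt with h0 | h0
  · have hx0 : x = 0 := abs_eq_zero.1 (le_antisymm (hx'.trans h0.symm.le) (abs_nonneg _))
    rw [hx0]
    simp [← h0]
  · have h1 := hall (x / M)
    rw [abs_le] at hx'
    have h2 : max (-1) (min 1 (x / M)) = x / M := by
      rw [min_eq_right ((div_le_one h0).2 hx'.2), max_eq_right]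
      rw [le_div_iff₀ h0]
      linarith [hx'.1]
    rwa [h2, mul_div_cancel₀ _ h0.ne'] at h1

theorem iSup_rat_eq_sSup_image {f : ℝ → ℝ} {M : ℝ} (hM : 0 ≤ M)
    (hf : ContinuousOn f {x | |x| ≤ M}) (hb : BddAbove (f '' {x | |x| ≤ M})) :
    ⨆ q : ℚ, f (M * max (-1) (min 1 (q : ℝ))) = sSup (f '' {x | |x| ≤ M}) := by
  have h := iInf_rat_eq_sInf_image (f := fun x => -f x) hM hf.neg (by
    obtain ⟨c, hc⟩ := hb
    exact ⟨-c, by rintro _ ⟨x, hx, rfl⟩; exact neg_le_neg (hc ⟨x, hx, rfl⟩)⟩)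
  have h1 : (fun x => -f x) '' {x | |x| ≤ M} = -(f '' {x | |x| ≤ M}) := by
    rw [← Set.image_neg_eq_neg, Set.image_image]
  have h2 : Set.range (fun q : ℚ => -f (M * max (-1) (min 1 (q : ℝ))))
      = -Set.range fun q : ℚ => f (M * max (-1) (min 1 (q : ℝ))) := by
    rw [← Set.image_neg_eq_neg, ← Set.range_comp]
    rfl
  rw [h1, Real.sInf_neg, iInf, h2, Real.sInf_neg] at h
  exact neg_injective h

/-! ### Jointly measurable functions along graphs and sections -/

theorem measurable_comp_graph {α γ : Type*} [MeasurableSpace γ] {m m' : MeasurableSpace α}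
    (h : m ≤ m') {δ : Type*} [MeasurableSpace δ] (F : α × γ → δ)
    (hF : @Measurable _ _ (m.prod inferInstance) _ F)
    {g : α → γ} (hg : Measurable[m'] g) : Measurable[m'] fun a => F (a, g a) :=
  hF.comp (@Measurable.prodMk α m' α γ m _ _ _ (measurable_id'' h) hg)

theorem measurable_section {α γ : Type*} [MeasurableSpace γ] {m : MeasurableSpace α} {δ : Type*}
    [MeasurableSpace δ] (F : α × γ → δ) (hF : @Measurable _ _ (m.prod inferInstance) _ F)
    (a : α) : Measurable fun t => F (a, t) :=
  hF.comp measurable_prodMk_left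

/-! ### Disintegration along a conditional distribution -/

section CondDistrib

open scoped ENNReal

variable {α β γ : Type*} {mα : MeasurableSpace α} {mβ : MeasurableSpace β} [MeasurableSpace γ]
  {μ : Measure α} [IsFiniteMeasure μ] {X : α → β} {Y : α → ℝ}

theorem lintegral_condDistrib (hX : Measurable X) (hY : Measurable Y) {f : β × ℝ → ℝ≥0∞}
    (hf : Measurable f) :
    ∫⁻ a, f (X a, Y a) ∂μ = ∫⁻ a, ∫⁻ t, f (X a, t) ∂condDistrib Y X μ (X a) ∂μ := by
  have h1 : ∫⁻ a, f (X a, Y a) ∂μ = ∫⁻ p, f p ∂(μ.map fun a => (X a, Y a)) :=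
    (lintegral_map hf (hX.prodMk hY)).symm
  rw [h1, ← compProd_map_condDistrib hY.aemeasurable, Measure.lintegral_compProd hf,
    lintegral_map hf.lintegral_kernel_prod_right' hX]

theorem measurable_lintegral_condDistrib {f : β × ℝ → ℝ≥0∞} (hf : Measurable f) :
    Measurable fun b => ∫⁻ t, f (b, t) ∂condDistrib Y X μ b :=
  hf.lintegral_kernel_prod_right'

theorem measurable_integral_condDistrib_param {f : (β × γ) × ℝ → ℝ} (hf : Measurable f) :
    Measurable fun p : β × γ => ∫ t, f (p, t) ∂condDistrib Y X μ p.1 :=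
  (StronglyMeasurable.integral_kernel_prod_right'
    (κ := (condDistrib Y X μ).comap Prod.fst measurable_fst) hf.stronglyMeasurable).measurable

/-- Pushing the conditional law of `Y` forward by `s (b, ·)` gives a kernel that disintegrates the
joint law of `X` and `s (X, Y)`; such a kernel is almost everywhere unique. -/
theorem condDistrib_comp_ae_eq (hX : Measurable X) (hY : Measurable Y) {s : β × ℝ → ℝ}
    (hs : Measurable s) :
    ∀ᵐ a ∂μ, condDistrib (fun a => s (X a, Y a)) X μ (X a)
      = (condDistrib Y X μ (X a)).map fun t => s (X a, t) := by
  set κ : Kernel β ℝ := (Kernel.id ×ₖ condDistrib Y X μ).map s with hκ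
  have hsm : ∀ b, Measurable fun t => s (b, t) := fun b => hs.comp measurable_prodMk_left
  have hκb : ∀ b, κ b = (condDistrib Y X μ b).map fun t => s (b, t) := fun b => by
    rw [hκ, Kernel.map_apply _ hs, Kernel.prod_apply, Kernel.id_apply, Measure.dirac_prod,
      Measure.map_map hs measurable_prodMk_left]
    rfl
  have h := condDistrib_ae_eq_of_measure_eq_compProd_of_measurable (μ := μ) (κ := κ) hX
    (hs.comp (hX.prodMk hY)) (by
      refine Measure.ext_of_lintegral _ fun f hf => ?_
      rw [lintegral_map hf (hX.prodMk (hs.comp (hX.prodMk hY))), Measure.lintegral_compProd hf,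
        lintegral_map hf.lintegral_kernel_prod_right' hX]
      have h1 := lintegral_condDistrib (μ := μ) hX hY (f := fun p => f (p.1, s p))
        (hf.comp (measurable_fst.prodMk hs))
      refine h1.trans (lintegral_congr fun a => ?_)
      rw [hκb]
      exact (lintegral_map (f := fun z => f (X a, z)) (hf.comp measurable_prodMk_left)
        (hsm _)).symm)
  filter_upwards [ae_of_ae_map hX.aemeasurable h] with a ha
  rw [← hκb, ← ha]
  rfl

end CondDistrib

/-! ### Measurability of the model -/

namespace Model

section

open scoped ENNReal

variable {Ω : Type*} [mΩ : MeasurableSpace Ω] {m : ℕ} {P : Measure Ω} {𝓜 : Model Ω m}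

instance isProbabilityMeasure_noiseLaw [IsFiniteMeasure P] (k : ℕ) (ω : Ω) :
    IsProbabilityMeasure (𝓜.noiseLaw P k ω) := by
  unfold noiseLaw condLaw
  infer_instance

theorem measurable_S (h₂ : ThresholdAssumption P 𝓜) (k : ℕ) :
    @Measurable (Ω × ℝ) ℝ ((𝓜.ℱ k).prod inferInstance) _ fun p => 𝓜.S k p.1 p.2 := by
  have hl := (h₂.l_adapted k).comp (@measurable_fst Ω ℝ (𝓜.ℱ k) inferInstance)
  have hu := (h₂.u_adapted k).comp (@measurable_fst Ω ℝ (𝓜.ℱ k) inferInstance)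
  have hL := (h₂.L_adapted k).comp (@measurable_fst Ω ℝ (𝓜.ℱ k) inferInstance)
  have hU := (h₂.U_adapted k).comp (@measurable_fst Ω ℝ (𝓜.ℱ k) inferInstance)
  have hz := @measurable_snd Ω ℝ (𝓜.ℱ k) inferInstance
  have hz' := measurable_coe_real_ereal.comp hz
  exact Measurable.ite (measurableSet_lt hz' hl) hL.ereal_toReal
    (Measurable.ite (measurableSet_le hz' hu) hz hU.ereal_toReal)

theorem measurable_dotProduct_θ (h₁ : RegressorAssumption P 𝓜) (k : ℕ) :
    Measurable[𝓜.ℱ k] fun ω => 𝓜.φ k ω ⬝ᵥ 𝓜.θ :=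
  (Continuous.measurable (f := fun v : Fin m → ℝ => v ⬝ᵥ 𝓜.θ) (by fun_prop)).comp (h₁.adapted k)

theorem measurable_S_param (h₁ : RegressorAssumption P 𝓜) (h₂ : ThresholdAssumption P 𝓜) (k : ℕ) :
    @Measurable (Ω × ℝ) ℝ ((𝓜.ℱ k).prod inferInstance) _
      fun p => 𝓜.S k p.1 (𝓜.φ k p.1 ⬝ᵥ 𝓜.θ + p.2) := by
  have h := measurable_S h₂ k
  have h' := measurable_dotProduct_θ h₁ k
  let _ : MeasurableSpace Ω := 𝓜.ℱ k
  exact h.comp (measurable_fst.prodMk ((h'.comp measurable_fst).add measurable_snd))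

variable [IsProbabilityMeasure P]

theorem measurable_G (h₂ : ThresholdAssumption P 𝓜) (k : ℕ) :
    @Measurable (Ω × ℝ) ℝ ((𝓜.ℱ k).prod inferInstance) _ fun p => 𝓜.G P k p.1 p.2 := by
  have hf : @Measurable ((Ω × ℝ) × ℝ) ℝ (((𝓜.ℱ k).prod inferInstance).prod inferInstance) _
      fun q => 𝓜.S k q.1.1 (q.1.2 + q.2) := by
    let _ : MeasurableSpace Ω := 𝓜.ℱ k
    exact (measurable_S (mΩ := mΩ) h₂ k).comp
      (measurable_fst.fst.prodMk (measurable_fst.snd.add measurable_snd))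
  exact @measurable_integral_condDistrib_param Ω Ω ℝ mΩ (𝓜.ℱ k) _ P _ id (𝓜.e (k + 1)) _ hf

theorem aeMeasWrt_G (h₂ : ThresholdAssumption P 𝓜) (k : ℕ) {ξ : Ω → ℝ}
    (hξ : AEMeasWrt (𝓜.ℱ k) P ξ) : AEMeasWrt (𝓜.ℱ k) P fun ω => 𝓜.G P k ω (ξ ω) := by
  obtain ⟨g, hg, hξg⟩ := hξ
  refine ⟨fun ω => 𝓜.G P k ω (g ω), measurable_comp_graph le_rfl
    (fun p : Ω × ℝ => 𝓜.G P k p.1 p.2) (measurable_G h₂ k) hg, ?_⟩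
  filter_upwards [hξg] with ω h
  rw [h]

/-- The derivative is the limit of difference quotients with steps `1 / (n + 1)`. Differentiability
holds only almost surely, so measurability is up to null sets. -/
theorem aeMeasWrt_deriv_G (h₂ : ThresholdAssumption P 𝓜) (h₃ : NoiseAssumption P 𝓜) (k : ℕ)
    {ξ : Ω → ℝ} (hξ : AEMeasWrt (𝓜.ℱ k) P ξ) :
    AEMeasWrt (𝓜.ℱ k) P fun ω => deriv (𝓜.G P k ω) (ξ ω) := by
  refine AEMeasWrt.of_tendsto (f := fun n ω => ((1 : ℝ) / ((n : ℝ) + 1))⁻¹ •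
    (𝓜.G P k ω (ξ ω + (1 : ℝ) / ((n : ℝ) + 1)) - 𝓜.G P k ω (ξ ω))) (fun n => ?_) ?_
  · exact (aeMeasWrt_G h₂ k (hξ.comp (F := fun x => x + (1 : ℝ) / ((n : ℝ) + 1))
      (by fun_prop))).comp₂ (aeMeasWrt_G h₂ k hξ)
      (F := fun x y => ((1 : ℝ) / ((n : ℝ) + 1))⁻¹ • (x - y)) (by fun_prop)
  · filter_upwards [h₃.differentiable k] with ω h
    have h1 := (h (ξ ω)).hasDerivAt.tendsto_slope_zero_right
    refine h1.comp (tendsto_nhdsWithin_iff.2 ⟨tendsto_one_div_add_atTop_nhds_zero_nat,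
      Eventually.of_forall fun n => ?_⟩)
    exact Set.mem_Ioi.2 (by positivity)

theorem aeMeasWrt_gLow_gUp (h₂ : ThresholdAssumption P 𝓜) (h₃ : NoiseAssumption P 𝓜)
    (k : ℕ) (hM : AEMeasWrt (𝓜.ℱ k) P (𝓜.M k)) (hM0 : ∀ᵐ ω ∂P, 0 ≤ 𝓜.M k ω)
    (hcont : ∀ᵐ ω ∂P, ContinuousOn (deriv (𝓜.G P k ω)) {x | |x| ≤ 𝓜.M k ω})
    (hb : ∀ᵐ ω ∂P, BddBelow (deriv (𝓜.G P k ω) '' {x | |x| ≤ 𝓜.M k ω}) ∧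
      BddAbove (deriv (𝓜.G P k ω) '' {x | |x| ≤ 𝓜.M k ω})) :
    AEMeasWrt (𝓜.ℱ k) P (𝓜.gLow P k) ∧ AEMeasWrt (𝓜.ℱ k) P (𝓜.gUp P k) := by
  have h : ∀ q : ℚ, AEMeasWrt (𝓜.ℱ k) P fun ω =>
      deriv (𝓜.G P k ω) (𝓜.M k ω * max (-1) (min 1 (q : ℝ))) := fun q =>
    aeMeasWrt_deriv_G h₂ h₃ k (hM.comp (F := fun x => x * max (-1) (min 1 (q : ℝ))) (by fun_prop))
  constructor
  · refine (AEMeasWrt.iInf h).congr ?_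
    filter_upwards [hM0, hcont, hb] with ω h1 h2 h3
    exact (iInf_rat_eq_sInf_image h1 h2 h3.1).symm
  · refine (AEMeasWrt.iSup h).congr ?_
    filter_upwards [hM0, hcont, hb] with ω h1 h2 h3
    exact (iSup_rat_eq_sSup_image h1 h2 h3.2).symm

/-! ### The innovations -/

/-- The innovation `y_{k+1} - Gₖ(φₖᵀ θ)`. -/
noncomputable def innovation (𝓜 : Model Ω m) (P : Measure Ω) [IsFiniteMeasure P] (k : ℕ) (ω : Ω) :
    ℝ :=
  𝓜.yNext k ω - 𝓜.G P k ω (𝓜.φ k ω ⬝ᵥ 𝓜.θ)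

/-- The innovation as a function of the noise. -/
noncomputable def innovationFun (𝓜 : Model Ω m) (P : Measure Ω) [IsFiniteMeasure P] (k : ℕ)
    (ω : Ω) (t : ℝ) : ℝ :=
  𝓜.S k ω (𝓜.φ k ω ⬝ᵥ 𝓜.θ + t) - 𝓜.G P k ω (𝓜.φ k ω ⬝ᵥ 𝓜.θ)

/-- The conditional moment of order `2 * p` of the innovation. -/
noncomputable def innovationMoment (𝓜 : Model Ω m) (P : Measure Ω) [IsFiniteMeasure P] (p : ℝ)
    (k : ℕ) (ω : Ω) : ℝ≥0∞ :=
  ∫⁻ t, ENNReal.ofReal ((𝓜.innovationFun P k ω t ^ 2) ^ p) ∂𝓜.noiseLaw P k ω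

theorem measurable_G_θ (h₁ : RegressorAssumption P 𝓜) (h₂ : ThresholdAssumption P 𝓜) (k : ℕ) :
    Measurable[𝓜.ℱ k] fun ω => 𝓜.G P k ω (𝓜.φ k ω ⬝ᵥ 𝓜.θ) :=
  measurable_comp_graph le_rfl (fun p : Ω × ℝ => 𝓜.G P k p.1 p.2) (measurable_G h₂ k)
    (measurable_dotProduct_θ h₁ k)

theorem measurable_innovationFun (h₁ : RegressorAssumption P 𝓜) (h₂ : ThresholdAssumption P 𝓜)
    (k : ℕ) :
    @Measurable (Ω × ℝ) ℝ ((𝓜.ℱ k).prod inferInstance) _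
      fun p => 𝓜.innovationFun P k p.1 p.2 :=
  (measurable_S_param h₁ h₂ k).sub
    ((measurable_G_θ h₁ h₂ k).comp (@measurable_fst Ω ℝ (𝓜.ℱ k) inferInstance))

theorem measurable_e (h₃ : NoiseAssumption P 𝓜) (k : ℕ) : Measurable (𝓜.e (k + 1)) :=
  (h₃.adapted k).mono (𝓜.ℱ.le _) le_rfl

theorem measurable_yNext (h₁ : RegressorAssumption P 𝓜) (h₂ : ThresholdAssumption P 𝓜)
    (h₃ : NoiseAssumption P 𝓜) (k : ℕ) : Measurable[𝓜.ℱ (k + 1)] (𝓜.yNext k) :=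
  measurable_comp_graph (𝓜.ℱ.mono k.le_succ)
    (fun p : Ω × ℝ => 𝓜.S k p.1 (𝓜.φ k p.1 ⬝ᵥ 𝓜.θ + p.2)) (measurable_S_param h₁ h₂ k)
    (h₃.adapted k)

theorem measurable_innovationMoment (h₁ : RegressorAssumption P 𝓜)
    (h₂ : ThresholdAssumption P 𝓜) (p : ℝ) (k : ℕ) :
    Measurable[𝓜.ℱ k] (𝓜.innovationMoment P p k) :=
  @measurable_lintegral_condDistrib Ω Ω mΩ (𝓜.ℱ k) P _ id (𝓜.e (k + 1))
    (fun q => ENNReal.ofReal ((𝓜.innovationFun P k q.1 q.2 ^ 2) ^ p))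
    (((measurable_innovationFun h₁ h₂ k).pow_const 2).pow_const p).ennreal_ofReal

theorem lintegral_noise (h₃ : NoiseAssumption P 𝓜) (k : ℕ) {f : Ω × ℝ → ℝ≥0∞}
    (hf : @Measurable (Ω × ℝ) ℝ≥0∞ ((𝓜.ℱ k).prod inferInstance) _ f) :
    ∫⁻ ω, f (ω, 𝓜.e (k + 1) ω) ∂P = ∫⁻ ω, ∫⁻ t, f (ω, t) ∂𝓜.noiseLaw P k ω ∂P :=
  @lintegral_condDistrib Ω Ω mΩ (𝓜.ℱ k) P _ id (𝓜.e (k + 1)) (measurable_id'' (𝓜.ℱ.le k))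
    (measurable_e h₃ k) f hf

/-- The conditional mean of the observation is `Gₖ(φₖᵀ θ)`. -/
theorem condMean_yNext_ae_eq (h₁ : RegressorAssumption P 𝓜) (h₂ : ThresholdAssumption P 𝓜)
    (h₃ : NoiseAssumption P 𝓜) (k : ℕ) :
    ∀ᵐ ω ∂P, condMean (𝓜.ℱ k) P (𝓜.yNext k) ω = 𝓜.G P k ω (𝓜.φ k ω ⬝ᵥ 𝓜.θ) := by
  have h := @condDistrib_comp_ae_eq Ω Ω mΩ (𝓜.ℱ k) P _ id (𝓜.e (k + 1))
    (measurable_id'' (𝓜.ℱ.le k)) (measurable_e h₃ k)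
    (fun p => 𝓜.S k p.1 (𝓜.φ k p.1 ⬝ᵥ 𝓜.θ + p.2)) (measurable_S_param h₁ h₂ k)
  filter_upwards [h] with ω hω
  have h1 : condLaw (𝓜.ℱ k) P (𝓜.yNext k) ω
      = (𝓜.noiseLaw P k ω).map fun t => 𝓜.S k ω (𝓜.φ k ω ⬝ᵥ 𝓜.θ + t) := hω
  have h2 : Measurable fun t => 𝓜.S k ω (𝓜.φ k ω ⬝ᵥ 𝓜.θ + t) :=
    measurable_section (fun p : Ω × ℝ => 𝓜.S k p.1 (𝓜.φ k p.1 ⬝ᵥ 𝓜.θ + p.2))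
      (measurable_S_param h₁ h₂ k) ω
  rw [condMean, h1]
  exact integral_map (f := fun t : ℝ => t) h2.aemeasurable (by fun_prop)

end

end Model

open scoped ENNReal

/-! ### Moment bounds for the innovations -/

section Moments

theorem add_rpow_le {x y q : ℝ} (hx : 0 ≤ x) (hy : 0 ≤ y) (hq : 0 ≤ q) :
    (x + y) ^ q ≤ 2 ^ q * (x ^ q + y ^ q) := by
  have h1 : (x + y) ^ q ≤ (2 * max x y) ^ q :=
    Real.rpow_le_rpow (by positivity) (by
      have := le_max_left x y
      have := le_max_right x y
      linarith) hq
  rw [Real.mul_rpow zero_le_two (le_max_of_le_left hx)] at h1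
  refine h1.trans (mul_le_mul_of_nonneg_left ?_ (by positivity))
  rcases max_cases x y with ⟨h, -⟩ | ⟨h, -⟩ <;> rw [h]
  · linarith [Real.rpow_nonneg hy q]
  · linarith [Real.rpow_nonneg hx q]

theorem integrable_of_lintegral_rpow_lt_top {α : Type*} [MeasurableSpace α] {μ : Measure α}
    [IsFiniteMeasure μ] {g : α → ℝ} {p : ℝ} (hp : 1 ≤ p) (hg : Measurable g)
    (hg0 : ∀ a, 0 ≤ g a) (h : ∫⁻ a, ENNReal.ofReal (g a ^ p) ∂μ < ⊤) : Integrable g μ := by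
  refine ⟨hg.aestronglyMeasurable, ?_⟩
  rw [hasFiniteIntegral_iff_ofReal (ae_of_all _ hg0)]
  have h1 : ∫⁻ a, ENNReal.ofReal (g a) ∂μ ≤ ∫⁻ a, (1 + ENNReal.ofReal (g a ^ p)) ∂μ := by
    refine lintegral_mono fun a => ?_
    rw [← ENNReal.ofReal_one, ← ENNReal.ofReal_add zero_le_one (Real.rpow_nonneg (hg0 a) p)]
    exact ENNReal.ofReal_le_ofReal (le_one_add_rpow (hg0 a) hp)
  refine h1.trans_lt ?_
  rw [lintegral_add_left measurable_const, lintegral_const, one_mul]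
  exact ENNReal.add_lt_top.2 ⟨measure_lt_top _ _, h⟩

variable {ν : Measure ℝ} [IsProbabilityMeasure ν] {f : ℝ → ℝ} {q A K p : ℝ}

theorem lintegral_add_const_mul_rpow_le (hA0 : 0 ≤ A)
    (hA : ∫⁻ t, ENNReal.ofReal (|t| ^ q) ∂ν ≤ ENNReal.ofReal A) {x y : ℝ} (hx : 0 ≤ x)
    (hy : 0 ≤ y) :
    ∫⁻ t, ENNReal.ofReal (x + y * |t| ^ q) ∂ν ≤ ENNReal.ofReal (x + y * A) := by
  have h1 : ∀ t : ℝ, ENNReal.ofReal (x + y * |t| ^ q)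
      = ENNReal.ofReal x + ENNReal.ofReal y * ENNReal.ofReal (|t| ^ q) := fun t => by
    rw [ENNReal.ofReal_add hx (mul_nonneg hy (Real.rpow_nonneg (abs_nonneg t) q)),
      ENNReal.ofReal_mul hy]
  simp only [h1]
  rw [lintegral_add_left measurable_const, lintegral_const,
    lintegral_const_mul' _ _ ENNReal.ofReal_ne_top, measure_univ, mul_one,
    ENNReal.ofReal_add hx (mul_nonneg hy hA0), ENNReal.ofReal_mul hy]
  gcongr

theorem abs_integral_le_of_linear_growth (hq : 1 ≤ q) (hA0 : 0 ≤ A)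
    (hA : ∫⁻ t, ENNReal.ofReal (|t| ^ q) ∂ν ≤ ENNReal.ofReal A) (hK : 0 ≤ K)
    (hf : ∀ t, |f t| ≤ |t| + K) : |∫ t, f t ∂ν| ≤ 1 + K + A := by
  have h1 : ∫⁻ t, ENNReal.ofReal ‖f t‖ ∂ν ≤ ENNReal.ofReal (1 + K + 1 * A) :=
    (lintegral_mono fun t => ENNReal.ofReal_le_ofReal (by
      have h2 := le_one_add_rpow (abs_nonneg t) hq
      have h3 := hf t
      rw [Real.norm_eq_abs]
      linarith)).trans (lintegral_add_const_mul_rpow_le hA0 hA (by linarith) zero_le_one)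
  have h2 := ENNReal.toReal_mono ENNReal.ofReal_ne_top h1
  rw [ENNReal.toReal_ofReal (by linarith), one_mul] at h2
  exact (norm_integral_le_lintegral_norm f).trans h2

/-- Applied to the saturated observation as a function of the noise. Linear growth bounds the
centred value by `|t|` plus a constant, and `2 * p ≤ q` lets `1 + x ^ q` dominate `x ^ (2 * p)`. -/
theorem lintegral_sub_integral_rpow_le (hq : 1 ≤ q) (hp : 0 ≤ p) (hpq : 2 * p ≤ q) (hA0 : 0 ≤ A)
    (hA : ∫⁻ t, ENNReal.ofReal (|t| ^ q) ∂ν ≤ ENNReal.ofReal A) (hK : 0 ≤ K)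
    (hf : ∀ t, |f t| ≤ |t| + K) :
    ∫⁻ t, ENNReal.ofReal (((f t - ∫ s, f s ∂ν) ^ 2) ^ p) ∂ν
      ≤ ENNReal.ofReal (1 + 2 ^ q * (1 + 2 * K + A) ^ q + 2 ^ q * A) := by
  have hK' : 0 ≤ 1 + 2 * K + A := by linarith
  refine (lintegral_mono fun t => ENNReal.ofReal_le_ofReal ?_).trans
    (lintegral_add_const_mul_rpow_le (q := q) hA0 hA (by positivity) (by positivity))
  have h1 := abs_integral_le_of_linear_growth hq hA0 hA hK hf
  set x := |f t - ∫ s, f s ∂ν| with hx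
  have hx0 : 0 ≤ x := abs_nonneg _
  have h2 : x ≤ |t| + (1 + 2 * K + A) := by
    have := abs_sub (f t) (∫ s, f s ∂ν)
    linarith [hf t]
  have h3 : ((f t - ∫ s, f s ∂ν) ^ 2) ^ p = x ^ (2 * p) := by
    rw [Real.rpow_mul hx0, Real.rpow_two, hx, sq_abs]
  have h4 : x ^ (2 * p) ≤ 1 + x ^ q := by
    rcases le_total x 1 with h | h
    · linarith [Real.rpow_le_one hx0 h (by linarith : 0 ≤ 2 * p), Real.rpow_nonneg hx0 q]
    · linarith [Real.rpow_le_rpow_of_exponent_le h hpq]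
  have h5 := Real.rpow_le_rpow hx0 h2 (by linarith : 0 ≤ q)
  have h6 := add_rpow_le (abs_nonneg t) hK' (by linarith : 0 ≤ q)
  rw [h3]
  linarith

end Moments

/-! ### Localization of the innovations -/

namespace Model

variable {Ω : Type*} [mΩ : MeasurableSpace Ω] {m : ℕ} {P : Measure Ω} {𝓜 : Model Ω m}

theorem ae_abs_S_le (h₂ : ThresholdAssumption P 𝓜) :
    ∀ᵐ ω ∂P, ∃ K, 0 ≤ K ∧ ∀ k x, |𝓜.S k ω x| ≤ |x| + K := by
  obtain ⟨c, l, u, -, hpos, hb, hbl, hbu⟩ := h₂.bounds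
  filter_upwards [ae_all_iff.2 hb, hbl, hbu] with ω h h' h''
  obtain ⟨hc, hl, hu⟩ := hpos ω
  refine ⟨c ω + l ω + u ω, by linarith, fun k x => ?_⟩
  have hl' : 𝓜.l k ω ≤ (l ω : EReal) :=
    (le_max_left _ _).trans ((le_iSup (fun k => max (𝓜.l k ω) 0) k).trans h')
  have hu' : -𝓜.u k ω ≤ (u ω : EReal) :=
    (le_max_left _ _).trans ((le_iSup (fun k => max (-𝓜.u k ω) 0) k).trans h'')
  have := abs_saturation_le hc hl hu (h k).1 (h k).2.1 (h k).2.2.2.1 (h k).2.2.2.2 hl' hu' x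
  change |saturation _ _ _ _ _| ≤ _
  linarith

theorem ae_abs_dotProduct_le (h₁ : RegressorAssumption P 𝓜) :
    ∀ᵐ ω ∂P, ∃ B, 0 ≤ B ∧ ∀ k, 𝓜.M k ω ≤ B ∧ ∀ x ∈ 𝓜.D, |𝓜.φ k ω ⬝ᵥ x| ≤ 𝓜.M k ω := by
  filter_upwards [h₁.M_bounded, ae_all_iff.2 h₁.le_M] with ω ⟨B, hB⟩ h
  exact ⟨max B 0, le_max_right _ _, fun k =>
    ⟨(hB (Set.mem_range_self k)).trans (le_max_left _ _), h k⟩⟩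

variable [IsProbabilityMeasure P]

/-- The bound depends on the sample point but not on `k`. Taking it to be a natural number leaves
only countably many cut-off levels. -/
theorem ae_innovationMoment_le (h₁ : RegressorAssumption P 𝓜) (h₂ : ThresholdAssumption P 𝓜)
    {η p : ℝ} (hη : 0 < η) (hp : 0 ≤ p) (hpη : 2 * p ≤ 2 + η)
    (h : ∀ᵐ ω ∂P, (⨆ k, ∫⁻ t, ENNReal.ofReal (|t| ^ (2 + η)) ∂(𝓜.noiseLaw P k ω)) < ⊤) :
    ∀ᵐ ω ∂P, ∃ N : ℕ, ∀ k, 𝓜.innovationMoment P p k ω ≤ ENNReal.ofReal N := by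
  filter_upwards [h, ae_abs_S_le h₂, ae_abs_dotProduct_le h₁] with ω hω ⟨K, hK0, hK⟩ ⟨B, hB0, hB⟩
  obtain ⟨A, hA⟩ : ∃ A : ℝ, A
    = (⨆ k, ∫⁻ t, ENNReal.ofReal (|t| ^ (2 + η)) ∂(𝓜.noiseLaw P k ω)).toReal := ⟨_, rfl⟩
  have hA0 : 0 ≤ A := hA ▸ ENNReal.toReal_nonneg
  have hA' : ∀ k, ∫⁻ t, ENNReal.ofReal (|t| ^ (2 + η)) ∂(𝓜.noiseLaw P k ω) ≤ ENNReal.ofReal A :=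
    fun k => by
      rw [hA, ENNReal.ofReal_toReal hω.ne]
      exact le_iSup (fun k => ∫⁻ t, ENNReal.ofReal (|t| ^ (2 + η)) ∂(𝓜.noiseLaw P k ω)) k
  obtain ⟨N, hN⟩ := exists_nat_ge
    (1 + 2 ^ (2 + η) * (1 + 2 * (B + K) + A) ^ (2 + η) + 2 ^ (2 + η) * A)
  refine ⟨N, fun k => le_trans ?_ (ENNReal.ofReal_le_ofReal hN)⟩
  refine lintegral_sub_integral_rpow_le (f := fun t => 𝓜.S k ω (𝓜.φ k ω ⬝ᵥ 𝓜.θ + t))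
    (by linarith) hp hpη hA0 (hA' k) (by positivity) fun t => ?_
  have e1 := hK k (𝓜.φ k ω ⬝ᵥ 𝓜.θ + t)
  have e2 := abs_add_le (𝓜.φ k ω ⬝ᵥ 𝓜.θ) t
  have e3 := (hB k).2 𝓜.θ (interior_subset h₁.interior)
  linarith [(hB k).1]

/-- The innovation, cut off where its conditional moment exceeds `N`, as a function of the noise. -/
noncomputable def cutInnovation (𝓜 : Model Ω m) (P : Measure Ω) [IsFiniteMeasure P] (p : ℝ)
    (N : ℕ) (k : ℕ) (q : Ω × ℝ) : ℝ :=
  open Classical in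
  if 𝓜.innovationMoment P p k q.1 ≤ ENNReal.ofReal N then 𝓜.innovationFun P k q.1 q.2 else 0

theorem measurable_cutInnovation (h₁ : RegressorAssumption P 𝓜) (h₂ : ThresholdAssumption P 𝓜)
    (p : ℝ) (N k : ℕ) :
    @Measurable (Ω × ℝ) ℝ ((𝓜.ℱ k).prod inferInstance) _ (𝓜.cutInnovation P p N k) := by
  have h := measurable_innovationMoment h₁ h₂ p k (measurableSet_Iic (a := ENNReal.ofReal N))
  exact Measurable.ite ((@measurable_fst Ω ℝ (𝓜.ℱ k) inferInstance) h)
    (measurable_innovationFun h₁ h₂ k) measurable_const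

theorem lintegral_cutInnovation_le {p : ℝ} (hp : 0 < p) (N k : ℕ) (ω : Ω) :
    ∫⁻ t, ENNReal.ofReal ((𝓜.cutInnovation P p N k (ω, t) ^ 2) ^ p) ∂𝓜.noiseLaw P k ω
      ≤ ENNReal.ofReal N := by
  by_cases h : 𝓜.innovationMoment P p k ω ≤ ENNReal.ofReal N
  · simp only [cutInnovation, h, if_true]
    exact h
  · simp only [cutInnovation, if_neg h]
    simp [Real.zero_rpow hp.ne']

/-- The cut-off is decided by the past, so it preserves mean zero. The finite moment makes the
observation integrable under the noise law, so `G` is a genuine mean there and not the default value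
of the integral. -/
theorem integral_cutInnovation_eq_zero (h₁ : RegressorAssumption P 𝓜)
    (h₂ : ThresholdAssumption P 𝓜) {p : ℝ} (hp : 1 ≤ p) (N k : ℕ) (ω : Ω) :
    ∫ t, 𝓜.cutInnovation P p N k (ω, t) ∂𝓜.noiseLaw P k ω = 0 := by
  by_cases h : 𝓜.innovationMoment P p k ω ≤ ENNReal.ofReal N
  · simp only [cutInnovation, h, if_true]
    have hm : Measurable (𝓜.innovationFun P k ω) :=
      measurable_section (fun q : Ω × ℝ => 𝓜.innovationFun P k q.1 q.2)
        (measurable_innovationFun h₁ h₂ k) ω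
    have hint : Integrable (𝓜.innovationFun P k ω) (𝓜.noiseLaw P k ω) :=
      ((memLp_two_iff_integrable_sq hm.aestronglyMeasurable).2
        (integrable_of_lintegral_rpow_lt_top hp (hm.pow_const 2) (fun t => sq_nonneg _)
          (h.trans_lt ENNReal.ofReal_lt_top))).integrable one_le_two
    have hS : Integrable (fun t => 𝓜.S k ω (𝓜.φ k ω ⬝ᵥ 𝓜.θ + t)) (𝓜.noiseLaw P k ω) := by
      refine (hint.add (integrable_const (𝓜.G P k ω (𝓜.φ k ω ⬝ᵥ 𝓜.θ)))).congr
        (Eventually.of_forall fun t => ?_)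
      simp [innovationFun]
    unfold innovationFun
    rw [integral_sub hS (integrable_const _), integral_const, probReal_univ, one_smul]
    exact sub_self _
  · simp only [cutInnovation, if_neg h, integral_zero]

theorem isBoundedNoise_cutInnovation (h₁ : RegressorAssumption P 𝓜)
    (h₂ : ThresholdAssumption P 𝓜) (h₃ : NoiseAssumption P 𝓜) {p : ℝ} (hp : 1 ≤ p) (N : ℕ) :
    IsBoundedNoise 𝓜.ℱ P (fun k ω => 𝓜.cutInnovation P p N k (ω, 𝓜.e (k + 1) ω)) p N := by
  have hmeas : ∀ k, Measurable[𝓜.ℱ (k + 1)]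
      fun ω => 𝓜.cutInnovation P p N k (ω, 𝓜.e (k + 1) ω) := fun k =>
    measurable_comp_graph (𝓜.ℱ.mono k.le_succ) _ (measurable_cutInnovation h₁ h₂ p N k)
      (h₃.adapted k)
  have hmom : ∀ k, ∀ f : Ω → ℝ≥0∞, Measurable[𝓜.ℱ k] f →
      ∫⁻ ω, f ω * ENNReal.ofReal ((𝓜.cutInnovation P p N k (ω, 𝓜.e (k + 1) ω) ^ 2) ^ p) ∂P
        ≤ ENNReal.ofReal N * ∫⁻ ω, f ω ∂P := by
    intro k f hf
    have hg := (((measurable_cutInnovation h₁ h₂ p N k).pow_const 2).pow_const p).ennreal_ofReal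
    have h := lintegral_noise h₃ k
      (f := fun q => f q.1 * ENNReal.ofReal ((𝓜.cutInnovation P p N k q ^ 2) ^ p))
      ((hf.comp (@measurable_fst Ω ℝ (𝓜.ℱ k) inferInstance)).mul hg)
    refine h.le.trans ?_
    rw [← lintegral_const_mul' _ _ ENNReal.ofReal_ne_top]
    refine lintegral_mono fun ω => ?_
    have hω := measurable_section (m := 𝓜.ℱ k) _ hg ω
    change ∫⁻ t, f ω * ENNReal.ofReal ((𝓜.cutInnovation P p N k (ω, t) ^ 2) ^ p)
      ∂𝓜.noiseLaw P k ω ≤ _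
    rw [lintegral_const_mul _ hω, mul_comm]
    exact mul_le_mul_left (lintegral_cutInnovation_le (by linarith) N k ω) _
  refine ⟨hmeas, fun k => ?_, hmom⟩
  have hmk : Measurable fun ω => 𝓜.cutInnovation P p N k (ω, 𝓜.e (k + 1) ω) :=
    (hmeas k).mono (𝓜.ℱ.le _) le_rfl
  have hint : Integrable (fun ω => 𝓜.cutInnovation P p N k (ω, 𝓜.e (k + 1) ω)) P := by
    refine ((memLp_two_iff_integrable_sq hmk.aestronglyMeasurable).2
      (integrable_of_lintegral_rpow_lt_top hp (hmk.pow_const 2) (fun t => sq_nonneg _)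
        ?_)).integrable one_le_two
    have h := hmom k (fun _ => 1) measurable_const
    simp only [one_mul, lintegral_one, measure_univ, mul_one] at h
    exact h.trans_lt ENNReal.ofReal_lt_top
  have h := @condExp_prod_ae_eq_integral_condDistrib Ω Ω ℝ ℝ _ _ _ _ mΩ P _ id (𝓜.e (k + 1))
    (𝓜.ℱ k) (𝓜.cutInnovation P p N k) _ _ (measurable_id'' (𝓜.ℱ.le k))
    (measurable_e h₃ k).aemeasurable (measurable_cutInnovation h₁ h₂ p N k).stronglyMeasurable hint
  rw [MeasurableSpace.comap_id] at h
  exact h.trans (Eventually.of_forall fun ω => integral_cutInnovation_eq_zero h₁ h₂ hp N k ω)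

/-- The innovations form, up to localization, a martingale difference sequence with bounded
conditional moments of some order larger than two. -/
theorem exists_isBoundedNoise (h₁ : RegressorAssumption P 𝓜) (h₂ : ThresholdAssumption P 𝓜)
    (h₃ : NoiseAssumption P 𝓜) :
    ∃ p : ℝ, 1 < p ∧ p ≤ 2 ∧ ∃ w : ℕ → ℕ → Ω → ℝ,
      (∀ N : ℕ, IsBoundedNoise 𝓜.ℱ P (w N) p N) ∧
      ∀ᵐ ω ∂P, ∃ N, ∀ k, w N k ω = 𝓜.innovation P k ω := by
  obtain ⟨η, hη, -, hmom⟩ := h₃.moments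
  -- The order `2 * p` must not exceed `2 + η`, and the truncation argument requires `p ≤ 2`.
  refine ⟨min (1 + η / 2) 2, lt_min (by linarith) one_lt_two, min_le_right _ _, _,
    fun N => isBoundedNoise_cutInnovation h₁ h₂ h₃ (le_min (by linarith) one_le_two) N, ?_⟩
  have h := ae_innovationMoment_le h₁ h₂ (p := min (1 + η / 2) 2) hη
    (le_min (by linarith) zero_le_two) (by linarith [min_le_left (1 + η / 2) 2]) hmom
  filter_upwards [h] with ω ⟨N, hN⟩
  exact ⟨N, fun k => if_pos (hN k)⟩

theorem ae_abs_sum_innovation_le (h₁ : RegressorAssumption P 𝓜) (h₂ : ThresholdAssumption P 𝓜)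
    (h₃ : NoiseAssumption P 𝓜) {c : ℕ → Ω → ℝ} (hc : ∀ k, AEMeasWrt (𝓜.ℱ k) P (c k)) :
    ∀ᵐ ω ∂P, ∀ ε > 0, ∃ C, ∀ n, |∑ k ∈ Finset.range n, c k ω * 𝓜.innovation P k ω|
      ≤ ε * ∑ k ∈ Finset.range n, c k ω ^ 2 + C := by
  obtain ⟨p, hp, -, w, hw, hloc⟩ := exists_isBoundedNoise h₁ h₂ h₃
  choose c' hc' hcc' using hc
  filter_upwards [ae_all_iff.2 fun N => (hw N).ae_abs_sum_le hp.le hc', hloc, ae_all_iff.2 hcc']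
    with ω h ⟨N, hN⟩ hc
  have h := h N
  simp only [hN] at h
  simpa only [hc] using h

theorem ae_sum_mul_innovation_sq_le (h₁ : RegressorAssumption P 𝓜)
    (h₂ : ThresholdAssumption P 𝓜) (h₃ : NoiseAssumption P 𝓜) {d : ℕ → Ω → ℝ}
    (hd : ∀ k, AEMeasWrt (𝓜.ℱ k) P (d k)) (hd01 : ∀ᵐ ω ∂P, ∀ k, 0 ≤ d k ω ∧ d k ω ≤ 1) :
    ∀ᵐ ω ∂P, ∃ C, 0 ≤ C ∧ ∀ n, ∑ k ∈ Finset.range n, d k ω * 𝓜.innovation P k ω ^ 2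
      ≤ C * (1 + ∑ k ∈ Finset.range n, d k ω) := by
  obtain ⟨p, hp, hp2, w, hw, hloc⟩ := exists_isBoundedNoise h₁ h₂ h₃
  choose d' hd' hdd' using hd
  -- The measurable version `d'` lies in `[0, 1]` only almost surely, while the martingale bound
  -- wants this everywhere; hence the clamping.
  have h := fun N : ℕ => (hw N).ae_sum_mul_sq_le hp hp2 N.cast_nonneg
    (d := fun k ω => max 0 (min 1 (d' k ω)))
    (fun k => measurable_const.max (measurable_const.min (hd' k)))
    (fun k ω => le_max_left _ _) (fun k ω => max_le zero_le_one (min_le_left _ _))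
  filter_upwards [ae_all_iff.2 h, hloc, ae_all_iff.2 hdd', hd01] with ω h ⟨N, hN⟩ hd hd01
  have hd2 : ∀ k, max 0 (min 1 (d' k ω)) = d k ω := fun k => by
    rw [← hd k, min_eq_right (hd01 k).2, max_eq_right (hd01 k).1]
  have h := h N
  simp only [hN, hd2] at h
  exact h

end Model

/-! ### Growth of the largest eigenvalue -/

/-- A monotone sequence that does not tend to `1` either exceeds `1` at some time or has supremum
below `1`. In both cases `|log|` is eventually at least some `ε > 0`, and the constant `1` is
absorbed at the price of `1 / ε`. -/
theorem isBigO_log_of_monotone {f lam : ℕ → ℝ} (hmono : Monotone lam) (hpos : 0 < lam 0)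
    (hf0 : ∀ k, 0 ≤ f k) {C : ℝ} (hf : ∀ k, f k ≤ C * (1 + max 0 (Real.log (lam k))))
    (h : f = 0 ∨ ¬ Tendsto lam atTop (𝓝 1)) : f =O[atTop] fun k => Real.log (lam k) := by
  rcases h with rfl | h
  · exact Asymptotics.isBigO_zero _ _
  have hC : 0 ≤ C := by
    have h1 := (hf0 0).trans (hf 0)
    by_contra hneg
    have := le_max_left 0 (Real.log (lam 0))
    nlinarith
  have hlam : ∀ k, 0 < lam k := fun k => hpos.trans_le (hmono k.zero_le)
  obtain ⟨ε, hε, hev⟩ : ∃ ε > 0, ∀ᶠ k in atTop, ε ≤ |Real.log (lam k)| := by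
    by_cases h1 : ∃ k, 1 < lam k
    · obtain ⟨k, hk⟩ := h1
      refine ⟨Real.log (lam k), Real.log_pos hk, (eventually_ge_atTop k).mono fun n hn => ?_⟩
      exact (Real.log_le_log (hlam k) (hmono hn)).trans (le_abs_self _)
    · push Not at h1
      have hbdd : BddAbove (Set.range lam) := ⟨1, by rintro _ ⟨k, rfl⟩; exact h1 k⟩
      have hsup := tendsto_atTop_ciSup hmono hbdd
      have hsup1 : (⨆ k, lam k) < 1 := lt_of_le_of_ne (ciSup_le h1) fun h2 => h (h2 ▸ hsup)
      have hsup0 : 0 < ⨆ k, lam k := hpos.trans_le (le_ciSup hbdd 0)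
      refine ⟨-Real.log (⨆ k, lam k), neg_pos.2 (Real.log_neg hsup0 hsup1),
        Eventually.of_forall fun n => ?_⟩
      exact (neg_le_neg (Real.log_le_log (hlam n) (le_ciSup hbdd n))).trans (neg_le_abs _)
  refine Asymptotics.IsBigO.of_bound (C * (1 / ε + 1)) (hev.mono fun k hk => ?_)
  rw [Real.norm_eq_abs, Real.norm_eq_abs, abs_of_nonneg (hf0 k), mul_assoc]
  refine (hf k).trans (mul_le_mul_of_nonneg_left ?_ hC)
  have h1 : 1 ≤ 1 / ε * |Real.log (lam k)| := by
    rw [one_div, ← div_eq_inv_mul]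
    exact (one_le_div hε).2 hk
  have h2 : max 0 (Real.log (lam k)) ≤ |Real.log (lam k)| :=
    max_le (abs_nonneg _) (le_abs_self _)
  linarith

/-! ### The estimates along the sample paths -/

namespace Model

variable {Ω : Type*} [mΩ : MeasurableSpace Ω] {m : ℕ} {P : Measure Ω} [IsProbabilityMeasure P]
  {𝓜 : Model Ω m}

theorem ae_isGoodPath (h₁ : RegressorAssumption P 𝓜) (h₃ : NoiseAssumption P 𝓜) :
    ∀ᵐ ω ∂P, ∃ a b B, IsGoodPath 𝓜.D 𝓜.θ (fun k => 𝓜.G P k ω) (fun k => 𝓜.M k ω)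
      (fun k => 𝓜.φ k ω) a b B := by
  obtain ⟨M, -, -, -, -, hM, hab, -⟩ := h₃.derivBounds
  filter_upwards [hM, hab, h₁.bounded, h₁.M_bounded, ae_all_iff.2 h₁.le_M,
    ae_all_iff.2 h₃.differentiable] with ω hM ⟨a, b, ha, hab⟩ ⟨C, hC⟩ hbdd hle hdiff
  have hMk : ∀ k, 𝓜.M k ω < M ω := fun k => (le_ciSup hbdd k).trans_lt hM
  -- The regressors are bounded in the sup norm, so their Euclidean squares are at most `m * C ^ 2`.
  refine ⟨a, b, max (M ω) (m * C ^ 2), ⟨h₁.compact, h₁.convex, interior_subset h₁.interior, hle,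
    fun k => (hMk k).le.trans (le_max_left _ _), fun k => le_trans ?_ (le_max_right _ _), hdiff, ha,
    fun k x hx => hab k x (hx.trans (hMk k).le)⟩⟩
  have h1 : ∀ i ∈ (Finset.univ : Finset (Fin m)), 𝓜.φ k ω i * 𝓜.φ k ω i ≤ C ^ 2 := fun i _ => by
    rw [← sq, ← sq_abs]
    exact pow_le_pow_left₀ (abs_nonneg _) ((norm_le_pi_norm (𝓜.φ k ω) i).trans (hC k)) 2
  refine (Finset.sum_le_sum h1).trans (le_of_eq ?_)
  simp

theorem ae_continuousOn_deriv (h₁ : RegressorAssumption P 𝓜) (h₃ : NoiseAssumption P 𝓜) (k : ℕ) :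
    ∀ᵐ ω ∂P, ContinuousOn (deriv (𝓜.G P k ω)) {x | |x| ≤ 𝓜.M k ω} := by
  obtain ⟨M, ρ, -, -, hρ, hM, -, hlip⟩ := h₃.derivBounds
  filter_upwards [hM, hlip, h₁.M_bounded] with ω hM hlip hbdd
  have hMk : 𝓜.M k ω ≤ M ω := (le_ciSup hbdd k).trans hM.le
  refine (LipschitzOnWith.of_dist_le_mul (K := ⟨ρ ω, hρ ω⟩) fun x hx y hy => ?_).continuousOn
  exact hlip k x y (le_trans hx hMk) (le_trans hy hMk)

variable (𝓜 P) in
/-- The gain matrix `P̄ₖ`. -/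
noncomputable def gainBar (θbar₀ : Fin m → ℝ) (Pbar₀ : Matrix (Fin m) (Fin m) ℝ) (k : ℕ) (ω : Ω) :
    Matrix (Fin m) (Fin m) ℝ :=
  (step1 𝓜.D (fun i => 𝓜.G P i ω) (fun i => 𝓜.gLow P i ω) (fun i => 𝓜.gUp P i ω)
    (fun i => 𝓜.φ i ω) (fun i => 𝓜.yNext i ω) θbar₀ Pbar₀ k).2

variable (𝓜 P) in
/-- The coefficient `β̄ₖ`. -/
noncomputable def coeffBar (θbar₀ : Fin m → ℝ) (Pbar₀ : Matrix (Fin m) (Fin m) ℝ) (k : ℕ) (ω : Ω) :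
    ℝ :=
  betaBar (𝓜.gLow P k ω) (𝓜.gUp P k ω) (𝓜.gainBar P θbar₀ Pbar₀ k ω) (𝓜.φ k ω)

variable (𝓜 P) in
/-- The gain matrix `Pₖ`. -/
noncomputable def gain (μ : ℕ → Ω → ℝ) (θbar₀ : Fin m → ℝ) (Pbar₀ : Matrix (Fin m) (Fin m) ℝ)
    (θhat₀ : Fin m → ℝ) (P₀ : Matrix (Fin m) (Fin m) ℝ) (k : ℕ) (ω : Ω) :
    Matrix (Fin m) (Fin m) ℝ :=
  (step2 𝓜.D (fun i => 𝓜.G P i ω) (fun i => 𝓜.φ i ω) (fun i => 𝓜.yNext i ω)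
    (fun i => 𝓜.thetaBar P θbar₀ Pbar₀ i ω) (fun i => μ i ω) θhat₀ P₀ k).2

variable (𝓜 P) in
/-- The coefficient `βₖ`. -/
noncomputable def coeff (μ : ℕ → Ω → ℝ) (θbar₀ : Fin m → ℝ) (Pbar₀ : Matrix (Fin m) (Fin m) ℝ)
    (θhat₀ : Fin m → ℝ) (P₀ : Matrix (Fin m) (Fin m) ℝ) (k : ℕ) (ω : Ω) : ℝ :=
  beta (𝓜.G P k ω) (𝓜.φ k ω) (𝓜.thetaBar P θbar₀ Pbar₀ k ω)
    (𝓜.thetaHat P μ θbar₀ Pbar₀ θhat₀ P₀ k ω)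

variable {μ : ℕ → Ω → ℝ} {θbar₀ θhat₀ : Fin m → ℝ} {Pbar₀ P₀ : Matrix (Fin m) (Fin m) ℝ}

theorem isQuasiNewton_thetaBar (hθ : θbar₀ ∈ 𝓜.D) (hP : Pbar₀.PosDef) (ω : Ω) :
    IsQuasiNewton 𝓜.D (fun k => 𝓜.G P k ω) (fun k => 𝓜.φ k ω) (fun k => 𝓜.yNext k ω)
      (fun _ => 1) (fun k => 𝓜.coeffBar P θbar₀ Pbar₀ k ω)
      (fun k => 𝓜.thetaBar P θbar₀ Pbar₀ k ω) fun k => 𝓜.gainBar P θbar₀ Pbar₀ k ω :=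
  ⟨hP, hθ, fun _ => rfl, fun _ => rfl⟩

theorem isQuasiNewton_thetaHat (hθ : θhat₀ ∈ 𝓜.D) (hP : P₀.PosDef) (ω : Ω) :
    IsQuasiNewton 𝓜.D (fun k => 𝓜.G P k ω) (fun k => 𝓜.φ k ω) (fun k => 𝓜.yNext k ω)
      (fun k => μ k ω) (fun k => 𝓜.coeff P μ θbar₀ Pbar₀ θhat₀ P₀ k ω)
      (fun k => 𝓜.thetaHat P μ θbar₀ Pbar₀ θhat₀ P₀ k ω)
      fun k => 𝓜.gain P μ θbar₀ Pbar₀ θhat₀ P₀ k ω :=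
  ⟨hP, hθ, fun _ => rfl, fun _ => rfl⟩

theorem aeMeasWrt_coeffBar (h₁ : RegressorAssumption P 𝓜) (h₂ : ThresholdAssumption P 𝓜)
    (h₃ : NoiseAssumption P 𝓜) (k : ℕ)
    (hP : AEMeasWrt (𝓜.ℱ k) P (𝓜.gainBar P θbar₀ Pbar₀ k)) :
    AEMeasWrt (𝓜.ℱ k) P (𝓜.coeffBar P θbar₀ Pbar₀ k) := by
  obtain ⟨hlow, hup⟩ := aeMeasWrt_gLow_gUp h₂ h₃ k (.of_measurable (h₁.M_adapted k))
    (by filter_upwards [ae_isGoodPath h₁ h₃] with ω ⟨a, b, B, h⟩ using h.M_nonneg k)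
    (ae_continuousOn_deriv h₁ h₃ k)
    (by
      filter_upwards [ae_isGoodPath h₁ h₃] with ω ⟨a, b, B, h⟩
      exact ⟨h.bddBelow_deriv k, h.bddAbove_deriv k⟩)
  have hq : AEMeasWrt (𝓜.ℱ k) P fun ω =>
      𝓜.φ k ω ⬝ᵥ (𝓜.gainBar P θbar₀ Pbar₀ k ω *ᵥ 𝓜.φ k ω) :=
    (hP.prodMk (.of_measurable (h₁.adapted k))).comp measurable_quadForm
  exact (hlow.prodMk (hup.prodMk hq)).comp
    (F := fun p : ℝ × ℝ × ℝ => min p.1 (1 / (2 * p.2.1 * p.2.2 + 1))) (by fun_prop)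

theorem aeMeasWrt_beta (h₂ : ThresholdAssumption P 𝓜) (h₃ : NoiseAssumption P 𝓜) (k : ℕ)
    {φ θbar θhat : Ω → Fin m → ℝ} (hφ : AEMeasWrt (𝓜.ℱ k) P φ)
    (hbar : AEMeasWrt (𝓜.ℱ k) P θbar) (hhat : AEMeasWrt (𝓜.ℱ k) P θhat) :
    AEMeasWrt (𝓜.ℱ k) P fun ω => beta (𝓜.G P k ω) (φ ω) (θbar ω) (θhat ω) := by
  classical
  have hx : AEMeasWrt (𝓜.ℱ k) P fun ω => φ ω ⬝ᵥ θbar ω :=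
    (hφ.prodMk hbar).comp measurable_dotProduct
  have hz : AEMeasWrt (𝓜.ℱ k) P fun ω => φ ω ⬝ᵥ θhat ω :=
    (hφ.prodMk hhat).comp measurable_dotProduct
  unfold beta
  refine AEMeasWrt.ite (q := fun t : ℝ => t ≠ 0) (hz.comp₂ hx (F := fun s t => s - t) (by fun_prop))
    (measurableSet_singleton 0).compl (fun _ => Iff.rfl) ?_ (aeMeasWrt_deriv_G h₂ h₃ k hz)
  exact ((aeMeasWrt_G h₂ k hx).prodMk ((aeMeasWrt_G h₂ k hz).prodMk (hx.prodMk hz))).comp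
    (F := fun p : ℝ × ℝ × ℝ × ℝ => (p.1 - p.2.1) / (p.2.2.1 - p.2.2.2)) (by fun_prop)

/-- The sums of the innovations along a quasi-Newton recursion with adapted coefficients. -/
theorem ae_innovation_bounds (h₁ : RegressorAssumption P 𝓜) (h₂ : ThresholdAssumption P 𝓜)
    (h₃ : NoiseAssumption P 𝓜) {β : ℕ → Ω → ℝ} {θ' : ℕ → Ω → Fin m → ℝ}
    {Q : ℕ → Ω → Matrix (Fin m) (Fin m) ℝ}
    (hQ : ∀ ω, IsQuasiNewton 𝓜.D (fun k => 𝓜.G P k ω) (fun k => 𝓜.φ k ω) (fun k => 𝓜.yNext k ω)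
      (fun k => μ k ω) (fun k => β k ω) (fun k => θ' k ω) fun k => Q k ω)
    (hμ : ∀ᵐ ω ∂P, ∀ k, 0 < μ k ω) (hμm : ∀ k, AEMeasWrt (𝓜.ℱ k) P (μ k))
    (hβm : ∀ k, AEMeasWrt (𝓜.ℱ k) P (β k)) (hθm : ∀ k, AEMeasWrt (𝓜.ℱ k) P (θ' k))
    (hQm : ∀ k, AEMeasWrt (𝓜.ℱ k) P (Q k)) :
    ∀ᵐ ω ∂P, (∀ ε > 0, ∃ C, ∀ n, |∑ k ∈ Finset.range n,
        β k ω * (𝓜.φ k ω ⬝ᵥ (𝓜.θ - θ' k ω)) / μ k ω * 𝓜.innovation P k ω|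
        ≤ ε * ∑ k ∈ Finset.range n, (β k ω * (𝓜.φ k ω ⬝ᵥ (𝓜.θ - θ' k ω)) / μ k ω) ^ 2 + C) ∧
      ∃ C, 0 ≤ C ∧ ∀ n, ∑ k ∈ Finset.range n,
        normGain (Q k ω) (𝓜.φ k ω) (μ k ω) (β k ω) * 𝓜.innovation P k ω ^ 2
        ≤ C * (1 + ∑ k ∈ Finset.range n, normGain (Q k ω) (𝓜.φ k ω) (μ k ω) (β k ω)) := by
  have hφ : ∀ k, AEMeasWrt (𝓜.ℱ k) P (𝓜.φ k) := fun k => .of_measurable (h₁.adapted k)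
  have hc : ∀ k, AEMeasWrt (𝓜.ℱ k) P fun ω =>
      β k ω * (𝓜.φ k ω ⬝ᵥ (𝓜.θ - θ' k ω)) / μ k ω := fun k =>
    ((hβm k).prodMk ((hμm k).prodMk (((hφ k).prodMk ((hθm k).comp
      (measurable_id.const_sub 𝓜.θ))).comp measurable_dotProduct))).comp
      (F := fun p : ℝ × ℝ × ℝ => p.1 * p.2.2 / p.2.1) (by fun_prop)
  have hd : ∀ k, AEMeasWrt (𝓜.ℱ k) P fun ω =>
      normGain (Q k ω) (𝓜.φ k ω) (μ k ω) (β k ω) := fun k =>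
    ((hβm k).prodMk ((hμm k).prodMk (((hQm k).prodMk (hφ k)).comp measurable_quadForm))).comp
      (F := fun p : ℝ × ℝ × ℝ => p.1 ^ 2 * p.2.2 / (p.2.1 + p.1 ^ 2 * p.2.2)) (by fun_prop)
  have hd01 : ∀ᵐ ω ∂P, ∀ k, 0 ≤ normGain (Q k ω) (𝓜.φ k ω) (μ k ω) (β k ω) ∧
      normGain (Q k ω) (𝓜.φ k ω) (μ k ω) (β k ω) ≤ 1 := by
    filter_upwards [hμ] with ω hμ k
    exact ⟨normGain_nonneg ((hQ ω).posDef hμ k) _ (hμ k) _,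
      normGain_le_one ((hQ ω).posDef hμ k) _ (hμ k) _⟩
  filter_upwards [ae_abs_sum_innovation_le h₁ h₂ h₃ hc,
    ae_sum_mul_innovation_sq_le h₁ h₂ h₃ hd hd01]
    with ω h h' using ⟨h, h'⟩

theorem ae_sum_sq_le (hm : 1 ≤ m) (h₁ : RegressorAssumption P 𝓜) (h₂ : ThresholdAssumption P 𝓜)
    (h₃ : NoiseAssumption P 𝓜) (hμ_adapted : Adapted 𝓜.ℱ μ)
    (hμ_bounds : ∀ᵐ ω ∂P, ∃ a b : ℝ, 0 < a ∧ ∀ k, a ≤ μ k ω ∧ μ k ω ≤ b)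
    (hθbar₀ : θbar₀ ∈ 𝓜.D) (hθhat₀ : θhat₀ ∈ 𝓜.D) (hPbar₀ : Pbar₀.PosDef) (hP₀ : P₀.PosDef)
    {lam₀ : ℝ} (hlam₀ : 0 ≤ lam₀) :
    ∀ᵐ ω ∂P, ∃ C, 0 ≤ C ∧ ∀ k, ∑ i ∈ Finset.range (k + 1),
      (𝓜.G P i ω (𝓜.φ i ω ⬝ᵥ 𝓜.θ)
        - 𝓜.G P i ω (𝓜.φ i ω ⬝ᵥ 𝓜.thetaHat P μ θbar₀ Pbar₀ θhat₀ P₀ i ω)) ^ 2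
      ≤ C * (1 + max 0 (Real.log (𝓜.lambdaMax lam₀ k ω))) := by
  have hne : 𝓜.D.Nonempty := ⟨_, hθbar₀⟩
  have hφ : ∀ k, AEMeasWrt (𝓜.ℱ k) P (𝓜.φ k) := fun k => .of_measurable (h₁.adapted k)
  have hy : ∀ k, AEMeasWrt (𝓜.ℱ (k + 1)) P (𝓜.yNext k) := fun k =>
    .of_measurable (measurable_yNext h₁ h₂ h₃ k)
  have hbar := fun ω => isQuasiNewton_thetaBar (P := P) hθbar₀ hPbar₀ ω
  have hhat := fun ω => isQuasiNewton_thetaHat (P := P) (μ := μ) (θbar₀ := θbar₀)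
    (Pbar₀ := Pbar₀) hθhat₀ hP₀ ω
  have hμ : ∀ᵐ ω ∂P, ∀ k, 0 < μ k ω := by
    filter_upwards [hμ_bounds] with ω ⟨a, b, ha, h⟩ k using ha.trans_le (h k).1
  have hμm : ∀ k, AEMeasWrt (𝓜.ℱ k) P (μ k) := fun k => .of_measurable (hμ_adapted k)
  have hbarm := aeMeasWrt_quasiNewton (μ := fun _ _ => 1) (G := 𝓜.G P)
    (θhat := 𝓜.thetaBar P θbar₀ Pbar₀) h₁.compact hne h₁.convex hPbar₀
    (Eventually.of_forall hbar) (Eventually.of_forall fun _ _ => one_pos) (fun _ => rfl)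
    (fun _ => rfl) hφ (fun _ => .const 1) hy (fun k _ => aeMeasWrt_G h₂ k)
    (fun k _ => aeMeasWrt_coeffBar h₁ h₂ h₃ k)
  have hhatm := aeMeasWrt_quasiNewton (μ := μ) (G := 𝓜.G P)
    (θhat := 𝓜.thetaHat P μ θbar₀ Pbar₀ θhat₀ P₀) h₁.compact hne h₁.convex hP₀
    (Eventually.of_forall hhat) hμ (fun _ => rfl)
    (fun _ => rfl) hφ hμm hy (fun k _ => aeMeasWrt_G h₂ k)
    (fun k h _ => aeMeasWrt_beta h₂ h₃ k (hφ k) (hbarm k).1 h)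
  have hbar_bounds := ae_innovation_bounds (μ := fun _ _ => 1) h₁ h₂ h₃ hbar
    (Eventually.of_forall fun _ _ => one_pos) (fun _ => .const 1)
    (fun k => aeMeasWrt_coeffBar h₁ h₂ h₃ k (hbarm k).2.1) (fun k => (hbarm k).1)
    fun k => (hbarm k).2.1
  have hhat_bounds := ae_innovation_bounds h₁ h₂ h₃ hhat hμ hμm
    (fun k => aeMeasWrt_beta h₂ h₃ k (hφ k) (hbarm k).1 (hhatm k).1) (fun k => (hhatm k).1)
    fun k => (hhatm k).2.1
  filter_upwards [ae_isGoodPath h₁ h₃, hbar_bounds, hhat_bounds, hμ_bounds]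
    with ω ⟨a, b, B, hpath⟩ hb hh ⟨μ₀, μ₁, hμ₀, hμ⟩
  have hfirst := hpath.sum_sq_first_le (hbar ω) (fun _ => rfl) hlam₀ hm hb.1 hb.2
  exact hpath.sum_sq_second_le ((hbar ω).mem h₁.compact hne) (hhat ω) (fun _ => rfl) hμ₀ hμ hlam₀
    hm hfirst hh.1 hh.2

end Model

end TSQN

/-! ### The regret bound -/

theorem theorem2 {Ω : Type*} [MeasurableSpace Ω] (P : Measure Ω) [IsProbabilityMeasure P]
    {m : ℕ} (hm : 1 ≤ m) (𝓜 : TSQN.Model Ω m)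
    (h₁ : TSQN.RegressorAssumption P 𝓜)
    (h₂ : TSQN.ThresholdAssumption P 𝓜)
    (h₃ : TSQN.NoiseAssumption P 𝓜)
    (μ : ℕ → Ω → ℝ) (hμ_adapted : Adapted 𝓜.ℱ μ)
    (hμ_bounds : ∀ᵐ ω ∂P, ∃ a b : ℝ, 0 < a ∧ ∀ k, a ≤ μ k ω ∧ μ k ω ≤ b)
    (θbar₀ θhat₀ : Fin m → ℝ) (hθbar₀ : θbar₀ ∈ 𝓜.D) (hθhat₀ : θhat₀ ∈ 𝓜.D)
    (Pbar₀ P₀ : Matrix (Fin m) (Fin m) ℝ) (hPbar₀ : Pbar₀.PosDef) (hP₀ : P₀.PosDef)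
    (lam₀ : ℝ) (hlam₀ : ‖Matrix.toEuclideanCLM (𝕜 := ℝ) P₀⁻¹‖ < lam₀) :
    ∀ᵐ ω ∂P,
      (1 ≤ lam₀ ∨ ¬ Tendsto (fun k => 𝓜.lambdaMax lam₀ k ω) atTop (𝓝 1)) →
        (fun k => ∑ i ∈ Finset.Icc 1 k, 𝓜.regret P μ θbar₀ Pbar₀ θhat₀ P₀ i ω)
          =O[atTop] (fun k => Real.log (𝓜.lambdaMax lam₀ k ω)) := by
  have hlam : 0 < lam₀ := (norm_nonneg _).trans_lt hlam₀
  have hregret := ae_all_iff.2 (TSQN.Model.condMean_yNext_ae_eq h₁ h₂ h₃)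
  filter_upwards [TSQN.Model.ae_sum_sq_le hm h₁ h₂ h₃ hμ_adapted hμ_bounds hθbar₀ hθhat₀ hPbar₀ hP₀
    hlam.le, hregret] with ω ⟨C, hC0, hC⟩ hregret hcase
  have hreg : ∀ i, 𝓜.regret P μ θbar₀ Pbar₀ θhat₀ P₀ i ω
      = (𝓜.G P i ω (𝓜.φ i ω ⬝ᵥ 𝓜.θ)
        - 𝓜.G P i ω (𝓜.φ i ω ⬝ᵥ 𝓜.thetaHat P μ θbar₀ Pbar₀ θhat₀ P₀ i ω)) ^ 2 := fun i => by
    rw [TSQN.Model.regret, hregret]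
  have hmono : Monotone fun k => 𝓜.lambdaMax lam₀ k ω :=
    TSQN.sSup_spectrum_infoMatrix_mono hm lam₀ fun i => 𝓜.φ i ω
  have hge : ∀ k, lam₀ ≤ 𝓜.lambdaMax lam₀ k ω :=
    TSQN.le_sSup_spectrum_infoMatrix hm lam₀ fun i => 𝓜.φ i ω
  simp only [hreg]
  refine TSQN.isBigO_log_of_monotone hmono (hlam.trans_le (hge 0))
    (fun k => Finset.sum_nonneg fun i _ => sq_nonneg _) (C := C) (fun k => ?_) ?_
  -- The path bound also contains the nonnegative term `i = 0`, which is dropped.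
  · refine (Finset.sum_le_sum_of_subset_of_nonneg (fun i hi => ?_) fun i _ _ => sq_nonneg _).trans
      (hC k)
    rw [Finset.mem_Icc] at hi
    exact Finset.mem_range.2 (by omega)
  -- If all regressors vanish then so do the regrets, which covers the case where the largest
  -- eigenvalue is constantly `lam₀ = 1`.
  · by_cases hφ : ∀ i, 𝓜.φ i ω = 0
    · left
      funext k
      exact Finset.sum_eq_zero fun i _ => by simp [hφ i]
    · right
      rcases hcase with h1 | h1
      · push Not at hφ
        obtain ⟨j, hj⟩ := hφ
        have h2 : lam₀ < 𝓜.lambdaMax lam₀ j ω :=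
          TSQN.lt_sSup_spectrum_infoMatrix lam₀ (fun i => 𝓜.φ i ω) hj
        -- Once a nonzero regressor has appeared, the largest eigenvalue exceeds `lam₀ ≥ 1`, and by
        -- monotonicity it cannot return to `1` in the limit.
        exact fun h3 => absurd (hmono.ge_of_tendsto h3 j) (not_le.2 (h1.trans_lt h2))
      · exact h1
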